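/- Let $X_t=\Psi(X_{t-1},\varepsilon_t)$, $t=1,2,\dots$, where $\varepsilon_1,\varepsilon_2,\dots$ are i.i.d. random elements of a measurable space $\mathbb S$, independent of the real random variable $X_0$, and $\Psi:\mathbb R\times\mathbb S\to\mathbb R$ is measurable; assume that $\Psi(X_0,\varepsilon_1)$ and $X_0$ are equal in law (so that $\{X_t\}$ is stationary). Assume: (a) there are $0<\alpha<\infty$ and $0\le p\le 1$ with $P(|X_0|>xy)/P(|X_0|>x)\to y^{-\alpha}$ for all $y>0$ and $P(X_0>x)/P(|X_0|>x)\to p$ as $x\to\infty$; put $p(1)=p$, $p(-1)=1-p$; (b) there is a measurable $\mathbb V\subset\mathbb S$ with $P(\varepsilon_1\in\mathbb V)=1$ such that $\lim_{x\to\sigma\infty}x^{-1}\Psi(x,v)=\phi(v,\sigma)$ exists in $\mathbb R$ for every $v\in\mathbb V$ and every $\sigma\in\{-1,1\}$ with $p(\sigma)>0$; moreover, if $P(\phi(\varepsilon_1,\sigma)=0)>0$ for some such $\sigma$, then there is a measurable $\mathbb W\subset\mathbb V$ with $P(\varepsilon_1\in\mathbb W)=1$ and $\sup_{|y|\le x}|\Psi(y,v)|=O(x)$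 as $x\to\infty$ for all $v\in\mathbb W$. Write $(x)_+=\max(x,0)$. Let $\mathcal M_{p,\alpha}$ be the set of laws of pairs $(I,M)$ with $P(I=1)=p=1-P(I=-1)$ and $E[(\sigma M)_+^\alpha]\le P(I=\sigma)$ for $\sigma=\pm1$; the laws of $(I,M)$ and $(I^*,M^*)$ in $\mathcal M_{p,\alpha}$ are adjoint if $E[(xI)_+^\alpha\wedge(yM)_+^\alpha]=E[(xM^*)_+^\alpha\wedge(yI^*)_+^\alpha]$ for all real $x,y$. A back-and-forth tail chain with index $\alpha$ and forward transition law $\mu\in\mathcal M_{p,\alpha}$ is a process $\{M_t:t\in\mathbb Z\}$ such that $(M_0,M_1)$ has law $\mu$; the law of $(M_0,M_{-1})$ belongs to $\mathcal M_{p,\alpha}$ and is adjoint to $\mu$; and, for $t\ge1$, the conditional law of $M_{\pm t}$ given $M_{\pm(t-1)}=x$ and $M_{\pm(t-2)},M_{\pm(t-3)},\dots$ (all the indices beyond, continued through both sides of $0$) is the law of $xM_{\pm1}/M_0$ given $M_0=\operatorname{sign}x$ if $x\ne0$, and the point mass at $0$ if $x=0$. Let $\mu$ be the law of $(M_0,M_0\,\phi(\varepsilon_1,M_0))$,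 where $M_0$ is independent of $\varepsilon_1$ and $P(M_0=\sigma)=p(\sigma)$ for $\sigma=\pm1$. Then $\mu\in\mathcal M_{p,\alpha}$, a back-and-forth tail chain with index $\alpha$ and forward transition law $\mu$ exists, and for every integer $t\ge0$: (i) for all $x_0,\dots,x_t\in\mathbb R$ the limit $$l_t(x_0,\dots,x_t)=\lim_{x\to\infty}\frac{P(x_0X_0>x\text{ or }\dots\text{ or }x_tX_t>x)}{P(|X_0|>x)}$$ exists in $[0,\infty)$ and, for any such tail chain $\{M_t\}$, equals $$E\Bigl[\bigvee_{j=0}^t(x_jM_j)_+^\alpha\Bigr]+\sum_{i=1}^tE\Bigl[\bigvee_{j=i}^t(x_jM_{j-i})_+^\alpha\,\mathbf 1(M_{-1}=0)\Bigr]$$ and also $$E\Bigl[\bigvee_{j=0}^t(x_jM_{j-t})_+^\alpha\Bigr]+\sum_{i=0}^{t-1}E\Bigl[\bigvee_{j=0}^i(x_jM_{j-i})_+^\alpha\,\mathbf 1(M_1=0)\Bigr];$$ (ii) if $(a_n)$ is a real sequence with $nP(|X_0|>a_n)\to1$, then for all $\sigma_i\in\{-1,1\}$ and $x_i\in(0,\infty)$,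 $i=0,\dots,t$, $$\lim_{n\to\infty}P(\sigma_0X_0\le a_nx_0,\dots,\sigma_tX_t\le a_nx_t)^n=\exp\{-l_t(\sigma_0/x_0,\dots,\sigma_t/x_t)\}.$$ -/

import Mathlib

open MeasureTheory ProbabilityTheory Filter Topology

noncomputable section

/-- The positive-part power `(x)_+ ^ α = (max x 0) ^ α`. -/
def posPow (α x : ℝ) : ℝ := (max x 0) ^ α

/-- The weight `p(σ)` of a sign: `p(+1) = p` and `p(-1) = 1 - p`. -/
def signProb (p σ : ℝ) : ℝ := if σ = 1 then p else 1 - p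

section Chain

variable {Ω S : Type*} [MeasurableSpace Ω] [MeasurableSpace S]

/-- `X_0, X_1, X_2, …` is the stationary Markov chain driven by the recursion
`X_t = Ψ(X_{t-1}, ε_t)`, `t ≥ 1`, where `ε_1, ε_2, …` are independent and identically distributed,
independent of `X_0`, and `Ψ(X_0, ε_1)` and `X_0` are equal in law.
The innovation `ε_{t+1}` is written `ε t`. -/
structure IsStationaryMarkovChain (P : Measure Ω) (X : ℕ → Ω → ℝ) (ε : ℕ → Ω → S)
    (Ψ : ℝ → S → ℝ) : Prop where
  measurable_X : ∀ t, Measurable (X t)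
  measurable_ε : ∀ t, Measurable (ε t)
  measurable_Ψ : Measurable (Function.uncurry Ψ)
  recursion : ∀ t, ∀ᵐ ω ∂P, X (t + 1) ω = Ψ (X t ω) (ε t ω)
  iIndep : iIndepFun ε P
  identDistrib : ∀ t, IdentDistrib (ε t) (ε 0) P P
  indep_zero : IndepFun (X 0) (fun ω t => ε t ω) P
  stationary : P.map (fun ω => Ψ (X 0 ω) (ε 0 ω)) = P.map (X 0)

/-- The law of `X₀` has regularly varying tails with index `α` and tail balance `p`. -/
structure HasRegularlyVaryingTails (P : Measure Ω) (X₀ : Ω → ℝ) (α p : ℝ) : Prop where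
  α_pos : 0 < α
  p_nonneg : 0 ≤ p
  p_le_one : p ≤ 1
  abs_tail : ∀ y : ℝ, 0 < y →
    Tendsto (fun x : ℝ => P.real {ω | x * y < |X₀ ω|} / P.real {ω | x < |X₀ ω|})
      atTop (𝓝 (y ^ (-α)))
  balance : Tendsto (fun x : ℝ => P.real {ω | x < X₀ ω} / P.real {ω | x < |X₀ ω|})
      atTop (𝓝 p)

/-- The asymptotic condition on `Ψ(x, ·)` for large `|x|`, with limit function `φ(v, σ)`; here `E`
is the law of `ε_1`. The limit `x → σ ∞` is taken along `σ * x` with `x → ∞`. Values `φ(v, σ)` with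
`v` outside `V` or with `p(σ) = 0` are unconstrained. -/
def HasTailIncrement (E : Measure S) (Ψ : ℝ → S → ℝ) (p : ℝ) (φ : S → ℝ → ℝ) : Prop :=
  ∃ V : Set S, MeasurableSet V ∧ E V = 1 ∧
    (∀ σ : ℝ, (σ = 1 ∨ σ = -1) → 0 < signProb p σ → ∀ v ∈ V,
      Tendsto (fun x : ℝ => (σ * x)⁻¹ * Ψ (σ * x) v) atTop (𝓝 (φ v σ))) ∧
    ((∃ σ : ℝ, (σ = 1 ∨ σ = -1) ∧ 0 < signProb p σ ∧ 0 < E {v | φ v σ = 0}) →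
      ∃ W : Set S, MeasurableSet W ∧ W ⊆ V ∧ E W = 1 ∧
        ∀ v ∈ W, ∃ C x₀ : ℝ, ∀ x : ℝ, x₀ ≤ x → ∀ y : ℝ, |y| ≤ x → |Ψ y v| ≤ C * x)

/-- The law of `(M_0, M_1)` with `M_1 = M_0 φ(ε_1, sign M_0)`, where `M_0` and `ε_1` are
independent, `P(M_0 = 1) = p = 1 - P(M_0 = -1)` and `E` is the law of `ε_1`
(note that `sign M_0 = M_0` because `M_0` is `1` or `-1`). -/
def forwardPairLaw (E : Measure S) (p : ℝ) (φ : S → ℝ → ℝ) : Measure (ℝ × ℝ) :=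
  ((ENNReal.ofReal p • Measure.dirac (1 : ℝ) +
      ENNReal.ofReal (1 - p) • Measure.dirac (-1 : ℝ)).prod E).map
    (fun q => (q.1, q.1 * φ q.2 q.1))

end Chain

/-- The class of laws `μ` of pairs `(I, M)` with `P(I = 1) = p = 1 - P(I = -1)` and
`E[(σ M)_+ ^ α] ≤ P(I = σ)` for `σ = 1` and `σ = -1`. -/
structure IsTailPairLaw (p α : ℝ) (μ : Measure (ℝ × ℝ)) : Prop where
  isProb : IsProbabilityMeasure μ
  pos_mass : μ {q | q.1 = 1} = ENNReal.ofReal p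
  neg_mass : μ {q | q.1 = -1} = ENNReal.ofReal (1 - p)
  moment : ∀ σ : ℝ, (σ = 1 ∨ σ = -1) →
    ∫⁻ q, ENNReal.ofReal (posPow α (σ * q.2)) ∂μ ≤ μ {q | q.1 = σ}

/-- The adjoint relation between the laws `μ` of `(I, M)` and `μ'` of `(I', M')`:
`E[(x I)_+ ^ α ∧ (y M)_+ ^ α] = E[(x M')_+ ^ α ∧ (y I')_+ ^ α]` for all real `x` and `y`. -/
def AreAdjoint (α : ℝ) (μ μ' : Measure (ℝ × ℝ)) : Prop :=
  ∀ x y : ℝ,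
    ∫⁻ q, ENNReal.ofReal (min (posPow α (x * q.1)) (posPow α (y * q.2))) ∂μ =
      ∫⁻ q, ENNReal.ofReal (min (posPow α (x * q.2)) (posPow α (y * q.1))) ∂μ'

/-- The transition law from the state `x` attached to a pair `(I, M)` with law `μ`: the law of
`x M / I` given `I = sign x` if `x ≠ 0`, and the point mass at `0` if `x = 0`. -/
def tailTransition (μ : Measure (ℝ × ℝ)) (x : ℝ) : Measure ℝ :=
  open Classical in
  if x = 0 then Measure.dirac 0
  else (ProbabilityTheory.cond μ {q | q.1 = Real.sign x}).map (fun q => x * (q.2 / q.1))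

/-- `Q` is the law, on the space of two-sided real sequences, of a back-and-forth tail chain
`{M_t : t ∈ ℤ}` with index `α` and forward transition law `μ`, a tail pair law for `(p, α)`.
The conditional laws of `M_{t+1}` given `M_t, M_{t-1}, …` and of `M_{-(t+1)}` given
`M_{-t}, M_{-t+1}, …` (`t ≥ 0`) are described by their defining integral identity. -/
structure IsBackForthTailChain (α p : ℝ) (μ : Measure (ℝ × ℝ)) (Q : Measure (ℤ → ℝ)) :
    Prop where
  isProb : IsProbabilityMeasure Q
  law_mem : IsTailPairLaw p α μ
  forward_law : Q.map (fun m => (m 0, m 1)) = μ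
  backward_mem : IsTailPairLaw p α (Q.map (fun m => (m 0, m (-1))))
  adjoint : AreAdjoint α μ (Q.map (fun m => (m 0, m (-1))))
  forward_step : ∀ (t : ℕ) (B : Set (ℕ → ℝ)) (A : Set ℝ), MeasurableSet B → MeasurableSet A →
    Q {m | (fun k : ℕ => m ((t : ℤ) - k)) ∈ B ∧ m ((t : ℤ) + 1) ∈ A} =
      ∫⁻ m in {m | (fun k : ℕ => m ((t : ℤ) - k)) ∈ B},
        tailTransition (Q.map (fun m => (m 0, m 1))) (m t) A ∂Q
  backward_step : ∀ (t : ℕ) (B : Set (ℕ → ℝ)) (A : Set ℝ), MeasurableSet B → MeasurableSet A →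
    Q {m | (fun k : ℕ => m (-(t : ℤ) + k)) ∈ B ∧ m (-(t : ℤ) - 1) ∈ A} =
      ∫⁻ m in {m | (fun k : ℕ => m (-(t : ℤ) + k)) ∈ B},
        tailTransition (Q.map (fun m => (m 0, m (-1)))) (m (-(t : ℤ))) A ∂Q

/-- The expression
`E[⋁_{0 ≤ j ≤ t} (x_j M_j)_+^α] + ∑_{1 ≤ i ≤ t} E[⋁_{i ≤ j ≤ t} (x_j M_{j-i})_+^α ; M_{-1} = 0]`. -/
def tailDependenceForward (α : ℝ) (Q : Measure (ℤ → ℝ)) {t : ℕ} (x : Fin (t + 1) → ℝ) :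
    ENNReal :=
  (∫⁻ m, ⨆ j : Fin (t + 1), ENNReal.ofReal (posPow α (x j * m (j : ℕ))) ∂Q) +
    ∑ i ∈ Finset.univ.filter (fun i : Fin (t + 1) => 0 < (i : ℕ)),
      ∫⁻ m in {m | m (-1) = 0}, ⨆ (j : Fin (t + 1)) (_ : i ≤ j),
        ENNReal.ofReal (posPow α (x j * m (((j : ℕ) : ℤ) - ((i : ℕ) : ℤ)))) ∂Q

/-- The expression
`E[⋁_{0 ≤ j ≤ t} (x_j M_{j-t})_+^α] + ∑_{0 ≤ i < t} E[⋁_{0 ≤ j ≤ i} (x_j M_{j-i})_+^α ; M_1 = 0]`. -/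
def tailDependenceBackward (α : ℝ) (Q : Measure (ℤ → ℝ)) {t : ℕ} (x : Fin (t + 1) → ℝ) :
    ENNReal :=
  (∫⁻ m, ⨆ j : Fin (t + 1), ENNReal.ofReal (posPow α (x j * m (((j : ℕ) : ℤ) - (t : ℤ)))) ∂Q) +
    ∑ i ∈ Finset.univ.filter (fun i : Fin (t + 1) => (i : ℕ) < t),
      ∫⁻ m in {m | m 1 = 0}, ⨆ (j : Fin (t + 1)) (_ : j ≤ i),
        ENNReal.ofReal (posPow α (x j * m (((j : ℕ) : ℤ) - ((i : ℕ) : ℤ)))) ∂Q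

end

/-! Far from the origin the chain is nearly multiplicative. Started at `σ r` with `r` large, `X_n /
r` is close to the `n`-th iterate, started at the sign `σ`, of a positively homogeneous map `Φ` with
`Φ(σ, v) = σ φ(v, σ)` (`ae_driven_tendsto`). Two things could go wrong. An iterate of `Φ` may hit
`0`; then the state is only known to be `o(r)`, and the linear growth bound keeps it so. An iterate
may also reach a sign `σ` with `p(σ) = 0`, where nothing is known about `Ψ`; this is excluded
because stationarity forces `E[(τ M_1)_+^α] ≤ p(τ)` (`isTailPairLaw_updatePairLaw`).

The event that some `x_i X_i` exceeds `u` is split according to the last exceedance. The law of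
`X_i` together with the innovations after it does not depend on `i`, and the conditions after `i`
concern only these. With the innovations frozen, each piece is a question about the tail of `X_0`;
regular variation and dominated convergence give the limit `E[((x_i M_0)_+^α - ⋁_{j>i} (x_j
M_{j-i})_+^α)_+]` (`exists_tail_dependence_limit`).

The rest is an identity for tail chains. Adjointness says `E k(M_0, M_1) = E k(M_{-1}, M_0)` for
functionals `k` homogeneous of degree `α` that vanish unless both arguments are nonzero; integrating
out end coordinates one at a time extends this to longer windows
(`IsBackForthTailChain.lintegral_shift`). Since `(a - b)_+ = max a b - b`, the sum of the limits
telescopes under the shift, and only terms on `{M_{-1} = 0}` survive (`tailDependenceForward_add`).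
The same shift applied to full windows equates the forward and backward expressions.

For existence, the adjoint law is written down explicitly, both laws are realised by homogeneous
updates, and the two updates are run independently from a common random sign
(`exists_isBackForthTailChain`). The extreme value limit is `(1 - l_n / n)^n → exp(-l)` when `l_n →
l`. -/

/-! ### Regularly varying tails of the stationary law -/

theorem HasRegularlyVaryingTails.map {Ω : Type*} [MeasurableSpace Ω] {P : Measure Ω} {X₀ : Ω → ℝ}
    {α p : ℝ} (h : HasRegularlyVaryingTails P X₀ α p) (hX : Measurable X₀) :
    HasRegularlyVaryingTails (P.map X₀) id α p := by
  have e1 : ∀ u : ℝ, (P.map X₀).real {x | u < |id x|} = P.real {ω | u < |X₀ ω|} := fun u => by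
    rw [map_measureReal_apply hX (measurableSet_lt measurable_const (by fun_prop))]; rfl
  have e2 : ∀ u : ℝ, (P.map X₀).real {x | u < id x} = P.real {ω | u < X₀ ω} := fun u => by
    rw [map_measureReal_apply hX (measurableSet_lt measurable_const (by fun_prop))]; rfl
  refine ⟨h.α_pos, h.p_nonneg, h.p_le_one, ?_, ?_⟩
  · intro y hy
    simp only [e1]
    exact h.abs_tail y hy
  · simp only [e1, e2]
    exact h.balance

theorem signProb_nonneg {p σ : ℝ} (h0 : 0 ≤ p) (h1 : p ≤ 1) : 0 ≤ signProb p σ := by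
  unfold signProb; split_ifs <;> linarith

section Tails

variable {ρ : Measure ℝ} [IsProbabilityMeasure ρ] {α p : ℝ}

/-- At `y = 1` the ratio tends to `1`, whereas a vanishing tail would make it `0 / 0 = 0`;
monotonicity of the tail then covers every `u`. -/
theorem HasRegularlyVaryingTails.tail_pos (h : HasRegularlyVaryingTails ρ id α p) (u : ℝ) :
    0 < ρ.real {x | u < |x|} := by
  have h1 := h.abs_tail 1 one_pos
  simp only [id, mul_one, Real.one_rpow] at h1
  have h2 := (h1.eventually (lt_mem_nhds (show (1 / 2 : ℝ) < 1 by norm_num))).and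
    (eventually_ge_atTop u)
  obtain ⟨v, hv, huv⟩ := h2.exists
  have h3 : 0 < ρ.real {x | v < |x|} := by
    rcases (measureReal_nonneg : 0 ≤ ρ.real {x | v < |x|}).eq_or_lt with h0 | h0
    · rw [← h0] at hv; norm_num at hv
    · exact h0
  exact h3.trans_le (measureReal_mono fun x (hx : v < |x|) => huv.trans_lt hx)

/-- The quotient factors through the tail of `|x|` at level `u y`: one factor tends to the sign
weight, the other to `y ^ (-α)`. For `σ = -1` the weight arises because the tail of `|x|` splits
into the two one-sided tails once `u ≥ 0`. -/
theorem HasRegularlyVaryingTails.tendsto_signed (h : HasRegularlyVaryingTails ρ id α p)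
    {σ : ℝ} (hσ : σ = 1 ∨ σ = -1) {y : ℝ} (hy : 0 < y) :
    Tendsto (fun u : ℝ => ρ.real {x | u * y < σ * x} / ρ.real {x | u < |x|}) atTop
      (𝓝 (signProb p σ * y ^ (-α))) := by
  have hT := h.tail_pos
  have key : Tendsto (fun u : ℝ => ρ.real {x | u < σ * x} / ρ.real {x | u < |x|}) atTop
      (𝓝 (signProb p σ)) := by
    rcases hσ with rfl | rfl
    · simpa [signProb] using h.balance
    · have hb := (tendsto_const_nhds (x := (1 : ℝ))).sub h.balance
      have : signProb p (-1) = 1 - p := by norm_num [signProb]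
      rw [this]
      refine hb.congr' ?_
      filter_upwards [eventually_ge_atTop 0] with u hu
      have hs : {x : ℝ | u < |x|} = {x | u < x} ∪ {x | u < -1 * x} := by
        ext x; simp [lt_abs]
      have hd : Disjoint {x : ℝ | u < x} {x | u < -1 * x} := by
        rw [Set.disjoint_left]
        intro x hx hx'
        simp only [Set.mem_ofPred_eq] at hx hx'
        linarith
      have hadd : ρ.real {x : ℝ | u < |x|} = ρ.real {x | u < x} + ρ.real {x | u < -1 * x} := by
        rw [hs, measureReal_union hd (measurableSet_lt measurable_const (by fun_prop))]
      have := (hT u).ne'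
      simp only [id]
      rw [eq_div_iff this, sub_mul, div_mul_cancel₀ _ this]
      linarith
  have hu : Tendsto (fun u : ℝ => u * y) atTop atTop := tendsto_id.atTop_mul_const hy
  refine ((key.comp hu).mul (h.abs_tail y hy)).congr fun u => ?_
  simp only [Function.comp, id]
  rw [div_mul_div_cancel₀ (hT _).ne']

end Tails

/-! ### Tail mass of sublevel sets -/

section Sublevel

variable {ρ : Measure ℝ} [IsFiniteMeasure ρ] {T : ℝ → ℝ} {σ c α : ℝ}

/-- If `g (σ r) ∼ b r`, the tail mass of `{κ u < σ x, g x ≤ u}` is that of the corresponding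
interval under the limiting power-law measure. -/
theorem tendsto_tail_sublevel
    (hF : ∀ y, 0 < y → Tendsto (fun u => ρ.real {x | u * y < σ * x} / T u) atTop
      (𝓝 (c * y ^ (-α))))
    (hT : ∀ u, 0 ≤ T u) (hσ : σ = 1 ∨ σ = -1) (hα : 0 < α) {g : ℝ → ℝ} {b κ : ℝ} (hb : 0 ≤ b)
    (hκ : 0 < κ) (hg : Tendsto (fun r => g (σ * r) / r) atTop (𝓝 b)) :
    Tendsto (fun u => ρ.real {x | u * κ < σ * x ∧ g x ≤ u} / T u) atTop
      (𝓝 (max (c * κ ^ (-α) - c * b ^ α) 0)) := by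
  have hσσ : ∀ x, σ * (σ * x) = x := fun x => by rcases hσ with rfl | rfl <;> ring
  have hm : ∀ y : ℝ, MeasurableSet {x : ℝ | y < σ * x} := fun y =>
    measurableSet_lt measurable_const (by fun_prop)
  have hcont : Continuous fun d : ℝ => max (c * κ ^ (-α) - c * d ^ α) 0 :=
    (continuous_const.sub (continuous_const.mul
      (Real.continuous_rpow_const hα.le))).max continuous_const
  have hlim : ∀ d, 0 < d → Tendsto (fun u => max (ρ.real {x | u * κ < σ * x} / T u -
      ρ.real {x | u * d⁻¹ < σ * x} / T u) 0) atTop (𝓝 (max (c * κ ^ (-α) - c * d ^ α) 0)) := by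
    intro d hd
    have := ((hF κ hκ).sub (hF d⁻¹ (inv_pos.2 hd))).max (tendsto_const_nhds (x := (0 : ℝ)))
    rwa [Real.inv_rpow hd.le, Real.rpow_neg hd.le, inv_inv] at this
  -- Beyond some `R`, `g x < d (σ x)`. Hence `σ x ≤ u / d` implies `g x ≤ u`, and the set contains
  -- an interval between two tail levels; `u κ ≥ R` puts that interval beyond `R`.
  have hlo : ∀ d, b < d → ∀ᶠ u in atTop, max (ρ.real {x | u * κ < σ * x} / T u -
      ρ.real {x | u * d⁻¹ < σ * x} / T u) 0 ≤ ρ.real {x | u * κ < σ * x ∧ g x ≤ u} / T u := by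
    intro d hd
    have hd0 : 0 < d := hb.trans_lt hd
    obtain ⟨R, hR⟩ := ((hg.eventually (gt_mem_nhds hd)).and
      (eventually_gt_atTop 0)).exists_forall_of_atTop
    filter_upwards [eventually_ge_atTop (R / κ)] with u hu
    refine max_le ?_ (div_nonneg measureReal_nonneg (hT u))
    rw [← sub_div]
    refine div_le_div_of_nonneg_right (le_trans le_measureReal_sdiff (measureReal_mono ?_)) (hT u)
    rintro x ⟨hx1, hx2⟩
    simp only [Set.mem_ofPred_eq, not_lt] at hx1 hx2 ⊢
    refine ⟨hx1, ?_⟩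
    have hRx : R ≤ σ * x := ((div_le_iff₀ hκ).1 hu).trans hx1.le
    obtain ⟨h1, h2⟩ := hR _ hRx
    rw [hσσ, div_lt_iff₀ h2] at h1
    rw [← div_eq_mul_inv, le_div_iff₀ hd0] at hx2
    linarith
  -- The reverse inclusion, from `g x > d (σ x)` beyond `R`. When `κ > d⁻¹` the set is empty, which
  -- is why the bound is a maximum with `0`.
  have hup : ∀ d, 0 < d → d < b → ∀ᶠ u in atTop,
      ρ.real {x | u * κ < σ * x ∧ g x ≤ u} / T u ≤ max (ρ.real {x | u * κ < σ * x} / T u -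
      ρ.real {x | u * d⁻¹ < σ * x} / T u) 0 := by
    intro d hd0 hd
    obtain ⟨R, hR⟩ := ((hg.eventually (lt_mem_nhds hd)).and
      (eventually_gt_atTop 0)).exists_forall_of_atTop
    filter_upwards [eventually_ge_atTop (R / κ), eventually_gt_atTop 0] with u hu hu0
    have hsub : {x | u * κ < σ * x ∧ g x ≤ u} ⊆
        {x | u * κ < σ * x} \ {x | u * d⁻¹ < σ * x} := by
      rintro x ⟨hx1, hx2⟩
      refine ⟨hx1, ?_⟩
      simp only [Set.mem_ofPred_eq, not_lt]
      have hRx : R ≤ σ * x := ((div_le_iff₀ hκ).1 hu).trans hx1.le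
      obtain ⟨h1, h2⟩ := hR _ hRx
      rw [hσσ, lt_div_iff₀ h2] at h1
      rw [← div_eq_mul_inv, le_div_iff₀ hd0]
      linarith
    rcases le_or_gt κ d⁻¹ with hk | hk
    · refine le_max_of_le_left ?_
      rw [← sub_div]
      refine div_le_div_of_nonneg_right ((measureReal_mono hsub).trans_eq ?_) (hT u)
      refine measureReal_sdiff (fun x hx => ?_) (hm _)
      simp only [Set.mem_ofPred_eq] at hx ⊢
      exact (mul_le_mul_of_nonneg_left hk hu0.le).trans_lt hx
    · refine le_max_of_le_right ?_
      have : {x | u * κ < σ * x ∧ g x ≤ u} = ∅ := by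
        refine Set.eq_empty_of_forall_notMem fun x hx => ?_
        obtain ⟨h1, h2⟩ := hsub hx
        simp only [Set.mem_ofPred_eq] at h1 h2
        exact h2 ((mul_lt_mul_of_pos_left hk hu0).trans h1)
      simp [this]
  -- The target is continuous in `d`, so `d ↓ b` gives the lower bound and `d ↑ b` the upper one.
  -- For `b = 0` no positive `d` lies below `b`, but then dropping the condition on `g` already
  -- gives the right limit.
  refine tendsto_order.2 ⟨fun a ha => ?_, fun a ha => ?_⟩
  · have h1 : ∀ᶠ d in 𝓝[>] b, a < max (c * κ ^ (-α) - c * d ^ α) 0 :=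
      nhdsWithin_le_nhds ((hcont.tendsto b).eventually (lt_mem_nhds ha))
    obtain ⟨d, hd, hdb⟩ := (h1.and self_mem_nhdsWithin).exists
    filter_upwards [hlo d hdb, (hlim d (hb.trans_lt hdb)).eventually (lt_mem_nhds hd)] with u h2 h3
    exact h3.trans_le h2
  · rcases hb.eq_or_lt with rfl | hb0
    · rw [Real.zero_rpow hα.ne', mul_zero, sub_zero] at ha
      filter_upwards [(hF κ hκ).eventually (gt_mem_nhds ((le_max_left _ _).trans_lt ha))] with u hu
      refine lt_of_le_of_lt (div_le_div_of_nonneg_right (measureReal_mono fun x hx => hx.1)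
        (hT u)) hu
    · have h1 : ∀ᶠ d in 𝓝[<] b, max (c * κ ^ (-α) - c * d ^ α) 0 < a :=
        nhdsWithin_le_nhds ((hcont.tendsto b).eventually (gt_mem_nhds ha))
      have h2 : ∀ᶠ d in 𝓝[<] b, 0 < d :=
        nhdsWithin_le_nhds (lt_mem_nhds hb0)
      obtain ⟨d, ⟨hd, hd0⟩, hdb⟩ := ((h1.and h2).and self_mem_nhdsWithin).exists
      filter_upwards [hup d hd0 hdb, (hlim d hd0).eventually (gt_mem_nhds hd)] with u h2 h3
      exact h2.trans_lt h3

/-- By Fubini the probability is an average over `e` of one-dimensional sublevel masses. Each is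
dominated by the normalised mass of `{u κ < σ x}`, eventually below `c κ ^ (-α) + 1`; a threshold `κ
> 0` is what makes this bound finite. -/
theorem tendsto_prod_tail_sublevel {S : Type*} [MeasurableSpace S] (ν : Measure S)
    [IsProbabilityMeasure ν]
    (hF : ∀ y, 0 < y → Tendsto (fun u => ρ.real {x | u * y < σ * x} / T u) atTop
      (𝓝 (c * y ^ (-α))))
    (hT : ∀ u, 0 ≤ T u) (hσ : σ = 1 ∨ σ = -1) (hα : 0 < α) {g : ℝ → S → ℝ}
    (hgm : Measurable (Function.uncurry g)) {b : S → ℝ} {κ : ℝ}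
    (hκ : 0 < κ) (hb : ∀ᵐ e ∂ν, 0 ≤ b e ∧ Tendsto (fun r => g (σ * r) e / r) atTop (𝓝 (b e))) :
    Tendsto (fun u => (ρ.prod ν).real {q | u * κ < σ * q.1 ∧ g q.1 q.2 ≤ u} / T u) atTop
      (𝓝 (∫ e, max (c * κ ^ (-α) - c * b e ^ α) 0 ∂ν)) := by
  have hms : ∀ u, MeasurableSet {q : ℝ × S | u * κ < σ * q.1 ∧ g q.1 q.2 ≤ u} := fun u =>
    (measurableSet_lt measurable_const
      (show Measurable fun q : ℝ × S => σ * q.1 by fun_prop)).inter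
      (measurableSet_le hgm measurable_const)
  have hmeas : ∀ u, Measurable fun e => ρ {x | u * κ < σ * x ∧ g x e ≤ u} := fun u =>
    measurable_measure_prodMk_right (hms u)
  have heq : ∀ u, (ρ.prod ν).real {q | u * κ < σ * q.1 ∧ g q.1 q.2 ≤ u} / T u =
      ∫ e, ρ.real {x | u * κ < σ * x ∧ g x e ≤ u} / T u ∂ν := by
    intro u
    rw [integral_div]
    congr 1
    simp only [Measure.real]
    rw [integral_toReal (hmeas u).aemeasurable (Eventually.of_forall fun e => measure_lt_top _ _),
      Measure.prod_apply_symm (hms u)]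
    rfl
  simp only [heq]
  refine tendsto_integral_filter_of_dominated_convergence (fun _ => c * κ ^ (-α) + 1) ?_ ?_
    (integrable_const _) ?_
  · exact Eventually.of_forall fun u => ((hmeas u).ennreal_toReal.div_const _).aestronglyMeasurable
  · filter_upwards [(hF κ hκ).eventually (gt_mem_nhds (lt_add_one _))] with u hu
    refine Eventually.of_forall fun e => ?_
    rw [Real.norm_of_nonneg (div_nonneg measureReal_nonneg (hT u))]
    exact (div_le_div_of_nonneg_right (measureReal_mono fun x hx => hx.1) (hT u)).trans hu.le
  · filter_upwards [hb] with e he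
    exact tendsto_tail_sublevel hF hT hσ hα he.1 hκ he.2

end Sublevel

/-! ### I.i.d. innovation sequences -/

section IID

variable {S : Type*} [MeasurableSpace S] (E : Measure S) [IsProbabilityMeasure E]

/-- The law of an i.i.d. sequence with common law `E`. -/
noncomputable abbrev iidLaw : Measure (ℕ → S) := Measure.infinitePi fun _ => E

/-- Prepend an entry to a sequence. -/
def consSeq (q : S × (ℕ → S)) : ℕ → S
  | 0 => q.1
  | n + 1 => q.2 n

theorem measurable_consSeq : Measurable (consSeq (S := S)) :=
  measurable_pi_iff.2 fun n => by
    cases n with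
    | zero => exact measurable_fst
    | succ n => exact (measurable_pi_apply n).comp measurable_snd

theorem map_consSeq : (E.prod (iidLaw E)).map consSeq = iidLaw E := by
  classical
  refine Measure.eq_infinitePi _ fun s t ht => ?_
  rw [Measure.map_apply measurable_consSeq
    (MeasurableSet.pi s.countable_toSet fun i _ => ht i)]
  -- The cylinder is padded with `Set.univ` to the index set `range (N + 1)`, so that its measure is
  -- a product from which the factor at `0` splits off.
  obtain ⟨N, hN⟩ : ∃ N, s ⊆ Finset.range (N + 1) :=
    ⟨s.sup id, fun i hi => Finset.mem_range.2 (Nat.lt_succ_of_le (Finset.le_sup (f := id) hi))⟩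
  set t' : ℕ → Set S := fun i => if i ∈ s then t i else Set.univ with ht'
  have hm' : ∀ i, MeasurableSet (t' i) := fun i => by
    simp only [ht']; split_ifs; exacts [ht i, MeasurableSet.univ]
  have hpre : consSeq ⁻¹' ((s : Set ℕ).pi t) =
      t' 0 ×ˢ ((Finset.range N : Set ℕ).pi fun i => t' (i + 1)) := by
    ext ⟨v, e⟩
    simp only [Set.mem_preimage, Set.mem_pi, Set.mem_prod, Finset.mem_coe, Finset.mem_range, ht']
    constructor
    · intro h
      refine ⟨?_, fun i _ => ?_⟩
      · split_ifs with h0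
        exacts [h 0 h0, Set.mem_univ _]
      · split_ifs with h0
        exacts [h (i + 1) h0, Set.mem_univ _]
    · rintro ⟨h0, h1⟩ i hi
      cases i with
      | zero => exact (by simpa [hi] using h0 : v ∈ t 0)
      | succ i =>
        have := h1 i (by simpa using hN hi)
        rw [if_pos hi] at this
        exact this
  rw [hpre, Measure.prod_prod, Measure.infinitePi_pi _ fun i _ => hm' (i + 1), mul_comm,
    ← Finset.prod_range_succ' (fun i => E (t' i)), ← Finset.prod_subset hN]
  · exact Finset.prod_congr rfl fun i hi => by simp [ht', hi]
  · intro i _ hi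
    simp [ht', hi]

theorem map_uncons_iidLaw :
    (iidLaw E).map (fun e => (e 0, fun n => e (n + 1))) = E.prod (iidLaw E) := by
  conv_lhs => rw [← map_consSeq E]
  rw [Measure.map_map (by fun_prop) measurable_consSeq]
  exact Measure.map_id

theorem measurable_update_prod (n : ℕ) :
    Measurable fun q : (ℕ → S) × S => Function.update q.1 n q.2 :=
  measurable_pi_iff.2 fun i => by
    by_cases h : i = n
    · subst h; simpa using measurable_snd
    · simp only [ne_eq, h, not_false_eq_true, Function.update_of_ne]; fun_prop

/-- Resampling one coordinate preserves the law; this takes the place of a conditional independence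
argument in `lintegral_iidLaw_eval`. -/
theorem map_update_iidLaw (n : ℕ) :
    ((iidLaw E).prod E).map (fun q => Function.update q.1 n q.2) = iidLaw E := by
  classical
  refine Measure.eq_infinitePi _ fun s t ht => ?_
  rw [Measure.map_apply (measurable_update_prod n)
    (MeasurableSet.pi s.countable_toSet fun i _ => ht i)]
  have hpre : (fun q : (ℕ → S) × S => Function.update q.1 n q.2) ⁻¹' ((s : Set ℕ).pi t) =
      ((s.erase n : Finset ℕ) : Set ℕ).pi t ×ˢ (if n ∈ s then t n else Set.univ) := by
    ext ⟨e, v⟩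
    simp only [Set.mem_preimage, Set.mem_pi, Set.mem_prod, Finset.mem_coe, Finset.mem_erase]
    constructor
    · intro h
      refine ⟨fun i hi => by simpa [Function.update_of_ne hi.1] using h i hi.2, ?_⟩
      split_ifs with h0
      exacts [by simpa using h n h0, Set.mem_univ _]
    · rintro ⟨h0, h1⟩ i hi
      by_cases hin : i = n
      · subst hin; simpa [hi] using h1
      · simpa [Function.update_of_ne hin] using h0 i ⟨hin, hi⟩
  rw [hpre, Measure.prod_prod, Measure.infinitePi_pi _ fun i _ => ht i]
  split_ifs with h
  · rw [Finset.prod_erase_mul _ _ h]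
  · rw [measure_univ, mul_one, Finset.erase_eq_of_notMem h]

/-- The `n`-th innovation may be integrated out separately when the remaining dependence is on the
other innovations only. -/
theorem lintegral_iidLaw_eval (n : ℕ) {f : (ℕ → S) → S → ENNReal}
    (hf : Measurable (Function.uncurry f)) (hdep : ∀ e v w, f (Function.update e n w) v = f e v) :
    ∫⁻ e, f e (e n) ∂iidLaw E = ∫⁻ e, ∫⁻ v, f e v ∂E ∂iidLaw E := by
  have hm : Measurable fun e : ℕ → S => f e (e n) :=
    hf.comp (measurable_id.prodMk (measurable_pi_apply n))
  conv_lhs => rw [← map_update_iidLaw E n]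
  rw [lintegral_map hm (measurable_update_prod n)]
  refine Eq.trans ?_ (lintegral_prod (Function.uncurry f) hf.aemeasurable)
  refine lintegral_congr fun q => ?_
  simp [hdep, Function.uncurry]

theorem ae_iidLaw_forall {A : S → Prop} (h : ∀ᵐ v ∂E, A v) : ∀ᵐ e ∂iidLaw E, ∀ n, A (e n) :=
  ae_all_iff.2 fun n =>
    (measurePreserving_eval_infinitePi (fun _ : ℕ => E) n).quasiMeasurePreserving.ae h

end IID

/-! ### Iterated random maps and the stationary chain -/

section Driven

variable {S : Type*}

/-- The iterates of the recursion `x ↦ Ψ x e` started at `x` and driven by the sequence `e`. -/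
def driven (Ψ : ℝ → S → ℝ) (x : ℝ) (e : ℕ → S) : ℕ → ℝ
  | 0 => x
  | n + 1 => Ψ (driven Ψ x e n) (e n)

theorem measurable_driven [MeasurableSpace S] {Ψ : ℝ → S → ℝ}
    (hΨ : Measurable (Function.uncurry Ψ)) (n : ℕ) :
    Measurable fun q : ℝ × (ℕ → S) => driven Ψ q.1 q.2 n := by
  induction n with
  | zero => exact measurable_fst
  | succ n ih => exact hΨ.comp (ih.prodMk ((measurable_pi_apply n).comp measurable_snd))

/-- Non-anticipation: the state at time `k` uses only the innovations with index below `k`. -/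
theorem driven_update (Ψ : ℝ → S → ℝ) (x : ℝ) (e : ℕ → S) (v : S) {n k : ℕ} (h : k ≤ n) :
    driven Ψ x (Function.update e n v) k = driven Ψ x e k := by
  induction k with
  | zero => rfl
  | succ k ih =>
    simp only [driven, ih (by omega)]
    rw [Function.update_of_ne (by omega)]

end Driven

section Stationary

variable {Ω S : Type*} [MeasurableSpace Ω] [MeasurableSpace S]
  {P : Measure Ω} {X : ℕ → Ω → ℝ} {ε : ℕ → Ω → S} {Ψ : ℝ → S → ℝ}

theorem IsStationaryMarkovChain.isProbabilityMeasure [IsProbabilityMeasure P]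
    (hX : IsStationaryMarkovChain P X ε Ψ) :
    IsProbabilityMeasure (P.map (ε 0)) :=
  Measure.isProbabilityMeasure_map (hX.measurable_ε 0).aemeasurable

theorem IsStationaryMarkovChain.map_ε (hX : IsStationaryMarkovChain P X ε Ψ)
    [IsProbabilityMeasure (P.map (ε 0))] :
    P.map (fun ω t => ε t ω) = iidLaw (P.map (ε 0)) := by
  rw [hX.iIndep.map_fun_eq_infinitePi_map hX.measurable_ε]
  congr 1
  ext1 i
  exact (hX.identDistrib i).map_eq

theorem IsStationaryMarkovChain.map_uncurry_eq [IsProbabilityMeasure P]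
    (hX : IsStationaryMarkovChain P X ε Ψ) :
    ((P.map (X 0)).prod (P.map (ε 0))).map (Function.uncurry Ψ) = P.map (X 0) := by
  have : P.map (fun ω => (X 0 ω, ε 0 ω)) = (P.map (X 0)).prod (P.map (ε 0)) :=
    (indepFun_iff_map_prod_eq_prod_map_map (hX.measurable_X 0).aemeasurable
      (hX.measurable_ε 0).aemeasurable).1
      (hX.indep_zero.comp measurable_id (measurable_pi_apply 0))
  rw [← this, Measure.map_map hX.measurable_Ψ ((hX.measurable_X 0).prodMk (hX.measurable_ε 0))]
  exact hX.stationary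

/-- One step sends `(x, e)` to `(Ψ x (e 0), shift e)`. This map preserves the product of the
stationary law with the i.i.d. law, because the first innovation is used up and the remaining ones
are again i.i.d. and independent of the new state. -/
theorem IsStationaryMarkovChain.map_state_innovations [IsProbabilityMeasure P]
    (hX : IsStationaryMarkovChain P X ε Ψ)
    [IsProbabilityMeasure (P.map (ε 0))] (i : ℕ) :
    P.map (fun ω => (X i ω, fun k => ε (i + k) ω)) =
      (P.map (X 0)).prod (iidLaw (P.map (ε 0))) := by
  have hmε : ∀ i, Measurable fun ω (k : ℕ) => ε (i + k) ω := fun i =>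
    measurable_pi_iff.2 fun k => hX.measurable_ε _
  set E := P.map (ε 0)
  have hstep : ((P.map (X 0)).prod (iidLaw E)).map
      (fun q : ℝ × (ℕ → S) => (Ψ q.1 (q.2 0), fun k => q.2 (k + 1))) =
      (((P.map (X 0)).prod E).map (Function.uncurry Ψ)).prod (iidLaw E) := by
    have : IsProbabilityMeasure (P.map (X 0)) :=
      Measure.isProbabilityMeasure_map (hX.measurable_X 0).aemeasurable
    have h1 : (P.map (X 0)).prod (E.prod (iidLaw E)) = ((P.map (X 0)).prod (iidLaw E)).map
        (Prod.map id fun e : ℕ → S => (e 0, fun n => e (n + 1))) := by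
      rw [← map_uncons_iidLaw E, ← Measure.map_prod_map _ _ measurable_id (by fun_prop),
        Measure.map_id]
    have h2 : (((P.map (X 0)).prod E).map (Function.uncurry Ψ)).prod (iidLaw E) =
        (((P.map (X 0)).prod E).prod (iidLaw E)).map (Prod.map (Function.uncurry Ψ) id) := by
      rw [← Measure.map_prod_map _ _ hX.measurable_Ψ measurable_id, Measure.map_id]
    rw [h2, ← (measurePreserving_prodAssoc (P.map (X 0)) E (iidLaw E)).symm.map_eq, h1,
      Measure.map_map (hX.measurable_Ψ.prodMap measurable_id) (MeasurableEquiv.measurable _),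
      Measure.map_map ((hX.measurable_Ψ.prodMap measurable_id).comp (MeasurableEquiv.measurable _))
        (measurable_id.prodMap (by fun_prop))]
    rfl
  have h0 : P.map (fun ω => (X 0 ω, fun k => ε k ω)) = (P.map (X 0)).prod (iidLaw E) := by
    rw [(indepFun_iff_map_prod_eq_prod_map_map (hX.measurable_X 0).aemeasurable
      (by simpa using (hmε 0).aemeasurable)).1 hX.indep_zero, hX.map_ε]
  rw [hX.map_uncurry_eq] at hstep
  induction i with
  | zero => simpa using h0
  | succ i ih =>
    have : P.map (fun ω => (X (i + 1) ω, fun k => ε (i + 1 + k) ω)) =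
        (P.map (fun ω => (X i ω, fun k => ε (i + k) ω))).map
          (fun q : ℝ × (ℕ → S) => (Ψ q.1 (q.2 0), fun k => q.2 (k + 1))) := by
      have hm : Measurable fun q : ℝ × (ℕ → S) => (Ψ q.1 (q.2 0), fun k => q.2 (k + 1)) :=
        (hX.measurable_Ψ.comp (measurable_fst.prodMk
          ((measurable_pi_apply 0).comp measurable_snd))).prodMk (by fun_prop)
      rw [Measure.map_map hm ((hX.measurable_X i).prodMk (hmε i))]
      refine Measure.map_congr ?_
      filter_upwards [hX.recursion i] with ω hω
      simp only [Function.comp, hω, add_zero, add_assoc, add_comm 1]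
    rw [this, ih, hstep]

theorem IsStationaryMarkovChain.ae_eq_driven (hX : IsStationaryMarkovChain P X ε Ψ) :
    ∀ᵐ ω ∂P, ∀ i n, X (i + n) ω = driven Ψ (X i ω) (fun k => ε (i + k) ω) n := by
  filter_upwards [ae_all_iff.2 hX.recursion] with ω hω i n
  induction n with
  | zero => rfl
  | succ n ih => rw [← add_assoc, hω, ih]; rfl

end Stationary

/-! ### Random signs and homogeneous updates -/

/-- The law of a random sign that equals `1` with probability `p`. -/
noncomputable def signLaw (p : ℝ) : Measure ℝ :=
  ENNReal.ofReal p • Measure.dirac (1 : ℝ) + ENNReal.ofReal (1 - p) • Measure.dirac (-1 : ℝ)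

theorem isProbabilityMeasure_signLaw {p : ℝ} (h0 : 0 ≤ p) (h1 : p ≤ 1) :
    IsProbabilityMeasure (signLaw p) := by
  refine ⟨?_⟩
  simp only [signLaw, Measure.add_apply, Measure.smul_apply, measure_univ, smul_eq_mul, mul_one]
  rw [← ENNReal.ofReal_add h0 (by linarith)]
  simp

theorem lintegral_signLaw (p : ℝ) (f : ℝ → ENNReal) :
    ∫⁻ s, f s ∂signLaw p =
      ENNReal.ofReal (signProb p 1) * f 1 + ENNReal.ofReal (signProb p (-1)) * f (-1) := by
  simp only [signLaw, lintegral_add_measure, lintegral_smul_measure, lintegral_dirac, signProb,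
    smul_eq_mul, if_true]
  norm_num

theorem ae_signLaw {p : ℝ} {A : ℝ → Prop}
    (h : ∀ σ, (σ = 1 ∨ σ = -1) → 0 < signProb p σ → A σ) : ∀ᵐ s ∂signLaw p, A s := by
  have key : ∀ σ : ℝ, (σ = 1 ∨ σ = -1) →
      ∀ᵐ s ∂(ENNReal.ofReal (signProb p σ) • Measure.dirac σ), A s := fun σ hσ => by
    rcases lt_or_ge 0 (signProb p σ) with h1 | h1
    · exact Measure.ae_smul_measure (by simpa [ae_dirac_eq] using h σ hσ h1) _
    · simp [ENNReal.ofReal_of_nonpos h1]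
  have h1 := key 1 (Or.inl rfl)
  have h2 := key (-1) (Or.inr rfl)
  simp only [signProb, if_true] at h1
  norm_num [signProb] at h2
  unfold signLaw
  exact ae_add_measure_iff.2 ⟨h1, h2⟩

theorem ae_signLaw_prod {S : Type*} [MeasurableSpace S] {E : Measure S} [SFinite E] {p : ℝ}
    {A : ℝ × S → Prop}
    (h : ∀ σ, (σ = 1 ∨ σ = -1) → 0 < signProb p σ → ∀ᵐ v ∂E, A (σ, v)) :
    ∀ᵐ q ∂(signLaw p).prod E, A q := by
  have key : ∀ σ : ℝ, (σ = 1 ∨ σ = -1) →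
      ∀ᵐ q ∂(ENNReal.ofReal (signProb p σ) • (Measure.dirac σ).prod E), A q := fun σ hσ => by
    rcases lt_or_ge 0 (signProb p σ) with h1 | h1
    · refine Measure.ae_smul_measure ?_ _
      rw [Measure.dirac_prod]
      refine (MeasurableEmbedding.ae_map_iff (measurableEmbedding_prodMk_left σ)).2 (h σ hσ h1)
    · simp [ENNReal.ofReal_of_nonpos h1]
  have h1 := key 1 (Or.inl rfl)
  have h2 := key (-1) (Or.inr rfl)
  simp only [signProb, if_true] at h1
  norm_num [signProb] at h2
  unfold signLaw
  rw [Measure.add_prod, Measure.prod_smul_left, Measure.prod_smul_left]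
  exact ae_add_measure_iff.2 ⟨h1, h2⟩

section Update

variable {S : Type*} [MeasurableSpace S]

/-- A measurable, positively homogeneous one-step recursion with absorbing state `0`. -/
structure IsTailUpdate (Φ : ℝ → S → ℝ) : Prop where
  measurable : Measurable (Function.uncurry Φ)
  zero : ∀ v, Φ 0 v = 0
  smul : ∀ c x v, 0 < c → Φ (c * x) v = c * Φ x v

/-- The law of `(M_0, Φ(M_0, ε))` for a random sign `M_0` and an innovation `ε` of law `E`. -/
noncomputable def updatePairLaw (E : Measure S) (p : ℝ) (Φ : ℝ → S → ℝ) : Measure (ℝ × ℝ) :=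
  ((signLaw p).prod E).map fun q => (q.1, Φ q.1 q.2)

theorem IsTailUpdate.measurable_pair {Φ : ℝ → S → ℝ} (h : IsTailUpdate Φ) :
    Measurable fun q : ℝ × S => (q.1, Φ q.1 q.2) :=
  measurable_fst.prodMk h.measurable

theorem IsTailUpdate.measurable_left {Φ : ℝ → S → ℝ} (h : IsTailUpdate Φ) (x : ℝ) :
    Measurable (Φ x) :=
  h.measurable.comp (measurable_const.prodMk measurable_id)

theorem lintegral_updatePairLaw {E : Measure S} [IsProbabilityMeasure E] {p : ℝ}
    {Φ : ℝ → S → ℝ} (h : IsTailUpdate Φ) {f : ℝ × ℝ → ENNReal} (hf : Measurable f) :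
    ∫⁻ q, f q ∂updatePairLaw E p Φ =
      ENNReal.ofReal (signProb p 1) * ∫⁻ v, f (1, Φ 1 v) ∂E +
        ENNReal.ofReal (signProb p (-1)) * ∫⁻ v, f (-1, Φ (-1) v) ∂E := by
  rw [updatePairLaw, lintegral_map hf h.measurable_pair,
    lintegral_prod (fun q : ℝ × S => f (q.1, Φ q.1 q.2))
      (hf.comp h.measurable_pair).aemeasurable, lintegral_signLaw]

theorem updatePairLaw_sign {E : Measure S} [IsProbabilityMeasure E] {p : ℝ}
    {Φ : ℝ → S → ℝ} (h : IsTailUpdate Φ) {σ : ℝ} (hσ : σ = 1 ∨ σ = -1) :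
    updatePairLaw E p Φ {q | q.1 = σ} = ENNReal.ofReal (signProb p σ) := by
  have hm : MeasurableSet {q : ℝ × ℝ | q.1 = σ} := measurable_fst (measurableSet_singleton σ)
  rw [← lintegral_indicator_one hm, lintegral_updatePairLaw h (measurable_one.indicator hm)]
  rcases hσ with rfl | rfl <;> norm_num [Set.indicator]

theorem ae_of_prob_eq_one {E : Measure S} [IsProbabilityMeasure E] {V : Set S}
    (hV : MeasurableSet V) (h : E V = 1) : ∀ᵐ v ∂E, v ∈ V :=
  (prob_compl_eq_zero_iff hV).2 h

/-- Growth bound at an innovation `v`: `sup_{|y| ≤ x} |Ψ(y, v)| = O(x)`. -/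
def HasLinearGrowth (Ψ : ℝ → S → ℝ) (v : S) : Prop :=
  ∃ C x₀ : ℝ, ∀ x : ℝ, x₀ ≤ x → ∀ y : ℝ, |y| ≤ x → |Ψ y v| ≤ C * x

/-- The function `φ` need not be measurable and is arbitrary at signs of weight zero. It is
therefore replaced by measurable a.e. limits of `Ψ(σ n, v) / n` along integers, extended to all
states by positive homogeneity. The final disjunction restates the growth condition: either zero is
almost surely not reached from a sign of positive weight, or the linear bound holds. -/
theorem HasTailIncrement.exists_update {E : Measure S} [IsProbabilityMeasure E]
    {Ψ : ℝ → S → ℝ} {p : ℝ} {φ : S → ℝ → ℝ} (hΨ : Measurable (Function.uncurry Ψ))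
    (h : HasTailIncrement E Ψ p φ) :
    ∃ Φ : ℝ → S → ℝ, IsTailUpdate Φ ∧ forwardPairLaw E p φ = updatePairLaw E p Φ ∧
      (∀ᵐ v ∂E, ∀ σ : ℝ, (σ = 1 ∨ σ = -1) → 0 < signProb p σ →
        Tendsto (fun r : ℝ => Ψ (σ * r) v / r) atTop (𝓝 (Φ σ v))) ∧
      ((∀ᵐ v ∂E, ∀ σ : ℝ, (σ = 1 ∨ σ = -1) → 0 < signProb p σ → Φ σ v ≠ 0) ∨
        ∀ᵐ v ∂E, HasLinearGrowth Ψ v) := by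
  obtain ⟨V, hV, hV1, hlim, hW⟩ := h
  have hVae := ae_of_prob_eq_one hV hV1
  have hlim' : ∀ σ : ℝ, (σ = 1 ∨ σ = -1) → 0 < signProb p σ → ∀ v ∈ V,
      Tendsto (fun r : ℝ => Ψ (σ * r) v / r) atTop (𝓝 (σ * φ v σ)) := by
    intro σ hσ hp v hv
    have hσσ : σ * σ = 1 := by rcases hσ with rfl | rfl <;> norm_num
    have hσi : σ⁻¹ = σ := by rcases hσ with rfl | rfl <;> norm_num
    refine ((hlim σ hσ hp v hv).const_mul σ).congr fun r => ?_
    rw [mul_inv, hσi, div_eq_mul_inv]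
    linear_combination (r⁻¹ * Ψ (σ * r) v) * hσσ
  have hf : ∀ σ : ℝ, (σ = 1 ∨ σ = -1) → ∃ f : S → ℝ, Measurable f ∧
      (0 < signProb p σ → ∀ᵐ v ∂E, f v = σ * φ v σ) := by
    intro σ hσ
    by_cases hp : 0 < signProb p σ
    · obtain ⟨f, hfm, hf⟩ := measurable_limit_of_tendsto_metrizable_ae (μ := E) (L := atTop)
        (f := fun (n : ℕ) v => Ψ (σ * n) v / n)
        (fun n => ((hΨ.comp (measurable_const.prodMk measurable_id)).div_const _).aemeasurable) (by
          filter_upwards [hVae] with v hv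
          exact ⟨_, (hlim' σ hσ hp v hv).comp tendsto_natCast_atTop_atTop⟩)
      refine ⟨f, hfm, fun _ => ?_⟩
      filter_upwards [hf, hVae] with v h1 h2
      exact tendsto_nhds_unique h1 ((hlim' σ hσ hp v h2).comp tendsto_natCast_atTop_atTop)
    · exact ⟨0, measurable_zero, fun h => absurd h hp⟩
  obtain ⟨f₁, hf₁, hfe₁⟩ := hf 1 (Or.inl rfl)
  obtain ⟨f₂, hf₂, hfe₂⟩ := hf (-1) (Or.inr rfl)
  set Φ : ℝ → S → ℝ := fun x v => max x 0 * f₁ v + max (-x) 0 * f₂ v with hΦ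
  have hΦe : ∀ σ : ℝ, (σ = 1 ∨ σ = -1) → 0 < signProb p σ → ∀ᵐ v ∂E, Φ σ v = σ * φ v σ := by
    rintro σ (rfl | rfl) hp
    · filter_upwards [hfe₁ hp] with v hv
      simp [hΦ, hv]
    · filter_upwards [hfe₂ hp] with v hv
      simp [hΦ, hv]
  have hall : ∀ {A : ℝ → S → Prop}, (∀ σ : ℝ, (σ = 1 ∨ σ = -1) → 0 < signProb p σ →
      ∀ᵐ v ∂E, A σ v) → ∀ᵐ v ∂E, ∀ σ : ℝ, (σ = 1 ∨ σ = -1) → 0 < signProb p σ → A σ v := by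
    intro A hA
    have h1 : ∀ᵐ v ∂E, 0 < signProb p 1 → A 1 v := eventually_imp_distrib_left.2 (hA 1 (Or.inl rfl))
    have h2 : ∀ᵐ v ∂E, 0 < signProb p (-1) → A (-1) v :=
      eventually_imp_distrib_left.2 (hA (-1) (Or.inr rfl))
    filter_upwards [h1, h2] with v h1 h2
    rintro σ (rfl | rfl) hp
    exacts [h1 hp, h2 hp]
  refine ⟨Φ, ⟨?_, fun v => by simp [hΦ], fun c x v hc => ?_⟩, ?_, ?_, ?_⟩
  · simp only [hΦ, Function.uncurry_def]
    fun_prop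
  · have h1 : max (c * x) 0 = c * max x 0 := by
      rw [mul_max_of_nonneg _ _ hc.le, mul_zero]
    have h2 : max (-(c * x)) 0 = c * max (-x) 0 := by
      rw [mul_max_of_nonneg _ _ hc.le, mul_zero, mul_neg]
    simp only [hΦ, h1, h2]
    ring
  · refine Measure.map_congr (ae_signLaw_prod fun σ hσ hp => ?_)
    filter_upwards [hΦe σ hσ hp] with v hv
    simp [hv]
  · refine hall fun σ hσ hp => ?_
    filter_upwards [hΦe σ hσ hp, hVae] with v h1 h2
    rw [h1]
    exact hlim' σ hσ hp v h2
  · by_cases hz : ∃ σ : ℝ, (σ = 1 ∨ σ = -1) ∧ 0 < signProb p σ ∧ 0 < E {v | φ v σ = 0}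
    · obtain ⟨W, hWm, -, hW1, hWb⟩ := hW hz
      exact Or.inr ((ae_of_prob_eq_one hWm hW1).mono hWb)
    · refine Or.inl (hall fun σ hσ hp => ?_)
      have h0 : E {v | φ v σ = 0} = 0 := by
        by_contra h0
        exact hz ⟨σ, hσ, hp, pos_iff_ne_zero.2 h0⟩
      filter_upwards [hΦe σ hσ hp, compl_mem_ae_iff.2 h0] with v h1 h2
      rw [h1]
      refine mul_ne_zero ?_ h2
      rcases hσ with rfl | rfl <;> norm_num

/-- Induction on `n`. If the limiting state is nonzero, the actual state escapes to infinity in that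
direction and the one-step limit applies again. If it is zero, the actual state is merely `o(r)`,
possibly bounded, and linear growth shows that the next state is `o(r)` too. Without the growth
bound the limiting state is never zero. -/
theorem ae_driven_tendsto {E : Measure S} [IsProbabilityMeasure E] {Ψ Φ : ℝ → S → ℝ} {p : ℝ}
    (hΦ : IsTailUpdate Φ)
    (hlim : ∀ᵐ v ∂E, ∀ σ : ℝ, (σ = 1 ∨ σ = -1) → 0 < signProb p σ →
        Tendsto (fun r : ℝ => Ψ (σ * r) v / r) atTop (𝓝 (Φ σ v)))
    (hsign : ∀ᵐ v ∂E, ∀ σ : ℝ, (σ = 1 ∨ σ = -1) → 0 < signProb p σ →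
        ∀ τ : ℝ, (τ = 1 ∨ τ = -1) → 0 < τ * Φ σ v → 0 < signProb p τ)
    (hgrowth : (∀ᵐ v ∂E, ∀ σ : ℝ, (σ = 1 ∨ σ = -1) → 0 < signProb p σ → Φ σ v ≠ 0) ∨
        ∀ᵐ v ∂E, HasLinearGrowth Ψ v) :
    ∀ᵐ e ∂iidLaw E, ∀ σ : ℝ, (σ = 1 ∨ σ = -1) → 0 < signProb p σ → ∀ n,
      Tendsto (fun r : ℝ => driven Ψ (σ * r) e n / r) atTop (𝓝 (driven Φ σ e n)) := by
  have hg : ∀ᵐ e ∂iidLaw E,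
      (∀ n, ∀ σ : ℝ, (σ = 1 ∨ σ = -1) → 0 < signProb p σ → Φ σ (e n) ≠ 0) ∨
        ∀ n, HasLinearGrowth Ψ (e n) := by
    rcases hgrowth with h | h
    · exact (ae_iidLaw_forall E h).mono fun e => Or.inl
    · exact (ae_iidLaw_forall E h).mono fun e => Or.inr
  filter_upwards [ae_iidLaw_forall E hlim, ae_iidLaw_forall E hsign, hg] with e h1 h2 h3 σ hσ hp n
  have hdecomp : ∀ m : ℝ, m ≠ 0 → ∃ τ : ℝ, (τ = 1 ∨ τ = -1) ∧ 0 < τ * m ∧ m = |m| * τ := by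
    intro m hm
    rcases hm.lt_or_gt with h | h
    · exact ⟨-1, Or.inr rfl, by linarith, by rw [abs_of_neg h]; ring⟩
    · exact ⟨1, Or.inl rfl, by linarith, by rw [abs_of_pos h]; ring⟩
  -- Along the limiting path, a nonzero state always has a sign of positive weight, so that the
  -- one-step limit is available there, and it stays nonzero if `Φ` does not vanish at such signs.
  have hinv : ∀ n, (∀ τ : ℝ, (τ = 1 ∨ τ = -1) → 0 < τ * driven Φ σ e n → 0 < signProb p τ) ∧
      ((∀ n, ∀ σ : ℝ, (σ = 1 ∨ σ = -1) → 0 < signProb p σ → Φ σ (e n) ≠ 0) →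
        driven Φ σ e n ≠ 0) := by
    intro n
    induction n with
    | zero =>
      refine ⟨fun τ hτ h => ?_, fun _ => ?_⟩
      · simp only [driven] at h
        rcases hσ with rfl | rfl <;> rcases hτ with rfl | rfl <;>
          first | exact hp | (norm_num at h)
      · simp only [driven]
        rcases hσ with rfl | rfl <;> norm_num
    | succ n ih =>
      by_cases hm : driven Φ σ e n = 0
      · refine ⟨fun τ hτ h => ?_, fun h => absurd hm (ih.2 h)⟩
        simp [driven, hm, hΦ.zero] at h
      · obtain ⟨τ', hτ', hpos, hdec⟩ := hdecomp _ hm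
        have hτp := ih.1 τ' hτ' hpos
        have habs := abs_pos.2 hm
        have heq : driven Φ σ e (n + 1) = |driven Φ σ e n| * Φ τ' (e n) := by
          rw [← hΦ.smul _ _ _ habs, ← hdec]; rfl
        rw [heq]
        refine ⟨fun τ hτ h => ?_, fun h => mul_ne_zero habs.ne' (h n τ' hτ' hτp)⟩
        refine h2 n τ' hτ' hτp τ hτ ?_
        rw [mul_left_comm] at h
        exact pos_of_mul_pos_right h habs.le
  induction n with
  | zero =>
    simp only [driven]
    refine tendsto_const_nhds.congr' ?_
    filter_upwards [eventually_ne_atTop 0] with r hr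
    field_simp
  | succ n ih =>
    by_cases hm : driven Φ σ e n = 0
    · have hgr : HasLinearGrowth Ψ (e n) := by
        rcases h3 with h3 | h3
        · exact absurd hm ((hinv n).2 h3)
        · exact h3 n
      obtain ⟨C, x₀, hC⟩ := hgr
      simp only [driven, hm, hΦ.zero]
      rw [hm] at ih
      rw [Metric.tendsto_nhds]
      intro η hη
      -- Chosen so that `(|C| + 1) δ r = η r / 2`; the added `1` covers `C = 0`.
      set δ := η / (2 * (|C| + 1)) with hδ
      have hC1 : 0 < |C| + 1 := by positivity
      have hδ0 : 0 < δ := by positivity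
      filter_upwards [(Metric.tendsto_nhds.1 ih) δ hδ0, eventually_gt_atTop 0,
        eventually_ge_atTop (x₀ / δ)] with r hr1 hr2 hr3
      rw [dist_zero_right, Real.norm_eq_abs, abs_div, abs_of_pos hr2, div_lt_iff₀ hr2] at hr1 ⊢
      have := hC (δ * r) (by rw [div_le_iff₀ hδ0] at hr3; linarith) _ hr1.le
      have h4 : C * (δ * r) ≤ (|C| + 1) * (δ * r) :=
        mul_le_mul_of_nonneg_right (by linarith [le_abs_self C]) (by positivity)
      have h5 : (|C| + 1) * (δ * r) = η / 2 * r := by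
        rw [hδ]; field_simp
      have h6 : η / 2 * r < η * r := by nlinarith
      linarith
    · obtain ⟨τ, hτ, hpos, hdec⟩ := hdecomp _ hm
      have hτp := (hinv n).1 τ hτ hpos
      have hττ : ∀ x, τ * (τ * x) = x := fun x => by rcases hτ with rfl | rfl <;> ring
      have hτm : τ * driven Φ σ e n = |driven Φ σ e n| := by
        conv_lhs => rw [hdec, mul_comm |_|, hττ]
      have hY : Tendsto (fun r => τ * driven Ψ (σ * r) e n / r) atTop
          (𝓝 |driven Φ σ e n|) := by
        rw [← hτm]
        exact (ih.const_mul τ).congr fun r => by rw [mul_div_assoc]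
      have hYinf : Tendsto (fun r => τ * driven Ψ (σ * r) e n) atTop atTop := by
        refine (Tendsto.pos_mul_atTop (abs_pos.2 hm) hY tendsto_id).congr' ?_
        filter_upwards [eventually_ne_atTop 0] with r hr
        rw [id, div_mul_cancel₀ _ hr]
      -- With `Y` the current state, `Ψ(Y) / r = (Ψ(Y) / (τ Y)) (τ Y / r)`, where `τ Y → ∞`.
      have hmain := ((h1 n τ hτ hτp).comp hYinf).mul hY
      have heq : driven Φ σ e (n + 1) = Φ τ (e n) * |driven Φ σ e n| := by
        rw [mul_comm, ← hΦ.smul _ _ _ (abs_pos.2 hm), ← hdec]; rfl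
      rw [heq]
      refine hmain.congr' ?_
      filter_upwards [hYinf.eventually_ne_atTop 0] with r hr
      simp only [Function.comp, hττ]
      rw [div_mul_div_cancel₀ hr]
      rfl

end Update

/-! ### Positive-part powers -/

theorem posPow_nonneg (α x : ℝ) : 0 ≤ posPow α x := Real.rpow_nonneg (le_max_right _ _) _

theorem posPow_of_nonpos {α x : ℝ} (hα : 0 < α) (hx : x ≤ 0) : posPow α x = 0 := by
  rw [posPow, max_eq_right hx, Real.zero_rpow hα.ne']

theorem posPow_of_nonneg {α x : ℝ} (hx : 0 ≤ x) : posPow α x = x ^ α := by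
  rw [posPow, max_eq_left hx]

@[fun_prop]
theorem measurable_posPow (α : ℝ) : Measurable (posPow α) := by
  unfold posPow
  fun_prop

/-- A monotone map commutes with finite suprema. Working in `NNReal` absorbs the positive part and
gives the empty supremum the value `0`, which `r ^ α` preserves because `α > 0`. -/
theorem iSup_ofReal_posPow {ι : Type*} {α : ℝ} (hα : 0 < α) (J : Finset ι) (f : ι → ℝ) :
    ⨆ j ∈ J, ENNReal.ofReal (posPow α (f j)) =
      ENNReal.ofReal (((J.sup fun j => (f j).toNNReal : NNReal) : ℝ) ^ α) := by
  have h1 : ∀ r : NNReal, ENNReal.ofReal ((r : ℝ) ^ α) = ((r ^ α : NNReal) : ENNReal) := fun r => by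
    rw [← NNReal.coe_rpow, ENNReal.ofReal_coe_nnreal]
  have h2 : ∀ y : ℝ, ENNReal.ofReal (posPow α y) = ((y.toNNReal ^ α : NNReal) : ENNReal) :=
    fun y => by rw [← h1, posPow, Real.coe_toNNReal']
  rw [h1, ← Finset.sup_eq_iSup]
  rw [Finset.apply_sup_eq_sup_comp_of_linearOrder (s := J) (f := fun j => (f j).toNNReal)
    (fun r : NNReal => ((r ^ α : NNReal) : ENNReal))]
  · exact Finset.sup_congr rfl fun j _ => h2 (f j)
  · exact fun a b hab => ENNReal.coe_le_coe.2 (NNReal.rpow_le_rpow hab hα.le)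
  · simp [NNReal.zero_rpow hα.ne']

theorem signProb_one_add (p : ℝ) : signProb p 1 + signProb p (-1) = 1 := by
  norm_num [signProb]

theorem measureReal_prod_fst {S : Type*} [MeasurableSpace S] {ρ : Measure ℝ} {E : Measure S}
    [IsProbabilityMeasure ρ] [IsProbabilityMeasure E] {A : ℝ → Prop} :
    (ρ.prod E).real {q | A q.1} = ρ.real {x | A x} := by
  have : {q : ℝ × S | A q.1} = {x | A x} ×ˢ Set.univ := by ext; simp
  rw [this, measureReal_prod_prod, probReal_univ, mul_one]

/-! ### One-step limits and the moment inequality -/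

section Limits

variable {S : Type*} [MeasurableSpace S] {E : Measure S} [IsProbabilityMeasure E]
  {ρ : Measure ℝ} [IsProbabilityMeasure ρ] {α p : ℝ} {Ψ Φ : ℝ → S → ℝ}

/-- The event is the difference of `{u κ < σ x}` and a sublevel set, and `c - max (c - d) 0 = min c
d`. If the sign has weight zero, the one-step limit says nothing there and the tail of `σ x` alone
forces the limit `0`. -/
theorem tendsto_joint_exceedance (hRV : HasRegularlyVaryingTails ρ id α p)
    (hΨ : Measurable (Function.uncurry Ψ)) (hΦ : IsTailUpdate Φ)
    (hlim : ∀ᵐ v ∂E, ∀ σ : ℝ, (σ = 1 ∨ σ = -1) → 0 < signProb p σ →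
        Tendsto (fun r : ℝ => Ψ (σ * r) v / r) atTop (𝓝 (Φ σ v)))
    {σ τ κ : ℝ} (hσ : σ = 1 ∨ σ = -1) (hκ : 0 < κ) :
    Tendsto (fun u => (ρ.prod E).real {q | u * κ < σ * q.1 ∧ u < τ * Ψ q.1 q.2} /
      ρ.real {x | u < |x|}) atTop
      (𝓝 (signProb p σ * ∫ v, min (κ ^ (-α)) (posPow α (τ * Φ σ v)) ∂E)) := by
  have hT : ∀ u, 0 ≤ ρ.real {x : ℝ | u < |x|} := fun u => measureReal_nonneg
  have hp0 : 0 ≤ signProb p σ := signProb_nonneg hRV.p_nonneg hRV.p_le_one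
  rcases hp0.eq_or_lt with hp | hp
  · rw [← hp, zero_mul]
    have h1 := hRV.tendsto_signed hσ hκ
    rw [← hp, zero_mul] at h1
    refine squeeze_zero (fun u => div_nonneg measureReal_nonneg (hT u)) (fun u => ?_) h1
    rw [← measureReal_prod_fst (E := E) (A := fun x => u * κ < σ * x)]
    exact div_le_div_of_nonneg_right (measureReal_mono fun q hq => hq.1) (hT u)
  have hgm : Measurable (Function.uncurry fun x v => max (τ * Ψ x v) 0) := by
    simp only [Function.uncurry_def]
    exact (measurable_const.mul hΨ).max measurable_const
  have h1 := tendsto_prod_tail_sublevel (ρ := ρ) E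
    (fun y hy => hRV.tendsto_signed hσ hy) hT hσ hRV.α_pos hgm
    (b := fun v => max (τ * Φ σ v) 0) hκ (by
      filter_upwards [hlim] with v hv
      refine ⟨le_max_right _ _, ?_⟩
      have := (((hv σ hσ hp).const_mul τ).max (tendsto_const_nhds (x := (0 : ℝ))))
      refine this.congr' ?_
      filter_upwards [eventually_gt_atTop 0] with r hr
      rw [← max_div_div_right hr.le, zero_div, mul_div_assoc])
  have h2 := (hRV.tendsto_signed hσ hκ).sub h1
  have hval : signProb p σ * κ ^ (-α) - ∫ v, max (signProb p σ * κ ^ (-α) -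
      signProb p σ * max (τ * Φ σ v) 0 ^ α) 0 ∂E =
      signProb p σ * ∫ v, min (κ ^ (-α)) (posPow α (τ * Φ σ v)) ∂E := by
    have hint : Integrable (fun v => max (signProb p σ * κ ^ (-α) -
        signProb p σ * max (τ * Φ σ v) 0 ^ α) 0) E := by
      have hm := hΦ.measurable_left σ
      refine Integrable.of_bound (Measurable.aestronglyMeasurable (by fun_prop))
        (signProb p σ * κ ^ (-α))
        (Eventually.of_forall fun v => ?_)
      rw [Real.norm_of_nonneg (le_max_right _ _)]
      refine max_le (sub_le_self _ ?_) (by positivity)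
      exact mul_nonneg hp.le (Real.rpow_nonneg (le_max_right _ _) _)
    rw [← integral_const_mul]
    have := integral_sub (μ := E) (integrable_const (signProb p σ * κ ^ (-α))) hint
    rw [integral_const, probReal_univ, one_smul] at this
    rw [← this]
    refine integral_congr_ae (Eventually.of_forall fun v => ?_)
    simp only [posPow]
    rw [mul_min_of_nonneg _ _ hp.le]
    rcases le_total (signProb p σ * κ ^ (-α)) (signProb p σ * max (τ * Φ σ v) 0 ^ α) with h | h
    · rw [max_eq_right (by linarith), min_eq_left h, sub_zero]
    · rw [max_eq_left (by linarith), min_eq_right h, sub_sub_cancel]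
  rw [hval] at h2
  refine h2.congr' ?_
  filter_upwards [eventually_ge_atTop 0] with u hu
  rw [← sub_div, ← measureReal_prod_fst (E := E) (A := fun x => u * κ < σ * x)]
  congr 1
  have hm : MeasurableSet {q : ℝ × S | u * κ < σ * q.1 ∧ max (τ * Ψ q.1 q.2) 0 ≤ u} :=
    (measurableSet_lt measurable_const
      (show Measurable fun q : ℝ × S => σ * q.1 by fun_prop)).inter
      (measurableSet_le hgm measurable_const)
  have hsub : {q : ℝ × S | u * κ < σ * q.1 ∧ max (τ * Ψ q.1 q.2) 0 ≤ u} ⊆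
      {q | u * κ < σ * q.1} := fun q hq => hq.1
  rw [← measureReal_sdiff hsub hm]
  congr 1
  ext q
  simp only [Set.mem_sdiff, Set.mem_ofPred_eq, not_and, not_le, max_le_iff]
  constructor
  · exact fun h => ⟨h.1, lt_of_not_ge fun h' => h.2 h.1 h' |>.not_ge hu⟩
  · exact fun h => ⟨h.1, fun _ h' => absurd h' h.2.not_ge⟩

/-- By stationarity `{τ X_1 > u}` has the probability of `{τ X_0 > u}`, and it contains the two
disjoint events where moreover `σ X_0 > u κ`, `σ = ±1`. In the limit this bounds the moment
truncated at `κ ^ (-α)` by `p(τ)`; then `κ → 0` by monotone convergence. -/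
theorem isTailPairLaw_updatePairLaw (hRV : HasRegularlyVaryingTails ρ id α p)
    (hΨ : Measurable (Function.uncurry Ψ)) (hΦ : IsTailUpdate Φ)
    (hlim : ∀ᵐ v ∂E, ∀ σ : ℝ, (σ = 1 ∨ σ = -1) → 0 < signProb p σ →
        Tendsto (fun r : ℝ => Ψ (σ * r) v / r) atTop (𝓝 (Φ σ v)))
    (hstat : (ρ.prod E).map (Function.uncurry Ψ) = ρ) :
    IsTailPairLaw p α (updatePairLaw E p Φ) := by
  have hsl := isProbabilityMeasure_signLaw hRV.p_nonneg hRV.p_le_one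
  refine ⟨Measure.isProbabilityMeasure_map hΦ.measurable_pair.aemeasurable, ?_, ?_, ?_⟩
  · simpa [signProb] using updatePairLaw_sign (E := E) (p := p) hΦ (Or.inl rfl)
  · rw [updatePairLaw_sign hΦ (Or.inr rfl)]; norm_num [signProb]
  intro τ hτ
  rw [updatePairLaw_sign hΦ hτ]
  have hm : ∀ σ, Measurable fun v => posPow α (τ * Φ σ v) := fun σ => by
    have := hΦ.measurable_left σ; fun_prop
  have hp0 : ∀ σ, 0 ≤ signProb p σ := fun σ => signProb_nonneg hRV.p_nonneg hRV.p_le_one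
  have key : ∀ κ, 0 < κ → signProb p 1 * ∫ v, min (κ ^ (-α)) (posPow α (τ * Φ 1 v)) ∂E +
      signProb p (-1) * ∫ v, min (κ ^ (-α)) (posPow α (τ * Φ (-1) v)) ∂E ≤ signProb p τ := by
    intro κ hκ
    have h1 := tendsto_joint_exceedance (τ := τ) hRV hΨ hΦ hlim (Or.inl rfl) hκ
    have h2 := tendsto_joint_exceedance (τ := τ) hRV hΨ hΦ hlim (Or.inr rfl) hκ
    have h3 := hRV.tendsto_signed hτ one_pos
    rw [Real.one_rpow, mul_one] at h3
    refine le_of_tendsto_of_tendsto (h1.add h2) h3 ?_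
    filter_upwards [eventually_ge_atTop 0] with u hu
    rw [← add_div]
    refine div_le_div_of_nonneg_right ?_ measureReal_nonneg
    have hΨm : Measurable fun q : ℝ × S => τ * Ψ q.1 q.2 := measurable_const.mul hΨ
    rw [← measureReal_union]
    · have h4 : ρ.real {x | u * 1 < τ * x} =
          (ρ.prod E).real {q | u < τ * Ψ q.1 q.2} := by
        conv_lhs => rw [← hstat]
        rw [map_measureReal_apply hΨ (measurableSet_lt measurable_const (by fun_prop))]
        simp [Function.uncurry_def]
      rw [h4]
      exact measureReal_mono (Set.union_subset (fun q hq => hq.2) fun q hq => hq.2)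
    · rw [Set.disjoint_left]
      rintro q ⟨hq, -⟩ ⟨hq', -⟩
      have : 0 ≤ u * κ := by positivity
      linarith
    · exact (measurableSet_lt measurable_const
        (show Measurable fun q : ℝ × S => -1 * q.1 by fun_prop)).inter
        (measurableSet_lt measurable_const hΨm)
  have key' : ∀ N : ℕ, ∫⁻ q, ENNReal.ofReal (min ((N : ℝ) + 1) (posPow α (τ * q.2)))
      ∂updatePairLaw E p Φ ≤ ENNReal.ofReal (signProb p τ) := by
    intro N
    have hN : (0 : ℝ) < N + 1 := by positivity
    -- This `κ` makes the truncation level `κ ^ (-α)` equal to `N + 1`.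
    have hk := key (((N : ℝ) + 1) ^ (-α⁻¹)) (by positivity)
    rw [← Real.rpow_mul hN.le, neg_mul_neg, inv_mul_cancel₀ hRV.α_pos.ne', Real.rpow_one] at hk
    rw [lintegral_updatePairLaw hΦ (by fun_prop)]
    have hint : ∀ σ, ∫⁻ v, ENNReal.ofReal (min ((N : ℝ) + 1) (posPow α (τ * Φ σ v))) ∂E =
        ENNReal.ofReal (∫ v, min ((N : ℝ) + 1) (posPow α (τ * Φ σ v)) ∂E) := fun σ => by
      have hnn : ∀ v, 0 ≤ min ((N : ℝ) + 1) (posPow α (τ * Φ σ v)) := fun v =>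
        le_min hN.le (posPow_nonneg _ _)
      refine (ofReal_integral_eq_lintegral_ofReal ?_ (Eventually.of_forall hnn)).symm
      refine Integrable.of_bound (measurable_const.min (hm σ)).aestronglyMeasurable (N + 1)
        (Eventually.of_forall fun v => ?_)
      rw [Real.norm_of_nonneg (hnn v)]
      exact min_le_left _ _
    have hJ : ∀ σ, 0 ≤ ∫ v, min ((N : ℝ) + 1) (posPow α (τ * Φ σ v)) ∂E := fun σ =>
      integral_nonneg fun v => le_min hN.le (posPow_nonneg _ _)
    rw [hint, hint, ← ENNReal.ofReal_mul (hp0 _), ← ENNReal.ofReal_mul (hp0 _),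
      ← ENNReal.ofReal_add (mul_nonneg (hp0 _) (hJ _)) (mul_nonneg (hp0 _) (hJ _))]
    exact ENNReal.ofReal_le_ofReal hk
  refine le_of_tendsto' (lintegral_tendsto_of_tendsto_of_monotone
    (fun N => (by fun_prop : AEMeasurable _ _)) (Eventually.of_forall fun q => ?_)
    (Eventually.of_forall fun q => ?_)) key'
  · intro N N' h
    exact ENNReal.ofReal_le_ofReal (min_le_min_right _ (by gcongr))
  · refine tendsto_const_nhds.congr' ?_
    obtain ⟨N₀, hN₀⟩ := exists_nat_ge (posPow α (τ * q.2))
    filter_upwards [eventually_ge_atTop N₀] with N hN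
    rw [min_eq_right]
    have : (N₀ : ℝ) ≤ N := by exact_mod_cast hN
    linarith

end Limits

theorem measurable_finset_sup {δ ι L : Type*} [MeasurableSpace δ] [MeasurableSpace L]
    [SemilatticeSup L] [OrderBot L] [MeasurableSup₂ L] (J : Finset ι) {f : ι → δ → L}
    (hf : ∀ j, Measurable (f j)) : Measurable fun x => J.sup fun j => f j x := by
  induction J using Finset.cons_induction with
  | empty => simp
  | cons a J ha ih =>
    simp only [Finset.sup_cons]
    exact (hf a).sup ih

/-! ### Limits for the last exceedance -/

section LastExceedance

variable {S : Type*} [MeasurableSpace S] {E : Measure S} [IsProbabilityMeasure E]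
  {ρ : Measure ℝ} [IsProbabilityMeasure ρ] {α p : ℝ} {Ψ Φ : ℝ → S → ℝ}

theorem measurable_iSup_posPow_driven (hΦ : Measurable (Function.uncurry Φ)) (α : ℝ) {ι : Type*}
    (J : Finset ι) (w : ι → ℝ) (k : ι → ℕ) :
    Measurable fun q : ℝ × (ℕ → S) =>
      ⨆ j ∈ J, ENNReal.ofReal (posPow α (w j * driven Φ q.1 q.2 (k j))) := by
  simp only [← Finset.sup_eq_iSup]
  refine measurable_finset_sup J fun j => ?_
  · have := measurable_driven hΦ (k j)
    fun_prop

/-- For `u ≥ 0`, all the later inequalities together say that the maximum of the positive parts is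
at most `u`; this maximum is the function `g` of the sublevel limit. Truncated subtraction in
`ENNReal` expresses the positive part of the result. -/
theorem tendsto_last_exceedance_of_sign (hRV : HasRegularlyVaryingTails ρ id α p)
    (hΨ : Measurable (Function.uncurry Ψ)) (hΦ : IsTailUpdate Φ)
    (hlim : ∀ᵐ e ∂iidLaw E, ∀ σ : ℝ, (σ = 1 ∨ σ = -1) → 0 < signProb p σ → ∀ n,
      Tendsto (fun r : ℝ => driven Ψ (σ * r) e n / r) atTop (𝓝 (driven Φ σ e n)))
    {ι : Type*} (J : Finset ι) (w : ι → ℝ) (k : ι → ℕ) {σ κ : ℝ} (hσ : σ = 1 ∨ σ = -1)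
    (hκ : 0 < κ) :
    ∃ L : ℝ, 0 ≤ L ∧ Tendsto (fun u => (ρ.prod (iidLaw E)).real
        {q | u * κ < σ * q.1 ∧ ∀ j ∈ J, w j * driven Ψ q.1 q.2 (k j) ≤ u} /
          ρ.real {x | u < |x|}) atTop (𝓝 L) ∧
      ENNReal.ofReal L = ENNReal.ofReal (signProb p σ) * ∫⁻ e, (ENNReal.ofReal (κ ^ (-α)) -
        ⨆ j ∈ J, ENNReal.ofReal (posPow α (w j * driven Φ σ e (k j)))) ∂iidLaw E := by
  have hT : ∀ u, 0 ≤ ρ.real {x : ℝ | u < |x|} := fun u => measureReal_nonneg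
  have hp0 : 0 ≤ signProb p σ := signProb_nonneg hRV.p_nonneg hRV.p_le_one
  rcases hp0.eq_or_lt with hp | hp
  · refine ⟨0, le_rfl, ?_, by simp [← hp]⟩
    have h1 := hRV.tendsto_signed hσ hκ
    rw [← hp, zero_mul] at h1
    refine squeeze_zero (fun u => div_nonneg measureReal_nonneg (hT u)) (fun u => ?_) h1
    rw [← measureReal_prod_fst (E := iidLaw E) (A := fun x => u * κ < σ * x)]
    exact div_le_div_of_nonneg_right (measureReal_mono fun q hq => hq.1) (hT u)
  set g : ℝ → (ℕ → S) → ℝ := fun x e =>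
    (J.sup fun j => (w j * driven Ψ x e (k j)).toNNReal : NNReal) with hg
  set b : (ℕ → S) → ℝ := fun e =>
    (J.sup fun j => (w j * driven Φ σ e (k j)).toNNReal : NNReal) with hb
  have hgm : Measurable (Function.uncurry g) := by
    refine measurable_coe_nnreal_real.comp (measurable_finset_sup J fun j => ?_)
    have := measurable_driven hΨ (k j)
    fun_prop
  have hbm : Measurable b := by
    refine measurable_coe_nnreal_real.comp (measurable_finset_sup J fun j => ?_)
    have := (measurable_driven hΦ.measurable (k j)).comp (measurable_prodMk_left (x := σ))
    simp only [Function.comp_def] at this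
    fun_prop
  have h1 := tendsto_prod_tail_sublevel (ρ := ρ) (iidLaw E)
    (fun y hy => hRV.tendsto_signed hσ hy) hT hσ hRV.α_pos hgm (b := b) hκ (by
      filter_upwards [hlim] with e he
      refine ⟨NNReal.coe_nonneg _, ?_⟩
      have h2 : Tendsto (fun r => ((J.sup fun j =>
          (w j * (driven Ψ (σ * r) e (k j) / r)).toNNReal : NNReal) : ℝ)) atTop (𝓝 (b e)) := by
        refine (NNReal.continuous_coe.tendsto _).comp ?_
        exact Tendsto.finset_sup_nhds_apply fun j _ =>
          (continuous_real_toNNReal.tendsto _).comp ((he σ hσ hp (k j)).const_mul (w j))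
      refine h2.congr' ?_
      filter_upwards [eventually_gt_atTop 0] with r hr
      simp only [hg, ← mul_div_assoc, Real.toNNReal_div' hr.le]
      rw [← NNReal.finset_sup_div, NNReal.coe_div, Real.coe_toNNReal _ hr.le])
  have hnn : ∀ e, 0 ≤ max (signProb p σ * κ ^ (-α) - signProb p σ * b e ^ α) 0 := fun e =>
    le_max_right _ _
  refine ⟨_, integral_nonneg hnn, h1.congr' ?_, ?_⟩
  · filter_upwards [eventually_ge_atTop 0] with u hu
    congr 2
    ext q
    refine and_congr_right fun _ => ?_
    simp only [hg]
    rw [← Real.le_toNNReal_iff_coe_le hu, Finset.sup_le_iff]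
    refine forall₂_congr fun j _ => ?_
    rw [Real.toNNReal_le_toNNReal_iff hu]
  · have hκα : 0 ≤ κ ^ (-α) := by positivity
    have hbα : ∀ e, 0 ≤ b e ^ α := fun e => Real.rpow_nonneg (NNReal.coe_nonneg _) _
    rw [ofReal_integral_eq_lintegral_ofReal _ (Eventually.of_forall hnn),
      ← lintegral_const_mul' _ _ ENNReal.ofReal_ne_top]
    · refine lintegral_congr fun e => ?_
      rw [iSup_ofReal_posPow hRV.α_pos, ← ENNReal.ofReal_sub _ (hbα e), ← ENNReal.ofReal_mul hp.le,
        mul_sub, ENNReal.ofReal_max, ENNReal.ofReal_zero, max_eq_left zero_le]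
    · refine Integrable.of_bound (Measurable.aestronglyMeasurable (by fun_prop))
        (signProb p σ * κ ^ (-α)) (Eventually.of_forall fun e => ?_)
      rw [Real.norm_of_nonneg (hnn e)]
      exact max_le (sub_le_self _ (mul_nonneg hp.le (hbα e))) (mul_nonneg hp.le hκα)

/-- Only the sign of `y` contributes: `u < y x` means `u κ < sign(y) x` with `κ = |y|⁻¹`, and `κ ^
(-α) = |y| ^ α`. For `y = 0` the event is empty once `u ≥ 0`. -/
theorem exists_tendsto_last_exceedance (hRV : HasRegularlyVaryingTails ρ id α p)
    (hΨ : Measurable (Function.uncurry Ψ)) (hΦ : IsTailUpdate Φ)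
    (hlim : ∀ᵐ e ∂iidLaw E, ∀ σ : ℝ, (σ = 1 ∨ σ = -1) → 0 < signProb p σ → ∀ n,
      Tendsto (fun r : ℝ => driven Ψ (σ * r) e n / r) atTop (𝓝 (driven Φ σ e n)))
    {ι : Type*} (J : Finset ι) (w : ι → ℝ) (k : ι → ℕ) (y : ℝ) :
    ∃ L : ℝ, 0 ≤ L ∧ Tendsto (fun u => (ρ.prod (iidLaw E)).real
        {q | u < y * q.1 ∧ ∀ j ∈ J, w j * driven Ψ q.1 q.2 (k j) ≤ u} /
          ρ.real {x | u < |x|}) atTop (𝓝 L) ∧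
      ENNReal.ofReal L = ∫⁻ q, (ENNReal.ofReal (posPow α (y * q.1)) -
        ⨆ j ∈ J, ENNReal.ofReal (posPow α (w j * driven Φ q.1 q.2 (k j))))
          ∂(signLaw p).prod (iidLaw E) := by
  have hα := hRV.α_pos
  have hm : Measurable fun q : ℝ × (ℕ → S) => ENNReal.ofReal (posPow α (y * q.1)) -
      ⨆ j ∈ J, ENNReal.ofReal (posPow α (w j * driven Φ q.1 q.2 (k j))) :=
    Measurable.sub (by fun_prop) (measurable_iSup_posPow_driven hΦ.measurable α J w k)
  rw [lintegral_prod _ hm.aemeasurable, lintegral_signLaw]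
  rcases lt_trichotomy y 0 with hy | rfl | hy
  · obtain ⟨L, h0, h1, h2⟩ := tendsto_last_exceedance_of_sign hRV hΨ hΦ hlim J w k (σ := -1)
      (Or.inr rfl) (inv_pos.2 (neg_pos.2 hy))
    refine ⟨L, h0, h1.congr fun u => ?_, ?_⟩
    · congr 3
      ext q
      rw [← div_eq_mul_inv, div_lt_iff₀ (neg_pos.2 hy)]
      simp only [mul_comm, mul_one, mul_neg, neg_neg]
    · have e1 : posPow α (y * 1) = 0 := posPow_of_nonpos hα (by linarith)
      have e2 : posPow α (y * -1) = (-y)⁻¹ ^ (-α) := by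
        rw [posPow_of_nonneg (by linarith), Real.inv_rpow (by linarith), Real.rpow_neg (by linarith),
          inv_inv, mul_neg_one]
      simp only [h2, e1, e2, ENNReal.ofReal_zero, zero_tsub, lintegral_zero, mul_zero, zero_add]
  · refine ⟨0, le_rfl, tendsto_const_nhds.congr' ?_, ?_⟩
    · filter_upwards [eventually_ge_atTop 0] with u hu
      simp [hu.not_gt]
    · simp [posPow_of_nonpos hα le_rfl]
  · obtain ⟨L, h0, h1, h2⟩ := tendsto_last_exceedance_of_sign hRV hΨ hΦ hlim J w k (σ := 1)
      (Or.inl rfl) (inv_pos.2 hy)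
    refine ⟨L, h0, h1.congr fun u => ?_, ?_⟩
    · congr 3
      ext q
      rw [← div_eq_mul_inv, div_lt_iff₀ hy]
      simp only [mul_comm, mul_one]
    · have e1 : posPow α (y * -1) = 0 := posPow_of_nonpos hα (by linarith)
      have e2 : posPow α (y * 1) = y⁻¹ ^ (-α) := by
        rw [mul_one, posPow_of_nonneg hy.le, Real.inv_rpow hy.le, Real.rpow_neg hy.le, inv_inv]
      simp only [h2, e1, e2, ENNReal.ofReal_zero, zero_tsub, lintegral_zero, mul_zero, add_zero]

end LastExceedance

/-! ### Existence of the tail dependence limit -/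

section Chain

variable {Ω S : Type*} [MeasurableSpace Ω] [MeasurableSpace S] {P : Measure Ω}
  [IsProbabilityMeasure P] {X : ℕ → Ω → ℝ} {ε : ℕ → Ω → S} {Ψ Φ : ℝ → S → ℝ} {α p : ℝ}

/-- The limit of the normalised probability of an exceedance, decomposed according to the last
exceedance. -/
theorem exists_tail_dependence_limit (hX : IsStationaryMarkovChain P X ε Ψ)
    (hRV : HasRegularlyVaryingTails P (X 0) α p) [IsProbabilityMeasure (P.map (ε 0))]
    (hΦ : IsTailUpdate Φ)
    (hlim : ∀ᵐ e ∂iidLaw (P.map (ε 0)), ∀ σ : ℝ, (σ = 1 ∨ σ = -1) → 0 < signProb p σ → ∀ n,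
      Tendsto (fun r : ℝ => driven Ψ (σ * r) e n / r) atTop (𝓝 (driven Φ σ e n)))
    (t : ℕ) (x : Fin (t + 1) → ℝ) :
    ∃ L : ℝ, 0 ≤ L ∧ Tendsto (fun u : ℝ => P.real {ω | ∃ i : Fin (t + 1), u < x i * X i ω} /
          P.real {ω | u < |X 0 ω|}) atTop (𝓝 L) ∧
      ENNReal.ofReal L = ∑ i, ∫⁻ q, (ENNReal.ofReal (posPow α (x i * q.1)) -
        ⨆ j ∈ Finset.Ioi i, ENNReal.ofReal (posPow α (x j * driven Φ q.1 q.2 (j - i : ℕ))))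
          ∂(signLaw p).prod (iidLaw (P.map (ε 0))) := by
  have hρ : IsProbabilityMeasure (P.map (X 0)) :=
    Measure.isProbabilityMeasure_map (hX.measurable_X 0).aemeasurable
  have hRV' := hRV.map (hX.measurable_X 0)
  choose L hL0 hL1 hL2 using fun i : Fin (t + 1) => exists_tendsto_last_exceedance hRV'
    hX.measurable_Ψ hΦ hlim (Finset.Ioi i) x (fun j => (j - i : ℕ)) (x i)
  refine ⟨∑ i, L i, Finset.sum_nonneg fun i _ => hL0 i, ?_, ?_⟩
  · refine (tendsto_finsetSum _ fun i _ => hL1 i).congr fun u => ?_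
    have hT : (P.map (X 0)).real {x | u < |x|} = P.real {ω | u < |X 0 ω|} := by
      rw [map_measureReal_apply (hX.measurable_X 0)
        (measurableSet_lt measurable_const (by fun_prop))]
      rfl
    rw [hT, ← Finset.sum_div]
    congr 1
    -- `A i` is the event that `i` is the last exceedance. Splitting at the last rather than the
    -- first index leaves conditions on the future of `X_i` only, a function of `X_i` and of
    -- innovations independent of it.
    set A : Fin (t + 1) → Set Ω := fun i =>
      {ω | u < x i * X i ω ∧ ∀ j ∈ Finset.Ioi i, x j * X j ω ≤ u} with hA
    have hAm : ∀ i, MeasurableSet (A i) := fun i => by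
      have h1 : MeasurableSet {ω | u < x i * X i ω} :=
        measurableSet_lt measurable_const ((hX.measurable_X _).const_mul _)
      have h2 : MeasurableSet {ω | ∀ j ∈ Finset.Ioi i, x j * X j ω ≤ u} := by
        have : {ω | ∀ j ∈ Finset.Ioi i, x j * X j ω ≤ u} =
            ⋂ j ∈ Finset.Ioi i, {ω | x j * X j ω ≤ u} := by ext; simp
        rw [this]
        exact Finset.measurableSet_biInter _ fun j _ =>
          measurableSet_le ((hX.measurable_X _).const_mul _) measurable_const
      exact h1.inter h2
    have hunion : {ω | ∃ i : Fin (t + 1), u < x i * X i ω} = ⋃ i, A i := by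
      ext ω
      simp only [Set.mem_ofPred_eq, Set.mem_iUnion, hA]
      refine ⟨fun h => ?_, fun ⟨i, hi⟩ => ⟨i, hi.1⟩⟩
      obtain ⟨i, hi, hmax⟩ := Set.Finite.exists_maximal
        (Set.toFinite {i : Fin (t + 1) | u < x i * X i ω}) h
      refine ⟨i, hi, fun j hj => not_lt.1 fun hj' => ?_⟩
      have := hmax (y := j) hj' (Finset.mem_Ioi.1 hj).le
      exact absurd (Finset.mem_Ioi.1 hj) this.not_gt
    have hdisj : Pairwise (Function.onFun Disjoint A) := by
      intro i j hij
      rw [Function.onFun, Set.disjoint_left]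
      rintro ω ⟨h1, h2⟩ ⟨h3, h4⟩
      rcases hij.lt_or_gt with h | h
      · exact absurd h3 (h2 j (Finset.mem_Ioi.2 h)).not_gt
      · exact absurd h1 (h4 i (Finset.mem_Ioi.2 h)).not_gt
    rw [hunion, measureReal_iUnion_fintype hdisj hAm]
    refine Finset.sum_congr rfl fun i _ => ?_
    have hBm : MeasurableSet {q : ℝ × (ℕ → S) | u < x i * q.1 ∧
        ∀ j ∈ Finset.Ioi i, x j * driven Ψ q.1 q.2 (j - i : ℕ) ≤ u} := by
      have h1 : MeasurableSet {q : ℝ × (ℕ → S) | u < x i * q.1} :=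
        measurableSet_lt measurable_const (by fun_prop)
      have h2 : MeasurableSet {q : ℝ × (ℕ → S) |
          ∀ j ∈ Finset.Ioi i, x j * driven Ψ q.1 q.2 (j - i : ℕ) ≤ u} := by
        have : {q : ℝ × (ℕ → S) | ∀ j ∈ Finset.Ioi i, x j * driven Ψ q.1 q.2 (j - i : ℕ) ≤ u} =
            ⋂ j ∈ Finset.Ioi i, {q | x j * driven Ψ q.1 q.2 (j - i : ℕ) ≤ u} := by ext; simp
        rw [this]
        exact Finset.measurableSet_biInter _ fun j _ =>
          measurableSet_le ((measurable_driven hX.measurable_Ψ _).const_mul _) measurable_const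
      exact h1.inter h2
    rw [← hX.map_state_innovations i, map_measureReal_apply ((hX.measurable_X i).prodMk
      (measurable_pi_iff.2 fun k => hX.measurable_ε _)) hBm]
    refine measureReal_congr ?_
    filter_upwards [hX.ae_eq_driven] with ω hω
    refine propext (and_congr_right fun _ => forall₂_congr fun j hj => ?_)
    have := hω i (j - i : ℕ)
    rw [Nat.add_sub_cancel' (Fin.le_def.1 (Finset.mem_Ioi.1 hj).le)] at this
    rw [this]
  · rw [ENNReal.ofReal_sum_of_nonneg fun i _ => hL0 i]
    exact Finset.sum_congr rfl fun i _ => hL2 i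

end Chain

/-! ### Transition laws of a tail chain -/

section Transition

variable (μ : Measure (ℝ × ℝ))

theorem measurableSet_fst_eq (s : ℝ) : MeasurableSet {q : ℝ × ℝ | q.1 = s} :=
  measurable_fst (measurableSet_singleton s)

theorem tailTransition_zero : tailTransition μ 0 = Measure.dirac 0 := by simp [tailTransition]

theorem tailTransition_of_ne_zero {x : ℝ} (hx : x ≠ 0) :
    tailTransition μ x =
      (ProbabilityTheory.cond μ {q | q.1 = Real.sign x}).map (fun q => x * (q.2 / q.1)) := by
  simp [tailTransition, hx]

theorem lintegral_tailTransition {x : ℝ} (hx : x ≠ 0) {f : ℝ → ENNReal} (hf : Measurable f) :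
    ∫⁻ z, f z ∂tailTransition μ x =
      ∫⁻ q, f (x * (q.2 / q.1)) ∂ProbabilityTheory.cond μ {q | q.1 = Real.sign x} := by
  rw [tailTransition_of_ne_zero μ hx, lintegral_map hf (by fun_prop)]

/-- A positive factor keeps the sign, hence the conditioning event. This carries homogeneity through
the integration of a coordinate in `IsHomogeneousFunctional.step`. -/
theorem lintegral_tailTransition_mul {c : ℝ} (hc : 0 < c) (x : ℝ) {f : ℝ → ENNReal}
    (hf : Measurable f) :
    ∫⁻ z, f z ∂tailTransition μ (c * x) = ∫⁻ z, f (c * z) ∂tailTransition μ x := by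
  by_cases hx : x = 0
  · subst hx
    simp [tailTransition_zero, lintegral_dirac]
  · rw [lintegral_tailTransition μ (mul_ne_zero hc.ne' hx) hf,
      lintegral_tailTransition μ hx (by fun_prop)]
    have hs : Real.sign (c * x) = Real.sign x := by
      rcases lt_or_gt_of_ne hx with h | h
      · rw [Real.sign_of_neg h, Real.sign_of_neg (mul_neg_of_pos_of_neg hc h)]
      · rw [Real.sign_of_pos h, Real.sign_of_pos (mul_pos hc h)]
    rw [hs]
    simp only [mul_assoc]

/-- Only an inequality: conditioning on a sign of mass zero yields the zero measure. -/
theorem tailTransition_univ_le (x : ℝ) : tailTransition μ x Set.univ ≤ 1 := by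
  by_cases hx : x = 0
  · subst hx; simp [tailTransition_zero]
  · rw [tailTransition_of_ne_zero μ hx, Measure.map_apply (by fun_prop) MeasurableSet.univ]
    exact prob_le_one

theorem measurable_tailTransition : Measurable (tailTransition μ) := by
  refine Measure.measurable_of_measurable_coe _ fun A hA => ?_
  have key : ∀ s : ℝ, Measurable fun x : ℝ =>
      ProbabilityTheory.cond μ {q | q.1 = s} {q | x * (q.2 / q.1) ∈ A} := fun s => by
    have hm : Measurable fun r : ℝ × (ℝ × ℝ) => r.1 * (r.2.2 / r.2.1) := by fun_prop
    exact measurable_measure_prodMk_left (hm hA)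
  have heq : (fun x => tailTransition μ x A) = fun x => if x = 0 then Measure.dirac (0 : ℝ) A
      else if 0 < x then ProbabilityTheory.cond μ {q | q.1 = 1} {q | x * (q.2 / q.1) ∈ A}
      else ProbabilityTheory.cond μ {q | q.1 = -1} {q | x * (q.2 / q.1) ∈ A} := by
    ext x
    split_ifs with h1 h2
    · rw [h1, tailTransition_zero]
    · rw [tailTransition_of_ne_zero μ h1, Measure.map_apply (by fun_prop) hA, Real.sign_of_pos h2]
      rfl
    · rw [tailTransition_of_ne_zero μ h1, Measure.map_apply (by fun_prop) hA,
        Real.sign_of_neg (lt_of_le_of_ne (not_lt.1 h2) h1)]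
      rfl
  rw [heq]
  exact Measurable.ite (measurableSet_singleton 0) measurable_const
    (Measurable.ite measurableSet_Ioi (key 1) (key (-1)))

theorem measurable_tailTransition_apply {T : Type*} [MeasurableSpace T] {x : T → ℝ}
    (hx : Measurable x) {A : Set ℝ} (hA : MeasurableSet A) :
    Measurable fun m => tailTransition μ (x m) A :=
  (Measure.measurable_coe hA).comp ((measurable_tailTransition μ).comp hx)

/-- The transition laws of a tail chain as a kernel. -/
noncomputable def tailKernel : Kernel ℝ ℝ where
  toFun := tailTransition μ
  measurable' := measurable_tailTransition μ

instance : IsFiniteKernel (tailKernel μ) :=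
  ⟨⟨1, ENNReal.one_lt_top, fun x => tailTransition_univ_le μ x⟩⟩

theorem measurable_lintegral_tailTransition {T : Type*} [MeasurableSpace T] {x : T → ℝ}
    (hx : Measurable x) {f : T → ℝ → ENNReal} (hf : Measurable (Function.uncurry f)) :
    Measurable fun m => ∫⁻ z, f m z ∂tailTransition μ (x m) :=
  Measurable.lintegral_kernel_prod_right (κ := (tailKernel μ).comap x hx) hf

end Transition

/-! ### Integrating out one coordinate; time reversal -/

section Step

variable {α p : ℝ} {μ : Measure (ℝ × ℝ)} {Q : Measure (ℤ → ℝ)}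

theorem measurable_update_int (j : ℤ) :
    Measurable fun q : (ℤ → ℝ) × ℝ => Function.update q.1 j q.2 :=
  measurable_pi_iff.2 fun i => by
    by_cases h : i = j
    · subst h; simpa using measurable_snd
    · simp only [ne_eq, h, not_false_eq_true, Function.update_of_ne]; fun_prop

/-- The step identity on rectangles says that past and next state are jointly distributed as past
law times transition kernel. A functional of the coordinates up to `t + 1` factors through this
pair. -/
theorem IsBackForthTailChain.lintegral_forward (hQ : IsBackForthTailChain α p μ Q) (t : ℕ)
    {h : (ℤ → ℝ) → ENNReal} (hm : Measurable h) (hd : DependsOn h (Set.Iic ((t : ℤ) + 1))) :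
    ∫⁻ m, h m ∂Q =
      ∫⁻ m, ∫⁻ z, h (Function.update m ((t : ℤ) + 1) z) ∂tailTransition μ (m t) ∂Q := by
  have := hQ.isProb
  have := hQ.law_mem.isProb
  set past : (ℤ → ℝ) → ℕ → ℝ := fun m k => m ((t : ℤ) - k) with hpast
  have hpm : Measurable past := by fun_prop
  have hmeas : Q.map (fun m => (past m, m ((t : ℤ) + 1))) =
      (Q.map past) ⊗ₘ ((tailKernel μ).comap (fun w : ℕ → ℝ => w 0) (measurable_pi_apply 0)) := by
    refine Measure.ext_prod fun {B A} hB hA => ?_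
    rw [Measure.map_apply (by fun_prop) (hB.prod hA), Measure.compProd_apply_prod hB hA,
      setLIntegral_map hB (Kernel.measurable_coe _ hA) hpm]
    have := hQ.forward_step t B A hB hA
    rw [hQ.forward_law] at this
    exact this
  -- Rebuilds a two-sided sequence from past and next state. Beyond `t + 1`, `toNat` returns `0` and
  -- the entries are irrelevant copies of the state at `t`, which `h` does not see.
  set r : (ℕ → ℝ) × ℝ → ℤ → ℝ := fun q k =>
    if k = (t : ℤ) + 1 then q.2 else q.1 ((t : ℤ) - k).toNat
    with hr
  have hrm : Measurable r := measurable_pi_iff.2 fun k => by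
    by_cases hk : k = (t : ℤ) + 1
    · simp only [hr, hk, if_true]; fun_prop
    · simp only [hr, hk, if_false]; fun_prop
  have h1 : ∀ m z, h (Function.update m ((t : ℤ) + 1) z) = h (r (past m, z)) := fun m z => by
    refine hd fun k hk => ?_
    simp only [hr, hpast]
    split_ifs with hkt
    · subst hkt; simp
    · rw [Function.update_of_ne hkt]
      congr 1
      have := Set.mem_Iic.1 hk
      omega
  have h2 : ∀ m, h m = h (r (past m, m ((t : ℤ) + 1))) := fun m => by
    rw [← h1, Function.update_eq_self]
  calc ∫⁻ m, h m ∂Q = ∫⁻ m, h (r (past m, m ((t : ℤ) + 1))) ∂Q := lintegral_congr h2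
    _ = ∫⁻ q, h (r q) ∂Q.map (fun m => (past m, m ((t : ℤ) + 1))) :=
      (lintegral_map (hm.comp hrm) (by fun_prop)).symm
    _ = ∫⁻ q, (h ∘ r) q ∂((Q.map past) ⊗ₘ
          ((tailKernel μ).comap (fun w : ℕ → ℝ => w 0) (measurable_pi_apply 0))) := by
      rw [hmeas]; rfl
    _ = ∫⁻ m, ∫⁻ z, h (r (past m, z)) ∂tailTransition μ (m t) ∂Q := by
      rw [Measure.lintegral_compProd (hm.comp hrm), lintegral_map _ hpm]
      · refine lintegral_congr fun m => ?_
        simp [hpast, Kernel.comap_apply, tailKernel]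
      · exact Measurable.lintegral_kernel_prod_right' (hm.comp hrm)
    _ = _ := by simp only [h1]

/-- Time reversal of a two-sided sequence. -/
def reverseSeq (m : ℤ → ℝ) : ℤ → ℝ := fun k => m (-k)

@[fun_prop]
theorem measurable_reverseSeq : Measurable reverseSeq := by
  unfold reverseSeq
  fun_prop

theorem AreAdjoint.symm {μ' : Measure (ℝ × ℝ)} (h : AreAdjoint α μ μ') : AreAdjoint α μ' μ := by
  intro x y
  have := h y x
  simp only [min_comm (posPow α (x * _))]
  exact this.symm

/-- The definition is symmetric under time reversal, since adjointness is symmetric; backward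
statements thus follow from forward ones. -/
theorem IsBackForthTailChain.reverse (hQ : IsBackForthTailChain α p μ Q) :
    IsBackForthTailChain α p (Q.map fun m => (m 0, m (-1))) (Q.map reverseSeq) := by
  have := hQ.isProb
  have hf : (Q.map reverseSeq).map (fun m => (m 0, m 1)) = Q.map fun m => (m 0, m (-1)) := by
    rw [Measure.map_map (by fun_prop) measurable_reverseSeq]; rfl
  have hb : (Q.map reverseSeq).map (fun m => (m 0, m (-1))) = Q.map fun m => (m 0, m 1) := by
    rw [Measure.map_map (by fun_prop) measurable_reverseSeq]; rfl
  refine ⟨Measure.isProbabilityMeasure_map measurable_reverseSeq.aemeasurable, hQ.backward_mem, hf,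
    by rw [hb, hQ.forward_law]; exact hQ.law_mem,
    by rw [hb, hQ.forward_law]; exact hQ.adjoint.symm, ?_, ?_⟩
  · intro t B A hB hA
    have hBm : MeasurableSet {m : ℤ → ℝ | (fun k : ℕ => m ((t : ℤ) - k)) ∈ B} :=
      (show Measurable fun (m : ℤ → ℝ) (k : ℕ) => m ((t : ℤ) - k) by fun_prop) hB
    have hAm : MeasurableSet {m : ℤ → ℝ | m ((t : ℤ) + 1) ∈ A} :=
      (show Measurable fun m : ℤ → ℝ => m ((t : ℤ) + 1) by fun_prop) hA
    rw [hf, Measure.map_apply measurable_reverseSeq (s := {m : ℤ → ℝ |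
      (fun k : ℕ => m ((t : ℤ) - k)) ∈ B ∧ m ((t : ℤ) + 1) ∈ A}) (hBm.inter hAm),
      setLIntegral_map hBm (measurable_tailTransition_apply _ (measurable_pi_apply (t : ℤ)) hA)
        measurable_reverseSeq]
    have e1 : ∀ k : ℕ, -((t : ℤ) - k) = -t + k := fun k => by ring
    have e2 : -((t : ℤ) + 1) = -t - 1 := by ring
    simp only [Set.preimage_ofPred_eq, reverseSeq, e1, e2]
    exact hQ.backward_step t B A hB hA
  · intro t B A hB hA
    have hBm : MeasurableSet {m : ℤ → ℝ | (fun k : ℕ => m (-(t : ℤ) + k)) ∈ B} :=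
      (show Measurable fun (m : ℤ → ℝ) (k : ℕ) => m (-(t : ℤ) + k) by fun_prop) hB
    have hAm : MeasurableSet {m : ℤ → ℝ | m (-(t : ℤ) - 1) ∈ A} :=
      (show Measurable fun m : ℤ → ℝ => m (-(t : ℤ) - 1) by fun_prop) hA
    rw [hb, Measure.map_apply measurable_reverseSeq (s := {m : ℤ → ℝ |
      (fun k : ℕ => m (-(t : ℤ) + k)) ∈ B ∧ m (-(t : ℤ) - 1) ∈ A}) (hBm.inter hAm),
      setLIntegral_map hBm (measurable_tailTransition_apply _ (measurable_pi_apply (-(t : ℤ))) hA)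
        measurable_reverseSeq]
    have e1 : ∀ k : ℕ, -(-(t : ℤ) + k) = t - k := fun k => by ring
    have e2 : -(-(t : ℤ) - 1) = t + 1 := by ring
    simp only [Set.preimage_ofPred_eq, reverseSeq, e1, e2, neg_neg]
    exact hQ.forward_step t B A hB hA

theorem IsBackForthTailChain.lintegral_backward (hQ : IsBackForthTailChain α p μ Q) (t : ℕ)
    {h : (ℤ → ℝ) → ENNReal} (hm : Measurable h) (hd : DependsOn h (Set.Ici (-(t : ℤ) - 1))) :
    ∫⁻ m, h m ∂Q = ∫⁻ m, ∫⁻ z, h (Function.update m (-(t : ℤ) - 1) z)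
      ∂tailTransition (Q.map fun m => (m 0, m (-1))) (m (-t)) ∂Q := by
  have hrr : ∀ m, reverseSeq (reverseSeq m) = m := fun m =>
    funext fun k => by simp [reverseSeq]
  have := hQ.reverse.lintegral_forward t (hm.comp measurable_reverseSeq)
    (fun x y hxy => hd fun k hk => hxy (-k) (by
      simp only [Set.mem_Iic, Set.mem_Ici] at hk ⊢; omega))
  have hup : ∀ m z, reverseSeq (Function.update (reverseSeq m) ((t : ℤ) + 1) z) =
      Function.update m (-(t : ℤ) - 1) z := fun m z => by
    ext k
    by_cases hk : k = -(t : ℤ) - 1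
    · subst hk
      simp [reverseSeq, add_comm]
    · have hk' : -k ≠ (t : ℤ) + 1 := by omega
      simp [reverseSeq, Function.update_of_ne hk, Function.update_of_ne hk']
  rw [lintegral_map (hm.comp measurable_reverseSeq) measurable_reverseSeq, lintegral_map _
    measurable_reverseSeq] at this
  · simp only [Function.comp, hrr, hup] at this
    exact this
  · refine measurable_lintegral_tailTransition _ (by fun_prop) ?_
    exact hm.comp (measurable_reverseSeq.comp (measurable_update_int _))

end Step

/-! ### Laws determined by truncated moments -/

section Uniqueness

/-- The left derivative of `s ↦ E[min Z s]` is the mass of `{s ≤ Z}`, by dominated convergence of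
difference quotients bounded by `1`. -/
theorem measure_le_eq_of_lintegral_min_eq {T : Type*} [MeasurableSpace T] {ν₁ ν₂ : Measure T}
    [IsFiniteMeasure ν₁] [IsFiniteMeasure ν₂] {Z : T → ℝ} (hZ : Measurable Z) (h0 : ∀ x, 0 ≤ Z x)
    (h : ∀ s, 0 < s →
      ∫⁻ x, ENNReal.ofReal (min (Z x) s) ∂ν₁ = ∫⁻ x, ENNReal.ofReal (min (Z x) s) ∂ν₂)
    {s : ℝ} (hs : 0 < s) : ν₁ {x | s ≤ Z x} = ν₂ {x | s ≤ Z x} := by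
  have hI : ∀ s, 0 < s → ∫ x, min (Z x) s ∂ν₁ = ∫ x, min (Z x) s ∂ν₂ := fun s hs => by
    rw [integral_eq_lintegral_of_nonneg_ae (Eventually.of_forall fun x => le_min (h0 x) hs.le)
      (by fun_prop), integral_eq_lintegral_of_nonneg_ae
      (Eventually.of_forall fun x => le_min (h0 x) hs.le) (by fun_prop), h s hs]
  have hint : ∀ (ν : Measure T) [IsFiniteMeasure ν] (s : ℝ), 0 < s →
      Integrable (fun x => min (Z x) s) ν := fun ν _ s hs =>
    Integrable.of_bound (by fun_prop) s (Eventually.of_forall fun x => by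
      rw [Real.norm_of_nonneg (le_min (h0 x) hs.le)]; exact min_le_right _ _)
  -- Increases to `s` with difference quotient factor `(n + 2) / s`; the `2` keeps `d 0` positive.
  set d : ℕ → ℝ := fun n => s - s / (n + 2) with hd
  have hd0 : ∀ n, 0 < d n := fun n => by
    have hn : (0 : ℝ) < n + 2 := by positivity
    have : s / (n + 2) < s := div_lt_self hs (by linarith [(Nat.cast_nonneg n : (0 : ℝ) ≤ n)])
    simp only [hd]; linarith
  have hlim : ∀ (ν : Measure T) [IsFiniteMeasure ν],
      Tendsto (fun n : ℕ => ∫ x, ((n + 2) / s) * (min (Z x) s - min (Z x) (d n)) ∂ν) atTop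
        (𝓝 (ν.real {x | s ≤ Z x})) := by
    intro ν _
    have hms : MeasurableSet {x | s ≤ Z x} := measurableSet_le measurable_const hZ
    rw [← integral_indicator_one hms]
    refine tendsto_integral_of_dominated_convergence (fun _ => 1) (fun n => by fun_prop)
      (integrable_const _) (fun n => Eventually.of_forall fun x => ?_)
      (Eventually.of_forall fun x => ?_)
    · have hn : (0 : ℝ) < n + 2 := by positivity
      have h1 : d n ≤ s := by simp only [hd]; linarith [div_pos hs hn]
      have h2 : min (Z x) (d n) ≤ min (Z x) s := min_le_min_left _ h1
      have h3 : min (Z x) s - min (Z x) (d n) ≤ s / (n + 2) := by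
        rcases le_total (Z x) (d n) with h4 | h4
        · rw [min_eq_left h4, min_eq_left (h4.trans h1)]; simp; positivity
        · rw [min_eq_right h4]
          have := min_le_right (Z x) s
          simp only [hd]; linarith
      rw [Real.norm_of_nonneg (mul_nonneg (by positivity) (by linarith))]
      calc ((n : ℝ) + 2) / s * (min (Z x) s - min (Z x) (d n)) ≤ (n + 2) / s * (s / (n + 2)) :=
            mul_le_mul_of_nonneg_left h3 (by positivity)
        _ = 1 := by field_simp
    · by_cases hx : s ≤ Z x
      · rw [Set.indicator_of_mem (by exact hx)]
        refine tendsto_const_nhds.congr fun n => ?_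
        have hn : (0 : ℝ) < n + 2 := by positivity
        have h1 : d n ≤ s := by simp only [hd]; linarith [div_pos hs hn]
        rw [min_eq_right hx, min_eq_right (h1.trans hx)]
        simp only [hd, Pi.one_apply]
        field_simp
        ring
      · rw [Set.indicator_of_notMem (by exact hx)]
        have hlimd : Tendsto d atTop (𝓝 s) := by
          have : Tendsto (fun n : ℕ => s / ((n : ℝ) + 2)) atTop (𝓝 0) :=
            tendsto_const_nhds.div_atTop
              (tendsto_atTop_add_const_right _ _ tendsto_natCast_atTop_atTop)
          simpa using (tendsto_const_nhds (x := s)).sub this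
        refine tendsto_const_nhds.congr' ?_
        filter_upwards [hlimd.eventually (lt_mem_nhds (not_le.1 hx))] with n hn
        rw [min_eq_left hn.le, min_eq_left (not_le.1 hx).le, sub_self, mul_zero]
  have heq : ν₁.real {x | s ≤ Z x} = ν₂.real {x | s ≤ Z x} := by
    refine tendsto_nhds_unique (hlim ν₁) ((hlim ν₂).congr fun n => ?_)
    rw [integral_const_mul, integral_const_mul, integral_sub (hint ν₁ s hs) (hint ν₁ _ (hd0 n)),
      integral_sub (hint ν₂ s hs) (hint ν₂ _ (hd0 n)), hI s hs, hI _ (hd0 n)]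
  exact (measureReal_eq_measureReal_iff).1 heq

/-- For `a ≤ 0`, `Iio a` is exhausted by the lower rays `Iic (a - 1 / (n + 1))`, and the total mass
gives `Ici a`. No information at `0` is needed. -/
theorem measure_eq_of_Ici_of_Iic {ν₁ ν₂ : Measure ℝ} [IsFiniteMeasure ν₁] [IsFiniteMeasure ν₂]
    (hu : ν₁ Set.univ = ν₂ Set.univ) (h1 : ∀ s, 0 < s → ν₁ (Set.Ici s) = ν₂ (Set.Ici s))
    (h2 : ∀ s, 0 < s → ν₁ (Set.Iic (-s)) = ν₂ (Set.Iic (-s))) : ν₁ = ν₂ := by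
  refine Measure.ext_of_Ici _ _ fun a => ?_
  rcases lt_or_ge 0 a with ha | ha
  · exact h1 a ha
  have hU : Set.Iio a = ⋃ n : ℕ, Set.Iic (a - 1 / ((n : ℝ) + 1)) := by
    ext x
    simp only [Set.mem_Iio, Set.mem_iUnion, Set.mem_Iic]
    constructor
    · intro hx
      obtain ⟨n, hn⟩ := exists_nat_one_div_lt (sub_pos.2 hx)
      exact ⟨n, by linarith⟩
    · rintro ⟨n, hn⟩
      have : (0 : ℝ) < 1 / ((n : ℝ) + 1) := by positivity
      linarith
  have hmono : Monotone fun n : ℕ => Set.Iic (a - 1 / ((n : ℝ) + 1)) := fun m n hmn =>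
    Set.Iic_subset_Iic.2 (sub_le_sub_left (by gcongr) _)
  have hIio : ν₁ (Set.Iio a) = ν₂ (Set.Iio a) := by
    rw [hU]
    refine tendsto_nhds_unique (tendsto_measure_iUnion_atTop hmono)
      ((tendsto_measure_iUnion_atTop hmono).congr fun n => ?_)
    have hn : (0 : ℝ) < 1 / ((n : ℝ) + 1) := by positivity
    have := h2 (1 / ((n : ℝ) + 1) - a) (by linarith)
    rw [neg_sub] at this
    exact this.symm
  rw [← Set.compl_Iio, measure_compl measurableSet_Iio (measure_ne_top _ _),
    measure_compl measurableSet_Iio (measure_ne_top _ _), hu, hIio]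

end Uniqueness

/-! ### Adjoint laws -/

section Adjoint

variable {α p : ℝ} {μ μ₁ μ₂ : Measure (ℝ × ℝ)}

theorem IsTailPairLaw.sign_mass (h : IsTailPairLaw p α μ) {σ : ℝ} (hσ : σ = 1 ∨ σ = -1) :
    μ {q | q.1 = σ} = ENNReal.ofReal (signProb p σ) := by
  rcases hσ with rfl | rfl
  · simpa [signProb] using h.pos_mass
  · rw [h.neg_mass]; norm_num [signProb]

theorem IsTailPairLaw.ae_sign (h : IsTailPairLaw p α μ) (h0 : 0 ≤ p) (h1 : p ≤ 1) :
    ∀ᵐ q ∂μ, q.1 = 1 ∨ q.1 = -1 := by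
  have := h.isProb
  have hm : MeasurableSet ({q : ℝ × ℝ | q.1 = 1} ∪ {q | q.1 = -1}) :=
    (measurableSet_fst_eq 1).union (measurableSet_fst_eq (-1))
  refine (prob_compl_eq_zero_iff hm).2 ?_
  rw [measure_union _ (measurableSet_fst_eq (-1)), h.pos_mass, h.neg_mass,
    ← ENNReal.ofReal_add h0 (by linarith)]
  · simp
  · rw [Set.disjoint_left]
    intro q (hq : q.1 = 1) (hq' : q.1 = -1)
    rw [hq] at hq'
    norm_num at hq'

theorem IsTailPairLaw.lintegral_eq (h : IsTailPairLaw p α μ) (h0 : 0 ≤ p) (h1 : p ≤ 1)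
    (f : ℝ × ℝ → ENNReal) : ∫⁻ q, f q ∂μ =
      ∫⁻ q in {q | q.1 = 1}, f q ∂μ + ∫⁻ q in {q | q.1 = -1}, f q ∂μ := by
  rw [← lintegral_add_compl f (measurableSet_fst_eq 1)]
  congr 1
  refine setLIntegral_congr ?_
  filter_upwards [h.ae_sign h0 h1] with q hq
  refine propext ?_
  change ¬ (q.1 = 1) ↔ q.1 = -1
  rcases hq with hq | hq <;> rw [hq] <;> norm_num

/-- With `y = τ s ^ (1/α)` one has `(y I')_+^α = s` on `{I' = τ}` and `0` elsewhere. Adjointness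
thus prescribes `E[(σ M')_+^α ∧ s ; I' = τ]` for every `s > 0`, hence both tails of `M'` on `{I' =
τ}`; the mass of that event is known. -/
theorem IsTailPairLaw.eq_of_areAdjoint (h0 : 0 ≤ p) (h1 : p ≤ 1) (hα : 0 < α)
    (hμ₁ : IsTailPairLaw p α μ₁) (hμ₂ : IsTailPairLaw p α μ₂)
    (ha₁ : AreAdjoint α μ μ₁) (ha₂ : AreAdjoint α μ μ₂) : μ₁ = μ₂ := by
  have := hμ₁.isProb
  have := hμ₂.isProb
  have hset : ∀ τ : ℝ, (τ = 1 ∨ τ = -1) → ∀ σ : ℝ, ∀ s, 0 < s →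
      ∀ ν : Measure (ℝ × ℝ), IsTailPairLaw p α ν →
      ∫⁻ q, ENNReal.ofReal (min (posPow α (σ * q.2)) (posPow α (τ * s ^ α⁻¹ * q.1))) ∂ν =
        ∫⁻ q in {q | q.1 = τ}, ENNReal.ofReal (min (posPow α (σ * q.2)) s) ∂ν := by
    intro τ hτ σ s hs ν hν
    rw [← lintegral_indicator (measurableSet_fst_eq τ)]
    refine lintegral_congr_ae ?_
    have hsα : (s ^ α⁻¹) ^ α = s := by
      rw [← Real.rpow_mul hs.le, inv_mul_cancel₀ hα.ne', Real.rpow_one]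
    have hs0 : 0 < s ^ α⁻¹ := by positivity
    filter_upwards [hν.ae_sign h0 h1] with q hq
    by_cases hqτ : q.1 = τ
    · rw [Set.indicator_of_mem (by exact hqτ), hqτ]
      have : τ * s ^ α⁻¹ * τ = s ^ α⁻¹ := by rcases hτ with rfl | rfl <;> ring
      rw [this, posPow_of_nonneg hs0.le, hsα]
    · rw [Set.indicator_of_notMem (by exact hqτ)]
      have : q.1 = -τ := by
        rcases hτ with rfl | rfl <;> rcases hq with hq | hq <;> simp_all
      have h2 : τ * s ^ α⁻¹ * q.1 ≤ 0 := by
        rw [this]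
        rcases hτ with rfl | rfl <;> linarith
      rw [posPow_of_nonpos hα h2, min_eq_right (posPow_nonneg _ _), ENNReal.ofReal_zero]
  have hle : ∀ τ : ℝ, (τ = 1 ∨ τ = -1) → ∀ σ : ℝ, ∀ s, 0 < s →
      μ₁.restrict {q | q.1 = τ} {q | s ≤ σ * q.2} = μ₂.restrict {q | q.1 = τ} {q | s ≤ σ * q.2} := by
    intro τ hτ σ s hs
    have key := measure_le_eq_of_lintegral_min_eq (ν₁ := μ₁.restrict {q | q.1 = τ})
      (ν₂ := μ₂.restrict {q | q.1 = τ}) (Z := fun q => posPow α (σ * q.2)) (by fun_prop)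
      (fun q => posPow_nonneg _ _) (fun s hs => by
        rw [← hset τ hτ σ s hs μ₁ hμ₁, ← hset τ hτ σ s hs μ₂ hμ₂]
        exact (ha₁ _ _).symm.trans (ha₂ _ _)) (s := s ^ α) (by positivity)
    have hiff : ∀ q : ℝ × ℝ, s ^ α ≤ posPow α (σ * q.2) ↔ s ≤ σ * q.2 := fun q => by
      rw [posPow, Real.rpow_le_rpow_iff hs.le (le_max_right _ _) hα, le_max_iff]
      exact ⟨fun h => h.resolve_right hs.not_ge, Or.inl⟩
    simpa only [hiff] using key
  have hmarg : ∀ τ : ℝ, (τ = 1 ∨ τ = -1) → (μ₁.restrict {q | q.1 = τ}).map Prod.snd =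
      (μ₂.restrict {q | q.1 = τ}).map Prod.snd := by
    intro τ hτ
    refine measure_eq_of_Ici_of_Iic ?_ (fun s hs => ?_) fun s hs => ?_
    · rw [Measure.map_apply measurable_snd MeasurableSet.univ,
        Measure.map_apply measurable_snd MeasurableSet.univ, Set.preimage_univ,
        Measure.restrict_apply_univ, Measure.restrict_apply_univ, hμ₁.sign_mass hτ,
        hμ₂.sign_mass hτ]
    · rw [Measure.map_apply measurable_snd measurableSet_Ici,
        Measure.map_apply measurable_snd measurableSet_Ici]
      have := hle τ hτ 1 s hs
      simp only [one_mul] at this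
      exact this
    · rw [Measure.map_apply measurable_snd measurableSet_Iic,
        Measure.map_apply measurable_snd measurableSet_Iic]
      have := hle τ hτ (-1) s hs
      simp only [neg_mul, one_mul, le_neg] at this
      exact this
  have hres : ∀ τ : ℝ, (τ = 1 ∨ τ = -1) → ∀ f : ℝ × ℝ → ENNReal, Measurable f →
      ∫⁻ q in {q | q.1 = τ}, f q ∂μ₁ = ∫⁻ q in {q | q.1 = τ}, f q ∂μ₂ := by
    intro τ hτ f hf
    have : ∀ ν : Measure (ℝ × ℝ), ∫⁻ q in {q | q.1 = τ}, f q ∂ν =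
        ∫⁻ z, f (τ, z) ∂(ν.restrict {q | q.1 = τ}).map Prod.snd := fun ν => by
      rw [lintegral_map (by fun_prop) measurable_snd]
      refine setLIntegral_congr_fun (measurableSet_fst_eq τ) fun q (hq : q.1 = τ) => ?_
      simp only [← hq]
    rw [this, this, hmarg τ hτ]
  refine Measure.ext_of_lintegral _ fun f hf => ?_
  rw [hμ₁.lintegral_eq h0 h1, hμ₂.lintegral_eq h0 h1, hres 1 (Or.inl rfl) f hf,
    hres (-1) (Or.inr rfl) f hf]

/-- The adjoint of a tail pair law: on `{M ≠ 0}` the pair `(sign M, I / |M|)` is weighted by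
`|M| ^ α`, and the remaining mass is put on the pairs `(1, 0)` and `(-1, 0)`. -/
noncomputable def adjointLaw (α p : ℝ) (μ : Measure (ℝ × ℝ)) : Measure (ℝ × ℝ) :=
  (μ.withDensity fun q => ENNReal.ofReal (|q.2| ^ α)).map
      (fun q => (Real.sign q.2, q.1 / |q.2|)) +
    ((ENNReal.ofReal (signProb p 1) - ∫⁻ q, ENNReal.ofReal (posPow α (1 * q.2)) ∂μ) •
        Measure.dirac ((1 : ℝ), (0 : ℝ)) +
      (ENNReal.ofReal (signProb p (-1)) - ∫⁻ q, ENNReal.ofReal (posPow α (-1 * q.2)) ∂μ) •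
        Measure.dirac ((-1 : ℝ), (0 : ℝ)))

theorem measurable_sign : Measurable Real.sign :=
  Measurable.ite measurableSet_Iio measurable_const
    (Measurable.ite measurableSet_Ioi measurable_const measurable_const)

theorem lintegral_adjointLaw {f : ℝ × ℝ → ENNReal} (hf : Measurable f) :
    ∫⁻ q, f q ∂adjointLaw α p μ =
      ∫⁻ q, ENNReal.ofReal (|q.2| ^ α) * f (Real.sign q.2, q.1 / |q.2|) ∂μ +
        ((ENNReal.ofReal (signProb p 1) - ∫⁻ q, ENNReal.ofReal (posPow α (1 * q.2)) ∂μ) * f (1, 0) +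
        (ENNReal.ofReal (signProb p (-1)) - ∫⁻ q, ENNReal.ofReal (posPow α (-1 * q.2)) ∂μ) *
          f (-1, 0)) := by
  have hm : Measurable fun q : ℝ × ℝ => (Real.sign q.2, q.1 / |q.2|) :=
    (measurable_sign.comp measurable_snd).prodMk (by fun_prop)
  rw [adjointLaw, lintegral_add_measure, lintegral_add_measure, lintegral_smul_measure,
    lintegral_smul_measure, lintegral_dirac, lintegral_dirac, lintegral_map hf hm]
  congr 1
  exact lintegral_withDensity_eq_lintegral_mul _ (by fun_prop) (hf.comp hm)

theorem abs_mul_sign' {m : ℝ} (hm : m ≠ 0) : |m| * Real.sign m = m := by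
  rcases lt_or_gt_of_ne hm with h | h
  · rw [Real.sign_of_neg h, abs_of_neg h]; ring
  · rw [Real.sign_of_pos h, abs_of_pos h]; ring

theorem posPow_mul {c : ℝ} (hc : 0 ≤ c) (x : ℝ) : posPow α (c * x) = c ^ α * posPow α x := by
  rw [posPow, posPow, ← Real.mul_rpow hc (le_max_right _ _), mul_max_of_nonneg _ _ hc, mul_zero]

theorem abs_rpow_eq (hα : 0 < α) {σ : ℝ} (hσ : σ = 1 ∨ σ = -1) (z : ℝ) :
    (if Real.sign z = σ then |z| ^ α else 0) = posPow α (σ * z) := by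
  rcases lt_trichotomy z 0 with h | rfl | h
  · rw [Real.sign_of_neg h, abs_of_neg h]
    rcases hσ with rfl | rfl
    · rw [posPow_of_nonpos hα (by linarith)]; norm_num
    · rw [posPow_of_nonneg (by linarith)]; norm_num
  · rw [mul_zero, posPow_of_nonpos hα le_rfl, abs_zero, Real.zero_rpow hα.ne', ite_self]
  · rw [Real.sign_of_pos h, abs_of_pos h]
    rcases hσ with rfl | rfl
    · rw [posPow_of_nonneg (by linarith)]; norm_num
    · rw [posPow_of_nonpos hα (by linarith)]; norm_num

/-- The weighted part gives the sign `σ` mass `E[(σ M)_+^α]`. The moment condition says this is at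
most `p(σ)`, so the atom at `(σ, 0)` fills the deficit exactly. -/
theorem adjointLaw_sign (h : IsTailPairLaw p α μ) (hα : 0 < α) {σ : ℝ} (hσ : σ = 1 ∨ σ = -1) :
    adjointLaw α p μ {q | q.1 = σ} = ENNReal.ofReal (signProb p σ) := by
  have hm := measurableSet_fst_eq σ
  have hmom := h.moment σ hσ
  rw [h.sign_mass hσ] at hmom
  rw [← lintegral_indicator_one hm, lintegral_adjointLaw (measurable_one.indicator hm)]
  have h1 : ∀ q : ℝ × ℝ, ENNReal.ofReal (|q.2| ^ α) *
      Set.indicator {q : ℝ × ℝ | q.1 = σ} 1 (Real.sign q.2, q.1 / |q.2|) =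
      ENNReal.ofReal (posPow α (σ * q.2)) := fun q => by
    rw [← abs_rpow_eq hα hσ]
    by_cases hq : Real.sign q.2 = σ <;> simp [Set.indicator, hq]
  simp only [h1]
  rcases hσ with rfl | rfl
  · have e1 : Set.indicator {q : ℝ × ℝ | q.1 = 1} (1 : ℝ × ℝ → ENNReal) (1, 0) = 1 := by simp
    have e2 : Set.indicator {q : ℝ × ℝ | q.1 = 1} (1 : ℝ × ℝ → ENNReal) (-1, 0) = 0 := by
      norm_num [Set.indicator]
    rw [e1, e2, mul_one, mul_zero, add_zero, add_tsub_cancel_of_le hmom]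
  · have e1 : Set.indicator {q : ℝ × ℝ | q.1 = -1} (1 : ℝ × ℝ → ENNReal) (1, 0) = 0 := by
      norm_num [Set.indicator]
    have e2 : Set.indicator {q : ℝ × ℝ | q.1 = -1} (1 : ℝ × ℝ → ENNReal) (-1, 0) = 1 := by simp
    rw [e1, e2, mul_one, mul_zero, zero_add, add_tsub_cancel_of_le hmom]

/-- In the moment condition the weight cancels: `|M|^α (σ I / |M|)_+^α = (σ I)_+^α`, which is the
indicator of `{I = σ}`. An inequality results because `{M = 0}` is lost. -/
theorem isTailPairLaw_adjointLaw (h : IsTailPairLaw p α μ) (h0 : 0 ≤ p) (h1 : p ≤ 1)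
    (hα : 0 < α) : IsTailPairLaw p α (adjointLaw α p μ) := by
  have hμ := h.isProb
  have hmass : ∀ σ : ℝ, (σ = 1 ∨ σ = -1) →
      ∫⁻ q, ENNReal.ofReal (posPow α (σ * q.2)) ∂μ ≤ ENNReal.ofReal (signProb p σ) := by
    intro σ hσ
    rw [← h.sign_mass hσ]
    exact h.moment σ hσ
  refine ⟨⟨?_⟩, ?_, ?_, ?_⟩
  · have e : ∀ q : ℝ × ℝ, ENNReal.ofReal (|q.2| ^ α) * 1 =
        ENNReal.ofReal (posPow α (1 * q.2)) + ENNReal.ofReal (posPow α (-1 * q.2)) := fun q => by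
      rw [mul_one, ← ENNReal.ofReal_add (posPow_nonneg _ _) (posPow_nonneg _ _)]
      congr 1
      rw [← abs_rpow_eq hα (Or.inl rfl), ← abs_rpow_eq hα (Or.inr rfl)]
      rcases Real.sign_apply_eq q.2 with hq | hq | hq
      · norm_num [hq]
      · rw [Real.sign_eq_zero_iff.1 hq, abs_zero, Real.zero_rpow hα.ne']; simp
      · norm_num [hq]
    rw [← lintegral_one, lintegral_adjointLaw measurable_const]
    simp only [e]
    rw [lintegral_add_left (by fun_prop), mul_one, mul_one, add_add_add_comm,
      add_tsub_cancel_of_le (hmass 1 (Or.inl rfl)), add_tsub_cancel_of_le (hmass (-1) (Or.inr rfl)),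
      ← ENNReal.ofReal_add (signProb_nonneg h0 h1) (signProb_nonneg h0 h1), signProb_one_add,
      ENNReal.ofReal_one]
  · simpa [signProb] using adjointLaw_sign h hα (Or.inl rfl)
  · rw [adjointLaw_sign h hα (Or.inr rfl)]; norm_num [signProb]
  · intro σ hσ
    rw [adjointLaw_sign h hα hσ, lintegral_adjointLaw (by fun_prop), mul_zero,
      posPow_of_nonpos hα le_rfl, ENNReal.ofReal_zero, mul_zero, mul_zero, add_zero, add_zero,
      ← h.sign_mass hσ, ← lintegral_indicator_one (measurableSet_fst_eq σ)]
    refine lintegral_mono_ae ?_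
    filter_upwards [h.ae_sign h0 h1] with q hq
    have hq' : ENNReal.ofReal (posPow α (σ * q.1)) ≤ Set.indicator {q : ℝ × ℝ | q.1 = σ} 1 q := by
      rcases hσ with rfl | rfl <;> rcases hq with hq | hq <;>
        norm_num [Set.indicator, hq, posPow, hα.ne']
    refine le_trans ?_ hq'
    by_cases hz : q.2 = 0
    · rw [hz, abs_zero, Real.zero_rpow hα.ne', ENNReal.ofReal_zero, zero_mul]
      exact zero_le
    · have hz' := abs_pos.2 hz
      rw [← ENNReal.ofReal_mul (by positivity), ← posPow_mul hz'.le]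
      refine le_of_eq ?_
      congr 2
      field_simp

/-- The weight `|M|^α` moves inside the minimum by homogeneity, turning `I / |M|` into `I` and `sign
M` into `M`; the atoms have second coordinate `0` and contribute nothing. -/
theorem areAdjoint_adjointLaw (hα : 0 < α) : AreAdjoint α μ (adjointLaw α p μ) := by
  intro x y
  rw [lintegral_adjointLaw (by fun_prop)]
  simp only [mul_zero, posPow_of_nonpos hα le_rfl, min_eq_left (posPow_nonneg _ _),
    ENNReal.ofReal_zero, add_zero]
  refine lintegral_congr fun q => ?_
  by_cases hz : q.2 = 0
  · rw [hz, abs_zero, Real.zero_rpow hα.ne', ENNReal.ofReal_zero, zero_mul, mul_zero,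
      posPow_of_nonpos hα le_rfl, min_eq_right (posPow_nonneg _ _), ENNReal.ofReal_zero]
  · have hz' := abs_pos.2 hz
    rw [← ENNReal.ofReal_mul (by positivity), mul_min_of_nonneg _ _ (by positivity),
      ← posPow_mul hz'.le, ← posPow_mul hz'.le]
    have e1 : |q.2| * (x * (q.1 / |q.2|)) = x * q.1 := by field_simp
    have e2 : |q.2| * (y * Real.sign q.2) = y * q.2 := by
      rw [mul_left_comm, abs_mul_sign' hz]
    rw [e1, e2]

/-- The time-change identity for a pair and its adjoint. -/
theorem lintegral_pair_eq_of_areAdjoint {μ' : Measure (ℝ × ℝ)} (h : IsTailPairLaw p α μ)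
    (h' : IsTailPairLaw p α μ') (ha : AreAdjoint α μ μ') (h0 : 0 ≤ p) (h1 : p ≤ 1) (hα : 0 < α)
    {k : ℝ × ℝ → ENNReal} (hk : Measurable k)
    (hom : ∀ c : ℝ, 0 < c → ∀ q : ℝ × ℝ, k (c * q.1, c * q.2) = ENNReal.ofReal (c ^ α) * k q) :
    ∫⁻ q in {q | q.2 ≠ 0}, k q ∂μ = ∫⁻ q in {q | q.2 ≠ 0}, k (q.2, q.1) ∂μ' := by
  have hm : MeasurableSet {q : ℝ × ℝ | q.2 ≠ 0} :=
    measurable_snd (measurableSet_singleton (0 : ℝ)).compl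
  -- Uniqueness of the adjoint lets the explicit law stand in for `μ'`.
  rw [h'.eq_of_areAdjoint h0 h1 hα (isTailPairLaw_adjointLaw h h0 h1 hα) ha
    (areAdjoint_adjointLaw hα), ← lintegral_indicator hm, ← lintegral_indicator hm,
    lintegral_adjointLaw (f := Set.indicator {q : ℝ × ℝ | q.2 ≠ 0} fun q => k (q.2, q.1))
      ((hk.comp measurable_swap).indicator hm)]
  simp only [ne_eq, not_true_eq_false, Set.mem_ofPred_eq, not_false_eq_true,
    Set.indicator_of_notMem, mul_zero, add_zero]
  refine lintegral_congr_ae ?_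
  filter_upwards [h.ae_sign h0 h1] with q hq
  have hq1 : q.1 ≠ 0 := by rcases hq with hq | hq <;> rw [hq] <;> norm_num
  by_cases hz : q.2 = 0
  · rw [Set.indicator_of_notMem (by simp [hz]), hz, abs_zero, Real.zero_rpow hα.ne',
      ENNReal.ofReal_zero, zero_mul]
  · have hz' := abs_pos.2 hz
    rw [Set.indicator_of_mem (by exact hz),
      Set.indicator_of_mem (by exact div_ne_zero hq1 hz'.ne'), ← hom _ hz', abs_mul_sign' hz]
    congr 2
    field_simp

end Adjoint

/-! ### The time-change formula -/

/-- Positive homogeneity of degree `α` of a functional of a two-sided sequence. -/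
def IsHomogeneousFunctional (α : ℝ) (h : (ℤ → ℝ) → ENNReal) : Prop :=
  ∀ c : ℝ, 0 < c → ∀ m : ℤ → ℝ, h (fun k => c * m k) = ENNReal.ofReal (c ^ α) * h m

/-- The time shift of a two-sided sequence. -/
def shiftSeq (m : ℤ → ℝ) : ℤ → ℝ := fun k => m (k - 1)

@[fun_prop]
theorem measurable_shiftSeq : Measurable shiftSeq := by
  unfold shiftSeq
  fun_prop

section Shift

variable {α p : ℝ} {μ : Measure (ℝ × ℝ)} {Q : Measure (ℤ → ℝ)}

theorem IsBackForthTailChain.lintegral_forward' (hQ : IsBackForthTailChain α p μ Q) {j : ℤ}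
    (hj : 0 ≤ j) {h : (ℤ → ℝ) → ENNReal} (hm : Measurable h) (hd : DependsOn h (Set.Iic (j + 1))) :
    ∫⁻ m, h m ∂Q = ∫⁻ m, ∫⁻ z, h (Function.update m (j + 1) z) ∂tailTransition μ (m j) ∂Q := by
  lift j to ℕ using hj
  exact hQ.lintegral_forward j hm hd

theorem IsBackForthTailChain.lintegral_backward' (hQ : IsBackForthTailChain α p μ Q) {j : ℤ}
    (hj : j ≤ 0) {h : (ℤ → ℝ) → ENNReal} (hm : Measurable h) (hd : DependsOn h (Set.Ici (j - 1))) :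
    ∫⁻ m, h m ∂Q = ∫⁻ m, ∫⁻ z, h (Function.update m (j - 1) z)
      ∂tailTransition (Q.map fun m => (m 0, m (-1))) (m j) ∂Q := by
  obtain ⟨t, rfl⟩ : ∃ t : ℕ, j = -(t : ℤ) := ⟨(-j).toNat, by omega⟩
  exact hQ.lintegral_backward t hm hd

theorem shiftSeq_update (m : ℤ → ℝ) (j : ℤ) (z : ℝ) :
    shiftSeq (Function.update m j z) = Function.update (shiftSeq m) (j + 1) z := by
  ext k
  by_cases hk : k = j + 1
  · subst hk; simp [shiftSeq]
  · have hk' : k - 1 ≠ j := by omega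
    simp [shiftSeq, Function.update_of_ne hk, Function.update_of_ne hk']

/-- Integrating out one coordinate preserves homogeneity. -/
theorem IsHomogeneousFunctional.step {ν : Measure (ℝ × ℝ)} {h : (ℤ → ℝ) → ENNReal}
    (hom : IsHomogeneousFunctional α h) (hm : Measurable h) (i j : ℤ) :
    IsHomogeneousFunctional α fun m =>
      ∫⁻ z, h (Function.update m i z) ∂tailTransition ν (m j) := by
  intro c hc m
  have hup : ∀ m : ℤ → ℝ, Measurable fun z => h (Function.update m i z) := fun m =>
    hm.comp ((measurable_update_int i).comp measurable_prodMk_left)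
  change ∫⁻ z, h (Function.update (fun k => c * m k) i z) ∂tailTransition ν (c * m j) = _
  rw [lintegral_tailTransition_mul ν hc _ (hup _), ← lintegral_const_mul' _ _ ENNReal.ofReal_ne_top]
  refine lintegral_congr fun z => ?_
  rw [← hom c hc]
  congr 1
  ext k
  by_cases hk : k = i
  · subst hk; simp
  · simp [Function.update_of_ne hk]

theorem DependsOn.step {ν : Measure (ℝ × ℝ)} {h : (ℤ → ℝ) → ENNReal} {A B : Set ℤ} {i j : ℤ}
    (hd : DependsOn h A) (hB : ∀ k ∈ A, k ≠ i → k ∈ B) (hj : j ∈ B) :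
    DependsOn (fun m => ∫⁻ z, h (Function.update m i z) ∂tailTransition ν (m j)) B := by
  intro x y hxy
  simp only [hxy j hj]
  refine lintegral_congr fun z => hd fun k hk => ?_
  by_cases hki : k = i
  · subst hki; simp
  · rw [Function.update_of_ne hki, Function.update_of_ne hki, hxy k (hB k hk hki)]

theorem DependsOn.comp_shiftSeq {h : (ℤ → ℝ) → ENNReal} {A B : Set ℤ}
    (hd : DependsOn h A) (hB : ∀ k ∈ A, k - 1 ∈ B) :
    DependsOn (fun m => h (shiftSeq m)) B :=
  fun _ _ hxy => hd fun k hk => hxy (k - 1) (hB k hk)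

/-- The base case is the adjoint identity itself: the functional is `k(M_0, M_1)` and its shift
`k(M_{-1}, M_0)`. The vanishing conditions make the restrictions to nonzero coordinates harmless. -/
theorem IsBackForthTailChain.lintegral_shift_pair (hQ : IsBackForthTailChain α p μ Q)
    (h0 : 0 ≤ p) (h1 : p ≤ 1) (hα : 0 < α) {h : (ℤ → ℝ) → ENNReal} (hm : Measurable h)
    (hom : IsHomogeneousFunctional α h) (hd : DependsOn h (Set.Icc 0 1))
    (hs1 : ∀ m, m 1 = 0 → h m = 0) (hs0 : ∀ m, m 0 = 0 → h m = 0) :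
    ∫⁻ m, h m ∂Q = ∫⁻ m, h (shiftSeq m) ∂Q := by
  set k : ℝ × ℝ → ENNReal := fun q => h fun i => if i = 0 then q.1 else if i = 1 then q.2 else 0
    with hk
  have hkm : Measurable k := hm.comp (measurable_pi_iff.2 fun i => by split_ifs <;> fun_prop)
  have hkh : ∀ m, h m = k (m 0, m 1) := fun m => hd fun i hi => by
    obtain ⟨hi0, hi1⟩ := Set.mem_Icc.1 hi
    obtain rfl | rfl : i = 0 ∨ i = 1 := by omega
    · simp
    · simp
  have hkhom : ∀ c : ℝ, 0 < c → ∀ q : ℝ × ℝ,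
      k (c * q.1, c * q.2) = ENNReal.ofReal (c ^ α) * k q := fun c hc q => by
    simp only [hk]
    rw [← hom c hc]
    congr 1
    ext i
    split_ifs <;> simp
  have hk2 : ∀ q : ℝ × ℝ, q.2 = 0 → k q = 0 := fun q hq => hs1 _ (by simp [hq])
  have hk1 : ∀ q : ℝ × ℝ, q.1 = 0 → k q = 0 := fun q hq => hs0 _ (by simp [hq])
  have hset : MeasurableSet {q : ℝ × ℝ | q.2 ≠ 0} :=
    measurable_snd (measurableSet_singleton (0 : ℝ)).compl
  have key := lintegral_pair_eq_of_areAdjoint hQ.law_mem hQ.backward_mem hQ.adjoint h0 h1 hα hkm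
    hkhom
  rw [← lintegral_indicator hset, ← lintegral_indicator hset] at key
  have e1 : ∀ q, Set.indicator {q : ℝ × ℝ | q.2 ≠ 0} k q = k q := fun q => by
    by_cases hq : q.2 = 0
    · rw [Set.indicator_of_notMem (by simp [hq]), hk2 q hq]
    · rw [Set.indicator_of_mem (by exact hq)]
  have e2 : ∀ q, Set.indicator {q : ℝ × ℝ | q.2 ≠ 0} (fun q => k (q.2, q.1)) q = k (q.2, q.1) :=
    fun q => by
      by_cases hq : q.2 = 0
      · rw [Set.indicator_of_notMem (by simp [hq]), hk1 _ hq]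
      · rw [Set.indicator_of_mem (by exact hq)]
  simp only [e1, e2] at key
  rw [lintegral_map (f := fun q : ℝ × ℝ => k (q.2, q.1)) (hkm.comp measurable_swap)
    (by fun_prop)] at key
  conv at key => lhs; rw [← hQ.forward_law]
  rw [lintegral_map hkm (by fun_prop)] at key
  simp only [hkh]
  exact key

/-- The time-change formula: functionals that vanish unless `M_0` and `M_1` are both nonzero have
the same expectation after a shift. -/
theorem IsBackForthTailChain.lintegral_shift (hQ : IsBackForthTailChain α p μ Q)
    (h0 : 0 ≤ p) (h1 : p ≤ 1) (hα : 0 < α) (n : ℕ) {h : (ℤ → ℝ) → ENNReal} (hm : Measurable h)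
    (hom : IsHomogeneousFunctional α h) (hd : DependsOn h (Set.Icc (-(n : ℤ)) (n + 1)))
    (hs1 : ∀ m, m 1 = 0 → h m = 0) (hs0 : ∀ m, m 0 = 0 → h m = 0) :
    ∫⁻ m, h m ∂Q = ∫⁻ m, h (shiftSeq m) ∂Q := by
  induction n generalizing h with
  | zero => exact hQ.lintegral_shift_pair h0 h1 hα hm hom (by simpa using hd) hs1 hs0
  | succ n ih =>
    have hmeas : ∀ (ν : Measure (ℝ × ℝ)) {h : (ℤ → ℝ) → ENNReal}, Measurable h → ∀ i j : ℤ,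
        Measurable fun m : ℤ → ℝ => ∫⁻ z, h (Function.update m i z) ∂tailTransition ν (m j) :=
      fun ν h hm i j => measurable_lintegral_tailTransition ν (measurable_pi_apply j)
        (hm.comp (measurable_update_int i))
    set μ' := Q.map fun m : ℤ → ℝ => (m 0, m (-1)) with hμ'
    -- The window of `h` is `[-(n + 1), n + 2]`. Here `g` integrates out the right end and `f` below
    -- the left end, which leaves the window of the induction hypothesis.
    set g : (ℤ → ℝ) → ENNReal := fun m =>
      ∫⁻ z, h (Function.update m ((n : ℤ) + 1 + 1) z) ∂tailTransition μ (m ((n : ℤ) + 1)) with hg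
    have hgm : Measurable g := hmeas μ hm _ _
    have hgd : DependsOn g (Set.Icc (-(n : ℤ) - 1) (n + 1)) := by
      refine hd.step (fun k hk hki => ?_) ?_
      · simp only [Set.mem_Icc] at hk ⊢; push_cast at hk; omega
      · simp only [Set.mem_Icc]; omega
    have hghom : IsHomogeneousFunctional α g := hom.step hm _ _
    set f : (ℤ → ℝ) → ENNReal := fun m =>
      ∫⁻ z, g (Function.update m (-(n : ℤ) - 1) z) ∂tailTransition μ' (m (-(n : ℤ))) with hf
    have hfd : DependsOn f (Set.Icc (-(n : ℤ)) (n + 1)) := by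
      refine hgd.step (fun k hk hki => ?_) ?_
      · simp only [Set.mem_Icc] at hk ⊢; omega
      · simp only [Set.mem_Icc]; omega
    have hg1 : ∀ m, m 1 = 0 → g m = 0 := fun m h1 => by
      have : ∀ z, h (Function.update m ((n : ℤ) + 1 + 1) z) = 0 := fun z =>
        hs1 _ (by rw [Function.update_of_ne (by omega)]; exact h1)
      simp [hg, this]
    have hg0 : ∀ m, m 0 = 0 → g m = 0 := fun m h0 => by
      have : ∀ z, h (Function.update m ((n : ℤ) + 1 + 1) z) = 0 := fun z =>
        hs0 _ (by rw [Function.update_of_ne (by omega)]; exact h0)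
      simp [hg, this]
    have ihf := ih (hmeas μ' hgm _ _) (hghom.step hgm _ _) hfd
      (fun m h1 => by
        have : ∀ z, g (Function.update m (-(n : ℤ) - 1) z) = 0 := fun z =>
          hg1 _ (by rw [Function.update_of_ne (by omega)]; exact h1)
        simp [this])
      (fun m h0 => by
        have : ∀ z, g (Function.update m (-(n : ℤ) - 1) z) = 0 := fun z =>
          hg0 _ (by rw [Function.update_of_ne (by omega)]; exact h0)
        simp [this])
    have L1 : ∫⁻ m, h m ∂Q = ∫⁻ m, g m ∂Q :=
      hQ.lintegral_forward' (by omega) hm (hd.mono fun k hk => by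
        simp only [Set.mem_Icc, Set.mem_Iic] at hk ⊢; push_cast at hk; omega)
    have L2 : ∫⁻ m, g m ∂Q = ∫⁻ m, f m ∂Q :=
      hQ.lintegral_backward' (by omega) hgm (hgd.mono fun k hk => by
        simp only [Set.mem_Icc, Set.mem_Ici] at hk ⊢; omega)
    -- After the shift the right end is the coordinate `n + 1` of the chain, reached by a forward
    -- step from time `n`, and in `R2` the left end is reached by a backward step from `-n - 1`. The
    -- transition laws do not depend on time, so the same `g` and `f` appear.
    have R1 : ∫⁻ m, h (shiftSeq m) ∂Q = ∫⁻ m, g (shiftSeq m) ∂Q := by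
      rw [hQ.lintegral_forward' (j := n) (h := fun m => h (shiftSeq m)) (by omega)
        (hm.comp measurable_shiftSeq)
        (hd.comp_shiftSeq (B := Set.Iic ((n : ℤ) + 1)) fun k hk => by
          simp only [Set.mem_Icc, Set.mem_Iic] at hk ⊢; push_cast at hk; omega)]
      refine lintegral_congr fun m => ?_
      simp only [shiftSeq_update, hg]
      have : shiftSeq m ((n : ℤ) + 1) = m n := by simp [shiftSeq]
      rw [this]
    have R2 : ∫⁻ m, g (shiftSeq m) ∂Q = ∫⁻ m, f (shiftSeq m) ∂Q := by
      rw [hQ.lintegral_backward' (j := -(n : ℤ) - 1) (h := fun m => g (shiftSeq m)) (by omega)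
        (hgm.comp measurable_shiftSeq)
        (hgd.comp_shiftSeq (B := Set.Ici (-(n : ℤ) - 1 - 1)) fun k hk => by
          simp only [Set.mem_Icc, Set.mem_Ici] at hk ⊢; omega)]
      refine lintegral_congr fun m => ?_
      simp only [shiftSeq_update, hf]
      have e1 : shiftSeq m (-(n : ℤ)) = m (-(n : ℤ) - 1) := rfl
      have e2 : -(n : ℤ) - 1 - 1 + 1 = -(n : ℤ) - 1 := by ring
      rw [e1, e2]
    rw [L1, L2, R1, R2, ihf]

end Shift

/-! ### Absorption, signs and moments along the chain -/

section Paths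

variable {α p : ℝ} {μ : Measure (ℝ × ℝ)} {Q : Measure (ℤ → ℝ)}

theorem IsBackForthTailChain.ae_forward (hQ : IsBackForthTailChain α p μ Q) {j : ℤ} (hj : 0 ≤ j)
    {B : Set (ℝ × ℝ)} (hB : MeasurableSet B) (h : ∀ x, tailTransition μ x {z | (x, z) ∈ B} = 0) :
    ∀ᵐ m ∂Q, (m j, m (j + 1)) ∉ B := by
  have hm : Measurable fun m : ℤ → ℝ => (m j, m (j + 1)) := by fun_prop
  have key := hQ.lintegral_forward' hj
    (h := fun m => Set.indicator B 1 (m j, m (j + 1))) ((measurable_one.indicator hB).comp hm)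
    (fun x y hxy => by
      simp only [hxy j (Set.mem_Iic.2 (by omega)), hxy (j + 1) (Set.mem_Iic.2 le_rfl)])
  have hz : ∀ m : ℤ → ℝ, ∫⁻ z, Set.indicator B (1 : ℝ × ℝ → ENNReal)
      (Function.update m (j + 1) z j, Function.update m (j + 1) z (j + 1))
        ∂tailTransition μ (m j) = 0 := fun m => by
    have hsec : MeasurableSet {z | (m j, z) ∈ B} := measurable_prodMk_left hB
    rw [← h (m j), ← lintegral_indicator_one hsec]
    refine lintegral_congr fun z => ?_
    rw [Function.update_self, Function.update_of_ne (by omega)]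
    rfl
  simp only [hz, lintegral_zero] at key
  have := (lintegral_eq_zero_iff ((measurable_one.indicator hB).comp hm)).1 key
  filter_upwards [this] with m h2 h3
  simp [Set.indicator_of_mem h3] at h2

theorem IsBackForthTailChain.ae_absorbed (hQ : IsBackForthTailChain α p μ Q) :
    ∀ᵐ m ∂Q, m 1 = 0 → ∀ k : ℤ, 1 ≤ k → m k = 0 := by
  have hB : MeasurableSet {q : ℝ × ℝ | q.1 = 0 ∧ q.2 ≠ 0} :=
    (measurableSet_fst_eq 0).inter (measurable_snd (measurableSet_singleton (0 : ℝ)).compl)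
  have key : ∀ᵐ m ∂Q, ∀ j : ℕ, ¬ (m j = 0 ∧ m ((j : ℤ) + 1) ≠ 0) := ae_all_iff.2 fun j => by
    refine hQ.ae_forward (by omega) hB fun x => ?_
    by_cases hx : x = 0
    · subst hx
      rw [tailTransition_zero]
      simp
    · simp [hx]
  filter_upwards [key] with m hm h1 k hk
  induction k, hk using Int.leInduction with
  | base => exact h1
  | succ k hk ih =>
    have := hm k.toNat
    rw [Int.toNat_of_nonneg (by omega)] at this
    by_contra h2
    exact this ⟨ih, h2⟩

theorem IsBackForthTailChain.ae_absorbed_backward (hQ : IsBackForthTailChain α p μ Q) :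
    ∀ᵐ m ∂Q, m (-1) = 0 → ∀ k : ℤ, k ≤ -1 → m k = 0 := by
  have := ae_of_ae_map measurable_reverseSeq.aemeasurable hQ.reverse.ae_absorbed
  filter_upwards [this] with m hm h1 k hk
  simpa [reverseSeq] using hm h1 (-k) (by omega)

theorem IsBackForthTailChain.ae_sign (hQ : IsBackForthTailChain α p μ Q)
    (h0 : 0 ≤ p) (h1 : p ≤ 1) :
    ∀ᵐ m ∂Q, (m 0 = 1 ∨ m 0 = -1) ∧ 0 < signProb p (m 0) := by
  have hm : AEMeasurable (fun m : ℤ → ℝ => (m 0, m 1)) Q := by fun_prop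
  have e1 : ∀ᵐ q ∂μ, (q.1 = 1 ∨ q.1 = -1) ∧ 0 < signProb p q.1 := by
    have key : ∀ σ : ℝ, (σ = 1 ∨ σ = -1) → ∀ᵐ q ∂μ, q.1 = σ → 0 < signProb p σ := fun σ hσ => by
      by_cases hp : 0 < signProb p σ
      · exact Eventually.of_forall fun q _ => hp
      · have hz : μ {q | q.1 = σ} = 0 := by
          rw [hQ.law_mem.sign_mass hσ, ENNReal.ofReal_of_nonpos (not_lt.1 hp)]
        filter_upwards [compl_mem_ae_iff.2 hz] with q hq hq'
        exact absurd hq' hq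
    filter_upwards [hQ.law_mem.ae_sign h0 h1, key 1 (Or.inl rfl), key (-1) (Or.inr rfl)]
      with q hq k1 k2
    refine ⟨hq, ?_⟩
    rcases hq with hq | hq
    · rw [hq]; exact k1 hq
    · rw [hq]; exact k2 hq
  rw [← hQ.forward_law] at e1
  exact ae_of_ae_map hm e1

theorem sign_eq_or_of_ne_zero {x : ℝ} (hx : x ≠ 0) : Real.sign x = 1 ∨ Real.sign x = -1 := by
  rcases lt_or_gt_of_ne hx with h | h
  · exact Or.inr (Real.sign_of_neg h)
  · exact Or.inl (Real.sign_of_pos h)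

theorem measurableSet_null_sign (p : ℝ) :
    MeasurableSet {z : ℝ | z ≠ 0 ∧ ¬ 0 < signProb p (Real.sign z)} := by
  have h1 : Measurable (signProb p) :=
    Measurable.ite (measurableSet_singleton (1 : ℝ)) measurable_const measurable_const
  exact (measurableSet_singleton (0 : ℝ)).compl.inter
    (measurableSet_lt measurable_const (h1.comp measurable_sign)).compl

/-- A tail chain never enters a sign of probability zero. -/
theorem IsTailPairLaw.tailTransition_null (h : IsTailPairLaw p α μ) (x : ℝ) :
    tailTransition μ x {z | z ≠ 0 ∧ ¬ 0 < signProb p (Real.sign z)} = 0 := by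
  by_cases hx : x = 0
  · subst hx
    rw [tailTransition_zero]
    simp
  have hms := measurableSet_null_sign p
  rw [tailTransition_of_ne_zero μ hx, Measure.map_apply (by fun_prop) hms]
  rw [ProbabilityTheory.cond_apply (measurableSet_fst_eq _)]
  by_cases hpx : 0 < signProb p (Real.sign x)
  · refine mul_eq_zero_of_right _ ?_
    -- If `p(τ) = 0`, the moment condition makes `(τ M)_+` vanish almost surely.
    have key : ∀ τ : ℝ, (τ = 1 ∨ τ = -1) → ¬ 0 < signProb p τ → ∀ᵐ q ∂μ, τ * q.2 ≤ 0 := by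
      intro τ hτ hp
      have hmom := h.moment τ hτ
      rw [h.sign_mass hτ, ENNReal.ofReal_of_nonpos (not_lt.1 hp), nonpos_iff_eq_zero,
        lintegral_eq_zero_iff (by fun_prop)] at hmom
      filter_upwards [hmom] with q hq
      by_contra hlt
      have := not_le.1 hlt
      simp only [Pi.zero_apply, ENNReal.ofReal_eq_zero] at hq
      rw [posPow_of_nonneg this.le] at hq
      exact absurd (Real.rpow_pos_of_pos this α) hq.not_gt
    have hae : ∀ᵐ q ∂μ, q ∉ {q : ℝ × ℝ | q.1 = Real.sign x} ∩
        (fun q : ℝ × ℝ => x * (q.2 / q.1)) ⁻¹' {z | z ≠ 0 ∧ ¬ 0 < signProb p (Real.sign z)} := by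
      have k1 : ∀ᵐ q ∂μ, ¬ 0 < signProb p 1 → 1 * q.2 ≤ 0 :=
        eventually_imp_distrib_left.2 (key 1 (Or.inl rfl))
      have k2 : ∀ᵐ q ∂μ, ¬ 0 < signProb p (-1) → -1 * q.2 ≤ 0 :=
        eventually_imp_distrib_left.2 (key (-1) (Or.inr rfl))
      filter_upwards [k1, k2] with q k1 k2
      rintro ⟨hq, hz, hnp⟩
      simp only [Set.mem_ofPred_eq] at hq
      have hxq : x * (q.2 / q.1) = |x| * q.2 := by
        rcases sign_eq_or_of_ne_zero hx with hs | hs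
        · have := abs_mul_sign' hx
          rw [hs, mul_one] at this
          rw [hq, hs, this, div_one]
        · have := abs_mul_sign' hx
          rw [hs] at this
          rw [hq, hs]
          conv_lhs => rw [← this]
          ring
      have habs := abs_pos.2 hx
      simp only [hxq] at hz hnp
      have hq2 : q.2 ≠ 0 := right_ne_zero_of_mul hz
      rcases lt_or_gt_of_ne hq2 with hlt | hgt
      · rw [Real.sign_of_neg (mul_neg_of_pos_of_neg habs hlt)] at hnp
        linarith [k2 hnp]
      · rw [Real.sign_of_pos (mul_pos habs hgt)] at hnp
        linarith [k1 hnp]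
    simpa using measure_eq_zero_iff_ae_notMem.2 hae
  -- From a state whose own sign has weight zero the transition law is the zero measure.
  · have hz : μ {q | q.1 = Real.sign x} = 0 := by
      rw [h.sign_mass (sign_eq_or_of_ne_zero hx), ENNReal.ofReal_of_nonpos (not_lt.1 hpx)]
    exact mul_eq_zero_of_right _ (measure_inter_null_of_null_left _ hz)

theorem IsBackForthTailChain.ae_signProb_pos (hQ : IsBackForthTailChain α p μ Q)
    (h0 : 0 ≤ p) (h1 : p ≤ 1) (n : ℕ) :
    ∀ᵐ m ∂Q, m n ≠ 0 → 0 < signProb p (Real.sign (m n)) := by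
  cases n with
  | zero =>
    filter_upwards [hQ.ae_sign h0 h1] with m ⟨hm1, hm2⟩ _
    have : Real.sign (m 0) = m 0 := by
      rcases hm1 with h | h <;> rw [h]
      · exact Real.sign_of_pos one_pos
      · exact Real.sign_of_neg (by norm_num)
    simpa [this] using hm2
  | succ n =>
    have hms := measurableSet_null_sign p
    have := hQ.ae_forward (j := n) (by omega) (measurable_snd hms)
      fun x => hQ.law_mem.tailTransition_null x
    filter_upwards [this] with m hm hne
    by_contra hcon
    exact hm ⟨hne, hcon⟩

/-- The coordinates of a tail chain have finite moments of order `α`. -/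
theorem IsBackForthTailChain.lintegral_abs_rpow_lt_top (hQ : IsBackForthTailChain α p μ Q)
    (h0 : 0 ≤ p) (h1 : p ≤ 1) (hα : 0 < α) (n : ℕ) :
    ∫⁻ m, ENNReal.ofReal (|m n| ^ α) ∂Q < ⊤ := by
  have := hQ.isProb
  have := hQ.law_mem.isProb
  induction n with
  | zero =>
    refine lt_of_le_of_lt (lintegral_mono_ae (g := fun _ => 1) ?_) (by simp)
    filter_upwards [hQ.ae_sign h0 h1] with m hm
    rcases hm.1 with h | h <;> simp [h]
  | succ n ih =>
    have habs : ∀ z : ℝ, ENNReal.ofReal (|z| ^ α) =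
        ENNReal.ofReal (posPow α (1 * z)) + ENNReal.ofReal (posPow α (-1 * z)) := fun z => by
      rw [← ENNReal.ofReal_add (posPow_nonneg _ _) (posPow_nonneg _ _)]
      congr 1
      rcases le_total 0 z with h | h
      · rw [posPow_of_nonneg (by linarith), posPow_of_nonpos hα (by linarith), abs_of_nonneg h]
        simp
      · rw [posPow_of_nonpos hα (by linarith), posPow_of_nonneg (by linarith), abs_of_nonpos h]
        simp
    have hfin : ∫⁻ q, ENNReal.ofReal (|q.2| ^ α) ∂μ < ⊤ := by
      simp only [habs]
      rw [lintegral_add_left (by fun_prop)]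
      exact ENNReal.add_lt_top.2
        ⟨(hQ.law_mem.moment 1 (Or.inl rfl)).trans_lt (measure_lt_top _ _),
          (hQ.law_mem.moment (-1) (Or.inr rfl)).trans_lt (measure_lt_top _ _)⟩
    set C : ℝ → ENNReal := fun σ =>
      ∫⁻ q, ENNReal.ofReal (|q.2| ^ α) ∂ProbabilityTheory.cond μ {q | q.1 = σ} with hC
    have hCfin : ∀ σ, C σ < ⊤ := fun σ => by
      simp only [hC, ProbabilityTheory.cond, lintegral_smul_measure, smul_eq_mul]
      by_cases hz : μ {q | q.1 = σ} = 0
      · rw [setLIntegral_measure_zero _ _ hz]; simp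
      · exact ENNReal.mul_lt_top (ENNReal.inv_lt_top.2 (pos_iff_ne_zero.2 hz))
          ((setLIntegral_le_lintegral _ _).trans_lt hfin)
    -- From `x ≠ 0` the next state has modulus `|x| |M|`, with `M` conditioned on `I = sign x`; the
    -- sum of both conditional moments bounds the growth factor for either sign.
    have hstep : ∀ x, ∫⁻ z, ENNReal.ofReal (|z| ^ α) ∂tailTransition μ x ≤
        (C 1 + C (-1)) * ENNReal.ofReal (|x| ^ α) := fun x => by
      by_cases hx : x = 0
      · subst hx
        rw [tailTransition_zero, lintegral_dirac, abs_zero, Real.zero_rpow hα.ne']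
        simp
      · have h2 : ∫⁻ z, ENNReal.ofReal (|z| ^ α) ∂tailTransition μ x =
            ENNReal.ofReal (|x| ^ α) * C (Real.sign x) := by
          rw [lintegral_tailTransition μ hx (by fun_prop), hC,
            ← lintegral_const_mul' _ _ ENNReal.ofReal_ne_top]
          refine lintegral_congr_ae ?_
          filter_upwards [ProbabilityTheory.ae_cond_mem (measurableSet_fst_eq (Real.sign x))]
            with q hq
          rw [← ENNReal.ofReal_mul (by positivity), ← Real.mul_rpow (abs_nonneg _) (abs_nonneg _),
            abs_mul, abs_div]
          have : |q.1| = 1 := by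
            rw [show q.1 = Real.sign x from hq]
            rcases sign_eq_or_of_ne_zero hx with hs | hs <;> simp [hs]
          rw [this, div_one]
        rw [h2, mul_comm]
        gcongr
        rcases sign_eq_or_of_ne_zero hx with hs | hs
        · rw [hs]; exact le_self_add
        · rw [hs]; exact le_add_self
    have key := hQ.lintegral_forward n (h := fun m => ENNReal.ofReal (|m ((n : ℤ) + 1)| ^ α))
      (by fun_prop) (fun x y hxy => by simp only [hxy _ (Set.mem_Iic.2 le_rfl)])
    push_cast
    rw [key]
    simp only [Function.update_self]
    calc ∫⁻ m, ∫⁻ z, ENNReal.ofReal (|z| ^ α) ∂tailTransition μ (m n) ∂Q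
        ≤ ∫⁻ m, (C 1 + C (-1)) * ENNReal.ofReal (|m n| ^ α) ∂Q := lintegral_mono fun m => hstep _
      _ = (C 1 + C (-1)) * ∫⁻ m, ENNReal.ofReal (|m n| ^ α) ∂Q :=
        lintegral_const_mul' _ _ (ENNReal.add_lt_top.2 ⟨hCfin 1, hCfin (-1)⟩).ne
      _ < ⊤ := ENNReal.mul_lt_top (ENNReal.add_lt_top.2 ⟨hCfin 1, hCfin (-1)⟩) ih

theorem IsBackForthTailChain.lintegral_abs_rpow_lt_top' (hQ : IsBackForthTailChain α p μ Q)
    (h0 : 0 ≤ p) (h1 : p ≤ 1) (hα : 0 < α) (k : ℤ) :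
    ∫⁻ m, ENNReal.ofReal (|m k| ^ α) ∂Q < ⊤ := by
  rcases le_total 0 k with hk | hk
  · lift k to ℕ using hk
    exact hQ.lintegral_abs_rpow_lt_top h0 h1 hα k
  · obtain ⟨n, rfl⟩ : ∃ n : ℕ, k = -(n : ℤ) := ⟨(-k).toNat, by omega⟩
    have := hQ.reverse.lintegral_abs_rpow_lt_top h0 h1 hα n
    rwa [lintegral_map (by fun_prop) measurable_reverseSeq] at this

end Paths

theorem measurableSet_coord_eq_zero (k : ℤ) : MeasurableSet {m : ℤ → ℝ | m k = 0} :=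
  measurableSet_eq_fun (measurable_pi_apply k) measurable_const

/-! ### Window functionals and the two expressions for the limit -/

section Window

variable {α p : ℝ} {μ : Measure (ℝ × ℝ)} {Q : Measure (ℤ → ℝ)} {t : ℕ}

/-- The functional `⋁_{j ∈ s} (x_j m_{j-i})_+ ^ α`. -/
noncomputable def windowMax (α : ℝ) (x : Fin (t + 1) → ℝ) (s : Set (Fin (t + 1))) (i : ℤ)
    (m : ℤ → ℝ) : ENNReal :=
  ⨆ (j : Fin (t + 1)) (_ : j ∈ s), ENNReal.ofReal (posPow α (x j * m (((j : ℕ) : ℤ) - i)))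

@[fun_prop]
theorem measurable_windowMax (x : Fin (t + 1) → ℝ) (s : Set (Fin (t + 1))) (i : ℤ) :
    Measurable (windowMax α x s i) :=
  Measurable.iSup fun j => Measurable.iSup fun _ => by fun_prop

theorem windowMax_shiftSeq (x : Fin (t + 1) → ℝ) (s : Set (Fin (t + 1))) (i : ℤ) (m : ℤ → ℝ) :
    windowMax α x s i (shiftSeq m) = windowMax α x s (i + 1) m := by
  simp only [windowMax, shiftSeq, sub_sub]

theorem isHomogeneousFunctional_windowMax (x : Fin (t + 1) → ℝ) (s : Set (Fin (t + 1))) (i : ℤ) :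
    IsHomogeneousFunctional α (windowMax α x s i) := by
  intro c hc m
  simp only [windowMax, ENNReal.mul_iSup]
  refine iSup_congr fun j => iSup_congr fun _ => ?_
  rw [mul_left_comm, posPow_mul hc.le, ENNReal.ofReal_mul (by positivity)]

theorem windowMax_congr {x : Fin (t + 1) → ℝ} {s : Set (Fin (t + 1))} {i : ℤ} {m m' : ℤ → ℝ}
    (h : ∀ j ∈ s, m (((j : ℕ) : ℤ) - i) = m' (((j : ℕ) : ℤ) - i)) :
    windowMax α x s i m = windowMax α x s i m' :=
  iSup_congr fun j => iSup_congr fun hj => by rw [h j hj]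

theorem windowMax_eq_of_subset (hα : 0 < α) {x : Fin (t + 1) → ℝ} {s s' : Set (Fin (t + 1))}
    (hss : s ⊆ s') {i : ℤ} {m : ℤ → ℝ}
    (h : ∀ j ∈ s', j ∉ s → m (((j : ℕ) : ℤ) - i) = 0) :
    windowMax α x s' i m = windowMax α x s i m := by
  refine le_antisymm (iSup₂_le fun j hj => ?_) (biSup_mono fun j hj => hss hj)
  by_cases hjs : j ∈ s
  · exact le_iSup₂_of_le j hjs le_rfl
  · rw [h j hj hjs, mul_zero, posPow_of_nonpos hα le_rfl, ENNReal.ofReal_zero]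
    exact zero_le

theorem windowMax_Ici (x : Fin (t + 1) → ℝ) (i : Fin (t + 1)) (k : ℤ) (m : ℤ → ℝ) :
    windowMax α x (Set.Ici i) k m =
      max (ENNReal.ofReal (posPow α (x i * m (((i : ℕ) : ℤ) - k))))
        (windowMax α x (Set.Ioi i) k m) := by
  refine le_antisymm (iSup₂_le fun j hj => ?_) (max_le ?_ ?_)
  · rcases (Set.mem_Ici.1 hj).eq_or_lt with rfl | h
    · exact le_max_left _ _
    · exact le_max_of_le_right (le_iSup₂_of_le j h le_rfl)
  · exact le_iSup₂_of_le i (Set.mem_Ici.2 le_rfl) le_rfl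
  · exact biSup_mono fun j hj => Set.Ioi_subset_Ici_self hj

theorem tailDependenceForward_eq (x : Fin (t + 1) → ℝ) :
    tailDependenceForward α Q x = ∫⁻ m, windowMax α x Set.univ 0 m ∂Q +
      ∑ k : Fin t, ∫⁻ m in {m | m (-1) = 0}, windowMax α x (Set.Ici k.succ) (k.succ : ℕ) m ∂Q := by
  rw [tailDependenceForward]
  congr 1
  · simp [windowMax]
  · rw [Finset.sum_filter, Fin.sum_univ_succ]
    simp only [Fin.val_zero, lt_irrefl, if_false, zero_add, Fin.val_succ, Nat.succ_pos, if_true]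
    rfl

/-- Needed to cancel such terms in `ENNReal`; the maximum is bounded by a finite sum of moments of
order `α`. -/
theorem IsBackForthTailChain.lintegral_windowMax_ne_top (hQ : IsBackForthTailChain α p μ Q)
    (h0 : 0 ≤ p) (h1 : p ≤ 1) (hα : 0 < α) (x : Fin (t + 1) → ℝ) (s : Set (Fin (t + 1))) (i : ℤ) :
    ∫⁻ m, windowMax α x s i m ∂Q ≠ ⊤ := by
  refine ne_top_of_le_ne_top (b := ∑ j : Fin (t + 1), ENNReal.ofReal (|x j| ^ α) *
    ∫⁻ m, ENNReal.ofReal (|m (((j : ℕ) : ℤ) - i)| ^ α) ∂Q) ?_ ?_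
  · refine ENNReal.sum_ne_top.2 fun j _ => ENNReal.mul_ne_top ENNReal.ofReal_ne_top
      (hQ.lintegral_abs_rpow_lt_top' h0 h1 hα _).ne
  · simp only [← lintegral_const_mul' _ _ ENNReal.ofReal_ne_top]
    rw [← lintegral_finsetSum _ fun j _ => by fun_prop]
    refine lintegral_mono fun m => iSup₂_le fun j _ => ?_
    refine le_trans ?_ (Finset.single_le_sum (f := fun j : Fin (t + 1) =>
      ENNReal.ofReal (|x j| ^ α) * ENNReal.ofReal (|m (((j : ℕ) : ℤ) - i)| ^ α))
      (fun _ _ => zero_le) (Finset.mem_univ j))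
    rw [← ENNReal.ofReal_mul (by positivity), ← Real.mul_rpow (abs_nonneg _) (abs_nonneg _),
      ← abs_mul]
    exact ENNReal.ofReal_le_ofReal (Real.rpow_le_rpow (le_max_right _ _)
      (max_le (le_abs_self _) (abs_nonneg _)) hα.le)

/-- The time change is applied to the window maximum cut off to `{M_0 ≠ 0, M_1 ≠ 0}`. Since `M_0` is
a sign, this is a cut-off on `M_1` before the shift and on `M_{-1}` after it. -/
theorem IsBackForthTailChain.setLIntegral_windowMax_shift (hQ : IsBackForthTailChain α p μ Q)
    (h0 : 0 ≤ p) (h1 : p ≤ 1) (hα : 0 < α) (x : Fin (t + 1) → ℝ) (s : Set (Fin (t + 1))) (i : ℤ) :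
    ∫⁻ m in {m | m 1 ≠ 0}, windowMax α x s i m ∂Q =
      ∫⁻ m in {m | m (-1) ≠ 0}, windowMax α x s (i + 1) m ∂Q := by
  have hms : ∀ k : ℤ, MeasurableSet {m : ℤ → ℝ | m k ≠ 0} := fun k =>
    (measurableSet_coord_eq_zero k).compl
  set A : Set (ℤ → ℝ) := {m | m 0 ≠ 0} ∩ {m | m 1 ≠ 0} with hA
  have hAm : MeasurableSet A := (hms 0).inter (hms 1)
  have hae : ∀ᵐ m ∂Q, m 0 ≠ 0 := by
    filter_upwards [hQ.ae_sign h0 h1] with m hm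
    rcases hm.1 with h | h <;> rw [h] <;> norm_num
  -- Large enough for `[-n, n + 1]` to contain every index `j - i` with `0 ≤ j ≤ t`.
  set n : ℕ := t + i.natAbs with hn
  have key := hQ.lintegral_shift h0 h1 hα n (h := A.indicator (windowMax α x s i))
    ((measurable_windowMax x s i).indicator hAm) ?_ ?_ ?_ ?_
  · rw [← lintegral_indicator (hms 1), ← lintegral_indicator (hms (-1))]
    have e1 : ∫⁻ m, A.indicator (windowMax α x s i) m ∂Q =
        ∫⁻ m, Set.indicator {m | m 1 ≠ 0} (windowMax α x s i) m ∂Q := by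
      refine lintegral_congr_ae ?_
      filter_upwards [hae] with m hm
      by_cases h : m 1 = 0
      · rw [Set.indicator_of_notMem (show m ∉ A from fun h' => h'.2 h),
          Set.indicator_of_notMem (show m ∉ {m : ℤ → ℝ | m 1 ≠ 0} from fun h' => h' h)]
      · rw [Set.indicator_of_mem (show m ∈ A from ⟨hm, h⟩), Set.indicator_of_mem (by exact h)]
    have e2 : ∫⁻ m, A.indicator (windowMax α x s i) (shiftSeq m) ∂Q =
        ∫⁻ m, Set.indicator {m | m (-1) ≠ 0} (windowMax α x s (i + 1)) m ∂Q := by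
      refine lintegral_congr_ae ?_
      filter_upwards [hae] with m hm
      have e3 : shiftSeq m 0 = m (-1) := by simp [shiftSeq]
      have e4 : shiftSeq m 1 = m 0 := by simp [shiftSeq]
      by_cases h : m (-1) = 0
      · rw [Set.indicator_of_notMem (show shiftSeq m ∉ A from fun h' => h'.1 (e3.trans h)),
          Set.indicator_of_notMem (show m ∉ {m : ℤ → ℝ | m (-1) ≠ 0} from fun h' => h' h)]
      · rw [Set.indicator_of_mem (show shiftSeq m ∈ A from
          ⟨by rw [Set.mem_ofPred_eq, e3]; exact h, by rw [Set.mem_ofPred_eq, e4]; exact hm⟩),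
          Set.indicator_of_mem (by exact h), windowMax_shiftSeq]
    rw [← e1, ← e2, key]
  · intro c hc m
    by_cases hm : m ∈ A
    · rw [Set.indicator_of_mem hm, Set.indicator_of_mem (by
        exact ⟨mul_ne_zero hc.ne' hm.1, mul_ne_zero hc.ne' hm.2⟩),
        isHomogeneousFunctional_windowMax x s i c hc]
    · rw [Set.indicator_of_notMem hm, Set.indicator_of_notMem, mul_zero]
      exact fun h => hm ⟨right_ne_zero_of_mul h.1, right_ne_zero_of_mul h.2⟩
  · intro y z hyz
    have hA0 : y 0 = z 0 := hyz 0 (by simp only [Set.mem_Icc]; omega)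
    have hA1 : y 1 = z 1 := hyz 1 (by simp only [Set.mem_Icc]; omega)
    have hw : windowMax α x s i y = windowMax α x s i z := windowMax_congr fun j _ => hyz _ (by
      have := j.isLt
      simp only [Set.mem_Icc]; omega)
    by_cases hm : y ∈ A
    · rw [Set.indicator_of_mem hm, Set.indicator_of_mem (by
        exact ⟨by rw [Set.mem_ofPred_eq, ← hA0]; exact hm.1,
          by rw [Set.mem_ofPred_eq, ← hA1]; exact hm.2⟩), hw]
    · rw [Set.indicator_of_notMem hm, Set.indicator_of_notMem]
      exact fun h => hm ⟨by rw [Set.mem_ofPred_eq, hA0]; exact h.1,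
        by rw [Set.mem_ofPred_eq, hA1]; exact h.2⟩
  · exact fun m h => Set.indicator_of_notMem (fun h' => h'.2 h) _
  · exact fun m h => Set.indicator_of_notMem (fun h' => h'.1 h) _

/-- Telescoping, in additive form to avoid subtraction in `ENNReal`. By absorption the maximum over
`j > i` at offset `i` lives on `{M_1 ≠ 0}`; the shift turns it into the `{M_{-1} ≠ 0}` part of the
maximum over `j ≥ i + 1` at offset `i + 1`, leaving the `{M_{-1} = 0}` part. -/
theorem IsBackForthTailChain.tailDependenceForward_add (hQ : IsBackForthTailChain α p μ Q)
    (h0 : 0 ≤ p) (h1 : p ≤ 1) (hα : 0 < α) (x : Fin (t + 1) → ℝ) :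
    tailDependenceForward α Q x +
      ∑ i : Fin (t + 1), ∫⁻ m, windowMax α x (Set.Ioi i) (i : ℕ) m ∂Q =
      ∑ i : Fin (t + 1), ∫⁻ m, windowMax α x (Set.Ici i) (i : ℕ) m ∂Q := by
  have hms : MeasurableSet {m : ℤ → ℝ | m (-1) = 0} :=
    (measurableSet_coord_eq_zero (-1))
  have hms1 : MeasurableSet {m : ℤ → ℝ | m 1 ≠ 0} :=
    (measurableSet_coord_eq_zero (1)).compl
  have hb : ∀ k : Fin t, ∫⁻ m, windowMax α x (Set.Ioi k.castSucc) (k.castSucc : ℕ) m ∂Q =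
      ∫⁻ m in {m | m (-1) ≠ 0}, windowMax α x (Set.Ici k.succ) (k.succ : ℕ) m ∂Q := by
    intro k
    have e : Set.Ioi k.castSucc = Set.Ici k.succ := by
      ext j; simp [Fin.lt_def, Fin.le_def]
    have := hQ.setLIntegral_windowMax_shift h0 h1 hα x (Set.Ici k.succ) (k.castSucc : ℕ)
    rw [← lintegral_indicator hms1] at this
    rw [e]
    have e2 : ((k.succ : ℕ) : ℤ) = ((k.castSucc : ℕ) : ℤ) + 1 := by simp
    rw [e2, ← this]
    refine lintegral_congr_ae ?_
    filter_upwards [hQ.ae_absorbed] with m hm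
    by_cases h : m 1 = 0
    · rw [Set.indicator_of_notMem (show m ∉ {m : ℤ → ℝ | m 1 ≠ 0} from fun h' => h' h),
        windowMax_eq_of_subset hα (Set.empty_subset _) fun j hj _ => hm h _ ?_]
      · simp [windowMax]
      · have := Fin.le_def.1 (Set.mem_Ici.1 hj)
        simp only [Fin.val_succ, Fin.val_castSucc] at this ⊢
        omega
    · rw [Set.indicator_of_mem (by exact h)]
  have hlast :
      ∫⁻ m, windowMax α x (Set.Ioi (Fin.last t)) ((Fin.last t : Fin (t + 1)) : ℕ) m ∂Q = 0 := by
    have : Set.Ioi (Fin.last t) = ∅ := by ext j; simp [Fin.le_last]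
    simp [windowMax, this]
  have hz : ∫⁻ m, windowMax α x Set.univ 0 m ∂Q =
      ∫⁻ m, windowMax α x (Set.Ici 0) ((0 : Fin (t + 1)) : ℕ) m ∂Q := by
    have : Set.Ici (0 : Fin (t + 1)) = Set.univ := by ext j; simp
    rw [this]; simp
  rw [tailDependenceForward_eq, Fin.sum_univ_castSucc, hlast, add_zero,
    Fin.sum_univ_succ (fun i : Fin (t + 1) => ∫⁻ m, windowMax α x (Set.Ici i) (i : ℕ) m ∂Q), hz,
    add_assoc, ← Finset.sum_add_distrib]
  congr 1
  refine Finset.sum_congr rfl fun k _ => ?_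
  rw [hb]
  exact lintegral_add_compl _ hms

/-- On `{M_{-1} = 0}` the coordinates before `-1` vanish as well, so the restricted maxima are
maxima over the full window; likewise on `{M_1 = 0}`. Both expressions thus become the sum of
full-window expectations over offsets `0, …, t` after adding terms on `{M_{-1} ≠ 0}`, respectively
`{M_1 ≠ 0}`, and the shift matches these additions. -/
theorem IsBackForthTailChain.tailDependenceForward_eq_backward (hQ : IsBackForthTailChain α p μ Q)
    (h0 : 0 ≤ p) (h1 : p ≤ 1) (hα : 0 < α) (x : Fin (t + 1) → ℝ) :
    tailDependenceForward α Q x = tailDependenceBackward α Q x := by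
  have hms : MeasurableSet {m : ℤ → ℝ | m (-1) = 0} :=
    (measurableSet_coord_eq_zero (-1))
  have hms1 : MeasurableSet {m : ℤ → ℝ | m 1 = 0} :=
    (measurableSet_coord_eq_zero (1))
  have hF : tailDependenceForward α Q x + ∑ k : Fin t,
      ∫⁻ m in {m | m (-1) ≠ 0}, windowMax α x Set.univ (k.succ : ℕ) m ∂Q =
      ∑ i : Fin (t + 1), ∫⁻ m, windowMax α x Set.univ (i : ℕ) m ∂Q := by
    rw [tailDependenceForward_eq, Fin.sum_univ_succ (fun i : Fin (t + 1) =>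
      ∫⁻ m, windowMax α x Set.univ (i : ℕ) m ∂Q), add_assoc, ← Finset.sum_add_distrib]
    simp only [Fin.val_zero, Nat.cast_zero]
    congr 1
    refine Finset.sum_congr rfl fun k _ => ?_
    refine Eq.trans ?_ (lintegral_add_compl (fun m => windowMax α x Set.univ (k.succ : ℕ) m) hms)
    congr 1
    refine setLIntegral_congr_fun_ae hms ?_
    filter_upwards [hQ.ae_absorbed_backward] with m hm h
    refine (windowMax_eq_of_subset hα (Set.subset_univ _) fun j _ hj => hm h _ ?_).symm
    have := Fin.lt_def.1 (not_le.1 fun h' => hj (Set.mem_Ici.2 h'))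
    omega
  have hB : tailDependenceBackward α Q x + ∑ k : Fin t,
      ∫⁻ m in {m | m 1 ≠ 0}, windowMax α x Set.univ (k.castSucc : ℕ) m ∂Q =
      ∑ i : Fin (t + 1), ∫⁻ m, windowMax α x Set.univ (i : ℕ) m ∂Q := by
    rw [tailDependenceBackward, Finset.sum_filter, Fin.sum_univ_castSucc, Fin.sum_univ_castSucc
      (fun i : Fin (t + 1) => ∫⁻ m, windowMax α x Set.univ (i : ℕ) m ∂Q)]
    simp only [Fin.val_last, lt_irrefl, if_false, add_zero, Fin.val_castSucc, Fin.is_lt, if_true]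
    rw [add_assoc, ← Finset.sum_add_distrib, add_comm]
    congr 1
    · refine Finset.sum_congr rfl fun k _ => ?_
      refine Eq.trans ?_ (lintegral_add_compl (fun m => windowMax α x Set.univ (k : ℕ) m) hms1)
      congr 1
      refine setLIntegral_congr_fun_ae hms1 ?_
      filter_upwards [hQ.ae_absorbed] with m hm h
      refine (windowMax_eq_of_subset hα (s := Set.Iic k.castSucc) (Set.subset_univ _)
        fun j _ hj => hm h _ ?_).symm
      have := Fin.lt_def.1 (not_le.1 fun h' => hj (Set.mem_Iic.2 h'))
      simp only [Fin.val_castSucc] at this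
      omega
    · simp [windowMax]
  have hS : ∑ k : Fin t, ∫⁻ m in {m | m 1 ≠ 0}, windowMax α x Set.univ (k.castSucc : ℕ) m ∂Q =
      ∑ k : Fin t, ∫⁻ m in {m | m (-1) ≠ 0}, windowMax α x Set.univ (k.succ : ℕ) m ∂Q :=
    Finset.sum_congr rfl fun k _ => by
      rw [hQ.setLIntegral_windowMax_shift h0 h1 hα]
      simp
  rw [hS, ← hF] at hB
  refine ((ENNReal.add_left_inj (ENNReal.sum_ne_top.2 fun k _ => ?_)).1 hB).symm
  exact ne_top_of_le_ne_top (hQ.lintegral_windowMax_ne_top h0 h1 hα x _ _)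
    (setLIntegral_le_lintegral _ _)

end Window

/-! ### The forward tail chain as a driven sequence -/

section Identification

variable {S : Type*} [MeasurableSpace S] {E : Measure S} [IsProbabilityMeasure E] {α p : ℝ}
  {Φ : ℝ → S → ℝ} {Q : Measure (ℤ → ℝ)}

/-- Homogeneity reduces the step from `x` to the step from its sign. The weight of that sign must be
positive, since otherwise the conditional law is the zero measure. -/
theorem IsTailUpdate.lintegral_tailTransition_eq (hΦ : IsTailUpdate Φ) {x : ℝ}
    (hx : x ≠ 0 → 0 < signProb p (Real.sign x)) {f : ℝ → ENNReal} (hf : Measurable f) :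
    ∫⁻ z, f z ∂tailTransition (updatePairLaw E p Φ) x = ∫⁻ v, f (Φ x v) ∂E := by
  by_cases h0 : x = 0
  · subst h0
    simp [tailTransition_zero, lintegral_dirac, hΦ.zero]
  have hp := hx h0
  have hσ := sign_eq_or_of_ne_zero h0
  have hx' : |x| * Real.sign x = x := abs_mul_sign' h0
  have hpos : 0 < |x| := abs_pos.2 h0
  rw [lintegral_tailTransition _ h0 hf]
  generalize Real.sign x = σ at hp hσ hx' ⊢
  have hf' : Measurable fun q : ℝ × ℝ => f (x * (q.2 / q.1)) := by fun_prop
  have hms := measurableSet_fst_eq σ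
  have hmul : ∀ v, x * (Φ σ v / σ) = Φ x v := fun v => by
    conv_rhs => rw [← hx', hΦ.smul _ _ _ hpos]
    conv_lhs => rw [← hx']
    rcases hσ with rfl | rfl <;> ring
  rw [ProbabilityTheory.cond, lintegral_smul_measure, updatePairLaw_sign hΦ hσ,
    ← lintegral_indicator hms, lintegral_updatePairLaw hΦ (hf'.indicator hms), smul_eq_mul]
  have hc : (ENNReal.ofReal (signProb p σ))⁻¹ * ENNReal.ofReal (signProb p σ) = 1 :=
    ENNReal.inv_mul_cancel (by simpa using hp) ENNReal.ofReal_ne_top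
  rcases hσ with rfl | rfl
  · have e : ¬ (-1 : ℝ) = 1 := by norm_num
    simp only [Set.indicator, Set.mem_ofPred_eq, e, if_true, if_false, lintegral_zero, mul_zero,
      add_zero, hmul]
    rw [← mul_assoc, hc, one_mul]
  · have e : ¬ (1 : ℝ) = -1 := by norm_num
    simp only [Set.indicator, Set.mem_ofPred_eq, e, if_true, if_false, lintegral_zero, mul_zero,
      zero_add, hmul]
    rw [← mul_assoc, hc, one_mul]

/-- The forward part of a tail chain is the chain driven by the tail update. -/
theorem IsBackForthTailChain.lintegral_eq_driven (hΦ : IsTailUpdate Φ)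
    (hQ : IsBackForthTailChain α p (updatePairLaw E p Φ) Q) (h0 : 0 ≤ p) (h1 : p ≤ 1) (n : ℕ)
    {h : (ℕ → ℝ) → ENNReal} (hm : Measurable h) (hd : DependsOn h (Set.Iic n)) :
    ∫⁻ m, h (fun k => m k) ∂Q =
      ∫⁻ q, h (driven Φ q.1 q.2) ∂(signLaw p).prod (iidLaw E) := by
  have hdm : Measurable fun q : ℝ × (ℕ → S) => driven Φ q.1 q.2 :=
    measurable_pi_iff.2 fun k => measurable_driven hΦ.measurable k
  have hcomp : ∀ {g : (ℕ → ℝ) → ENNReal}, Measurable g →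
      Measurable fun q : ℝ × (ℕ → S) => g (driven Φ q.1 q.2) := fun hg => hg.comp hdm
  induction n generalizing h with
  | zero =>
    have e1 : ∀ w : ℕ → ℝ, h w = h fun _ => w 0 := fun w => hd fun k hk => by
      rw [Nat.le_zero.1 hk]
    have hm0 : Measurable fun s : ℝ => h fun _ => s := hm.comp (by fun_prop)
    have hm1 : Measurable fun q : ℝ × ℝ => h fun _ => q.1 := hm0.comp measurable_fst
    have hm2 : Measurable fun q : ℝ × S => h fun _ => q.1 := hm0.comp measurable_fst
    have e2 : ∫⁻ m, h (fun k => m k) ∂Q = ∫⁻ q, h (fun _ => q.1) ∂updatePairLaw E p Φ := by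
      rw [← hQ.forward_law, lintegral_map hm1
        (show Measurable fun m : ℤ → ℝ => (m 0, m 1) by fun_prop)]
      exact lintegral_congr fun m => e1 _
    rw [e2, updatePairLaw, lintegral_map hm1 hΦ.measurable_pair,
      lintegral_prod _ hm2.aemeasurable,
      lintegral_prod _ (hcomp hm).aemeasurable]
    refine lintegral_congr fun s => ?_
    have : ∀ e, h (driven Φ s e) = h fun _ => s := fun e => e1 _
    simp [this]
  | succ n ih =>
    -- The last step is integrated out on both sides: by the transition law for the tail chain, and
    -- by freshness of the `n`-th innovation for the driven sequence.
    set g : (ℕ → ℝ) → ENNReal := fun w => ∫⁻ v, h (Function.update w (n + 1) (Φ (w n) v)) ∂E with hg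
    have hum : Measurable fun q : (ℕ → ℝ) × S =>
        h (Function.update q.1 (n + 1) (Φ (q.1 n) q.2)) :=
      hm.comp ((measurable_update_prod (n + 1)).comp (measurable_fst.prodMk
        (hΦ.measurable.comp (((measurable_pi_apply n).comp measurable_fst).prodMk measurable_snd))))
    have hgm : Measurable g := hum.lintegral_prod_right'
    have hgd : DependsOn g (Set.Iic n) := fun w w' hw => by
      simp only [hg, hw n (Set.mem_Iic.2 le_rfl)]
      refine lintegral_congr fun v => hd fun k hk => ?_
      by_cases hk' : k = n + 1
      · subst hk'; simp
      · rw [Function.update_of_ne hk', Function.update_of_ne hk']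
        exact hw k (Set.mem_Iic.2 (by have := Set.mem_Iic.1 hk; omega))
    have hup : ∀ (m : ℤ → ℝ) z, (fun k : ℕ => Function.update m ((n : ℤ) + 1) z k) =
        Function.update (fun k : ℕ => m k) (n + 1) z := fun m z => by
      ext k
      by_cases hk : k = n + 1
      · subst hk; simp
      · rw [Function.update_of_ne hk, Function.update_of_ne (by omega)]
    have hdZ : DependsOn (fun m : ℤ → ℝ => h fun k => m k) (Set.Iic ((n : ℤ) + 1)) :=
      fun m m' hmm => hd fun k hk => hmm k (by
        simp only [Set.mem_Iic] at hk ⊢; omega)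
    have hmZ : Measurable fun m : ℤ → ℝ => h fun k => m k := hm.comp (by fun_prop)
    rw [hQ.lintegral_forward n hmZ hdZ]
    have e1 : ∫⁻ m, ∫⁻ z, h (fun k => Function.update m ((n : ℤ) + 1) z k)
        ∂tailTransition (updatePairLaw E p Φ) (m n) ∂Q = ∫⁻ m, g (fun k => m k) ∂Q := by
      refine lintegral_congr_ae ?_
      filter_upwards [hQ.ae_signProb_pos h0 h1 n] with m hmn
      simp only [hup]
      rw [hΦ.lintegral_tailTransition_eq hmn
        (f := fun z => h (Function.update (fun k : ℕ => m k) (n + 1) z))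
        (hm.comp ((measurable_update_prod (n + 1)).comp measurable_prodMk_left))]
    rw [e1, ih hgm hgd, lintegral_prod _ (hcomp hgm).aemeasurable,
      lintegral_prod _ (hcomp hm).aemeasurable]
    refine lintegral_congr fun s => ?_
    have hds : Measurable fun e : ℕ → S => driven Φ s e := hdm.comp measurable_prodMk_left
    have key := lintegral_iidLaw_eval E n
      (f := fun e v => h (Function.update (driven Φ s e) (n + 1) (Φ (driven Φ s e n) v)))
      (hum.comp ((hds.comp measurable_fst).prodMk measurable_snd)) (fun e v w => by
        simp only [driven_update Φ s e w le_rfl]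
        refine hd fun k hk => ?_
        by_cases hk' : k = n + 1
        · subst hk'; simp
        · rw [Function.update_of_ne hk', Function.update_of_ne hk']
          exact driven_update Φ s e w (by have := Set.mem_Iic.1 hk; omega))
    refine key.symm.trans (lintegral_congr fun e => ?_)
    rw [show Φ (driven Φ s e n) (e n) = driven Φ s e (n + 1) from rfl, Function.update_eq_self]

end Identification

section LastExceedanceIdentity

variable {S : Type*} [MeasurableSpace S] {E : Measure S} [IsProbabilityMeasure E] {α p : ℝ}
  {Φ : ℝ → S → ℝ} {Q : Measure (ℤ → ℝ)} {t : ℕ}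

/-- Truncated subtraction satisfies `(a - b) + b = max a b`, and the maximum over `j ≥ i` splits
into the term at `i` and the later ones. -/
theorem IsBackForthTailChain.lintegral_last_exceedance_add (hΦ : IsTailUpdate Φ)
    (hQ : IsBackForthTailChain α p (updatePairLaw E p Φ) Q) (h0 : 0 ≤ p) (h1 : p ≤ 1)
    (x : Fin (t + 1) → ℝ) (i : Fin (t + 1)) :
    ∫⁻ q, (ENNReal.ofReal (posPow α (x i * q.1)) -
        ⨆ j ∈ Finset.Ioi i, ENNReal.ofReal (posPow α (x j * driven Φ q.1 q.2 (j - i : ℕ))))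
          ∂(signLaw p).prod (iidLaw E) + ∫⁻ m, windowMax α x (Set.Ioi i) (i : ℕ) m ∂Q =
      ∫⁻ m, windowMax α x (Set.Ici i) (i : ℕ) m ∂Q := by
  set h : (ℕ → ℝ) → ENNReal := fun w => ENNReal.ofReal (posPow α (x i * w 0)) -
    ⨆ j ∈ Finset.Ioi i, ENNReal.ofReal (posPow α (x j * w (j - i : ℕ))) with hh
  have hm : Measurable h := by
    refine Measurable.sub (by fun_prop) ?_
    exact Measurable.iSup fun j => Measurable.iSup fun _ => by fun_prop
  have hd : DependsOn h (Set.Iic t) := fun w w' hw => by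
    simp only [hh, hw 0 (Set.mem_Iic.2 (Nat.zero_le _))]
    congr 1
    refine iSup_congr fun j => iSup_congr fun _ => ?_
    rw [hw _ (Set.mem_Iic.2 (by have := j.isLt; omega))]
  have key := hQ.lintegral_eq_driven hΦ h0 h1 t hm hd
  refine (congrArg (· + _) key.symm).trans ?_
  rw [← lintegral_add_right _ (measurable_windowMax x _ _)]
  refine lintegral_congr fun m => ?_
  have e : (⨆ j ∈ Finset.Ioi i, ENNReal.ofReal (posPow α (x j * m ((j - i : ℕ) : ℤ)))) =
      windowMax α x (Set.Ioi i) (i : ℕ) m := by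
    simp only [windowMax, Finset.mem_Ioi, Set.mem_Ioi]
    refine iSup_congr fun j => iSup_congr fun hj => ?_
    rw [Nat.cast_sub (Fin.le_def.1 hj.le)]
  rw [windowMax_Ici, ← e, ← tsub_add_eq_max, sub_self]
  rfl

theorem IsBackForthTailChain.sum_last_exceedance (hΦ : IsTailUpdate Φ)
    (hQ : IsBackForthTailChain α p (updatePairLaw E p Φ) Q) (h0 : 0 ≤ p) (h1 : p ≤ 1) (hα : 0 < α)
    (x : Fin (t + 1) → ℝ) :
    ∑ i, ∫⁻ q, (ENNReal.ofReal (posPow α (x i * q.1)) -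
        ⨆ j ∈ Finset.Ioi i, ENNReal.ofReal (posPow α (x j * driven Φ q.1 q.2 (j - i : ℕ))))
          ∂(signLaw p).prod (iidLaw E) = tailDependenceForward α Q x := by
  have key := hQ.tailDependenceForward_add h0 h1 hα x
  rw [← Finset.sum_congr rfl fun i _ => hQ.lintegral_last_exceedance_add hΦ h0 h1 x i,
    Finset.sum_add_distrib] at key
  exact ((ENNReal.add_left_inj (ENNReal.sum_ne_top.2 fun i _ =>
    hQ.lintegral_windowMax_ne_top h0 h1 hα x _ _)).1 key).symm

end LastExceedanceIdentity

/-! ### Existence of a back-and-forth tail chain -/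

section Representation

variable {α p : ℝ} {ν : Measure (ℝ × ℝ)}

theorem exists_probability_smul_eq (m : Measure ℝ) [IsFiniteMeasure m] :
    ∃ κ : Measure ℝ, IsProbabilityMeasure κ ∧ m Set.univ • κ = m := by
  by_cases h : m = 0
  · exact ⟨Measure.dirac 0, inferInstance, by simp [h]⟩
  · have h' : m Set.univ ≠ 0 := fun h' => h (Measure.measure_univ_eq_zero.1 h')
    refine ⟨(m Set.univ)⁻¹ • m, ⟨?_⟩, ?_⟩
    · simp [ENNReal.inv_mul_cancel h' (measure_ne_top _ _)]
    · rw [smul_smul, ENNReal.mul_inv_cancel h' (measure_ne_top _ _), one_smul]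

/-- Every tail pair law is produced by a tail update. -/
theorem IsTailPairLaw.exists_update (h : IsTailPairLaw p α ν) (h0 : 0 ≤ p) (h1 : p ≤ 1) :
    ∃ (E : Measure (ℝ × ℝ)) (Φ : ℝ → ℝ × ℝ → ℝ), IsProbabilityMeasure E ∧ IsTailUpdate Φ ∧
      ν = updatePairLaw E p Φ := by
  have := h.isProb
  set m : ℝ → Measure ℝ := fun σ => (ν.restrict {q | q.1 = σ}).map Prod.snd with hm
  obtain ⟨κ₁, hκ₁, e₁⟩ := exists_probability_smul_eq (m 1)
  obtain ⟨κ₂, hκ₂, e₂⟩ := exists_probability_smul_eq (m (-1))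
  have hmass : ∀ σ : ℝ, (σ = 1 ∨ σ = -1) → m σ Set.univ = ENNReal.ofReal (signProb p σ) :=
    fun σ hσ => by
      rw [← h.sign_mass hσ]
      simp [hm, Measure.map_apply measurable_snd MeasurableSet.univ]
  rw [hmass 1 (Or.inl rfl)] at e₁
  rw [hmass (-1) (Or.inr rfl)] at e₂
  -- The innovation is a pair: its first entry, distributed as `M` given `I = 1`, is used from
  -- positive states, and its second, as `M` given `I = -1`, from negative ones, each scaled by the
  -- modulus. At a sign of mass zero the conditional law may be any probability measure.
  have hΦ : IsTailUpdate fun (x : ℝ) (v : ℝ × ℝ) => if 0 < x then x * v.1 else -x * v.2 := by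
    refine ⟨?_, fun v => by simp, fun c x v hc => ?_⟩
    · exact Measurable.ite (measurableSet_lt measurable_const measurable_fst) (by fun_prop)
        (by fun_prop)
    · simp only [mul_pos_iff_of_pos_left hc]
      split_ifs <;> ring
  refine ⟨κ₁.prod κ₂, _, inferInstance, hΦ, Measure.ext_of_lintegral _ fun f hf => ?_⟩
  have hr : ∀ σ : ℝ, ∫⁻ q in {q | q.1 = σ}, f q ∂ν = ∫⁻ z, f (σ, z) ∂m σ := fun σ => by
    have hfσ : Measurable fun z => f (σ, z) := hf.comp measurable_prodMk_left
    rw [hm, lintegral_map hfσ measurable_snd]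
    refine setLIntegral_congr_fun (measurableSet_fst_eq σ) fun q hq => ?_
    rw [← (show q.1 = σ from hq)]
  rw [h.lintegral_eq h0 h1, hr, hr, lintegral_updatePairLaw hΦ hf, ← e₁, ← e₂,
    lintegral_smul_measure, lintegral_smul_measure]
  have f₁ : ∫⁻ v : ℝ × ℝ, f (1, v.1) ∂κ₁.prod κ₂ = ∫⁻ z, f (1, z) ∂κ₁ :=
    (measurePreserving_fst (μ := κ₁) (ν := κ₂)).lintegral_comp (hf.comp measurable_prodMk_left)
  have f₂ : ∫⁻ v : ℝ × ℝ, f (-1, v.2) ∂κ₁.prod κ₂ = ∫⁻ z, f (-1, z) ∂κ₂ :=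
    (measurePreserving_snd (μ := κ₁) (ν := κ₂)).lintegral_comp (hf.comp measurable_prodMk_left)
  norm_num [f₁, f₂]

end Representation

section DrivenMarkov

variable {S : Type*} [MeasurableSpace S] {E : Measure S} [IsProbabilityMeasure E] {α p : ℝ}
  {Φ : ℝ → S → ℝ}

theorem IsTailUpdate.ae_signProb_pos_driven (hΦ : IsTailUpdate Φ)
    (hν : IsTailPairLaw p α (updatePairLaw E p Φ)) {s : ℝ}
    (hs : s ≠ 0 → 0 < signProb p (Real.sign s)) (n : ℕ) :
    ∀ᵐ e ∂iidLaw E, driven Φ s e n ≠ 0 → 0 < signProb p (Real.sign (driven Φ s e n)) := by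
  induction n with
  | zero => exact .of_forall fun _ => hs
  | succ n ih =>
    have hN := measurableSet_null_sign p
    set N : Set ℝ := {z : ℝ | z ≠ 0 ∧ ¬ 0 < signProb p (Real.sign z)} with hNdef
    have hmd : ∀ n, Measurable fun e : ℕ → S => driven Φ s e n := fun n =>
      (measurable_driven hΦ.measurable n).comp measurable_prodMk_left
    have key := lintegral_iidLaw_eval E n
      (f := fun e v => N.indicator 1 (Φ (driven Φ s e n) v))
      ((measurable_one.indicator hN).comp (hΦ.measurable.comp
        (((hmd n).comp measurable_fst).prodMk measurable_snd)))
      (fun e v w => by simp only [driven_update Φ s e w le_rfl])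
    have hz : ∫⁻ e, ∫⁻ v, N.indicator 1 (Φ (driven Φ s e n) v) ∂E ∂iidLaw E = 0 := by
      refine (lintegral_congr_ae (g := 0) ?_).trans lintegral_zero
      filter_upwards [ih] with e he
      rw [← hΦ.lintegral_tailTransition_eq he (measurable_one.indicator hN),
        lintegral_indicator_one hN, hν.tailTransition_null]
      rfl
    rw [hz] at key
    change ∫⁻ e, N.indicator 1 (driven Φ s e (n + 1)) ∂iidLaw E = 0 at key
    have hNm : Measurable fun e => N.indicator (1 : ℝ → ENNReal) (driven Φ s e (n + 1)) :=
      (measurable_one.indicator hN).comp (hmd _)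
    rw [lintegral_eq_zero_iff hNm] at key
    filter_upwards [key] with e he hne
    by_contra hcon
    rw [Set.indicator_of_mem (show driven Φ s e (n + 1) ∈ N from ⟨hne, hcon⟩)] at he
    simp at he

/-- The Markov property of a chain driven by a tail update. -/
theorem IsTailUpdate.lintegral_mul_indicator_driven (hΦ : IsTailUpdate Φ)
    (hν : IsTailPairLaw p α (updatePairLaw E p Φ)) {s : ℝ}
    (hs : s ≠ 0 → 0 < signProb p (Real.sign s)) (n : ℕ) {F : (ℕ → S) → ENNReal}
    (hF : Measurable F) (hdep : ∀ e w, F (Function.update e n w) = F e) {A : Set ℝ}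
    (hA : MeasurableSet A) :
    ∫⁻ e, F e * A.indicator 1 (driven Φ s e (n + 1)) ∂iidLaw E =
      ∫⁻ e, F e * tailTransition (updatePairLaw E p Φ) (driven Φ s e n) A ∂iidLaw E := by
  have hmd : ∀ n, Measurable fun e : ℕ → S => driven Φ s e n := fun n =>
    (measurable_driven hΦ.measurable n).comp measurable_prodMk_left
  have hA1 : Measurable (A.indicator (1 : ℝ → ENNReal)) := measurable_one.indicator hA
  have key := lintegral_iidLaw_eval E n
    (f := fun e v => F e * A.indicator 1 (Φ (driven Φ s e n) v))
    ((hF.comp measurable_fst).mul (hA1.comp (hΦ.measurable.comp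
      (((hmd n).comp measurable_fst).prodMk measurable_snd))))
    (fun e v w => by simp only [driven_update Φ s e w le_rfl, hdep])
  refine key.trans (lintegral_congr_ae ?_)
  filter_upwards [hΦ.ae_signProb_pos_driven hν hs n] with e he
  have hAe : Measurable fun v => A.indicator (1 : ℝ → ENNReal) (Φ (driven Φ s e n) v) :=
    hA1.comp (hΦ.measurable_left _)
  rw [lintegral_const_mul _ hAe, ← hΦ.lintegral_tailTransition_eq he hA1,
    lintegral_indicator_one hA]

end DrivenMarkov

section TwoSidedDriven

variable {S₁ S₂ : Type*} {Φ₁ : ℝ → S₁ → ℝ} {Φ₂ : ℝ → S₂ → ℝ}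

/-- The two-sided sequence driven forward by `Φ₁` and backward by `Φ₂`. -/
def twoSidedDriven (Φ₁ : ℝ → S₁ → ℝ) (Φ₂ : ℝ → S₂ → ℝ) (q : ℝ × (ℕ → S₁) × (ℕ → S₂))
    (k : ℤ) : ℝ :=
  if 0 ≤ k then driven Φ₁ q.1 q.2.1 k.toNat else driven Φ₂ q.1 q.2.2 (-k).toNat

theorem twoSidedDriven_natCast (q : ℝ × (ℕ → S₁) × (ℕ → S₂)) (n : ℕ) :
    twoSidedDriven Φ₁ Φ₂ q n = driven Φ₁ q.1 q.2.1 n := by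
  simp [twoSidedDriven]

theorem reverseSeq_twoSidedDriven (s : ℝ) (e₁ : ℕ → S₁) (e₂ : ℕ → S₂) :
    reverseSeq (twoSidedDriven Φ₁ Φ₂ (s, e₁, e₂)) = twoSidedDriven Φ₂ Φ₁ (s, e₂, e₁) := by
  ext k
  simp only [reverseSeq, twoSidedDriven, neg_neg]
  rcases lt_trichotomy k 0 with h | rfl | h
  · rw [if_pos (by omega), if_neg (by omega)]
  · simp [driven]
  · rw [if_neg (by omega), if_pos (by omega)]

end TwoSidedDriven

section TwoSided

variable {S₁ S₂ : Type*} [MeasurableSpace S₁] [MeasurableSpace S₂] {E₁ : Measure S₁}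
  {E₂ : Measure S₂} [IsProbabilityMeasure E₁] [IsProbabilityMeasure E₂] {α p : ℝ}
  {Φ₁ : ℝ → S₁ → ℝ} {Φ₂ : ℝ → S₂ → ℝ}

/-- The law of a two-sided driven sequence started at a random sign. -/
noncomputable def twoSidedLaw (E₁ : Measure S₁) [IsProbabilityMeasure E₁] (E₂ : Measure S₂)
    [IsProbabilityMeasure E₂] (p : ℝ) (Φ₁ : ℝ → S₁ → ℝ) (Φ₂ : ℝ → S₂ → ℝ) : Measure (ℤ → ℝ) :=
  ((signLaw p).prod ((iidLaw E₁).prod (iidLaw E₂))).map (twoSidedDriven Φ₁ Φ₂)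

theorem measurable_twoSidedDriven (h₁ : IsTailUpdate Φ₁) (h₂ : IsTailUpdate Φ₂) :
    Measurable (twoSidedDriven Φ₁ Φ₂) :=
  measurable_pi_iff.2 fun k => by
    unfold twoSidedDriven
    by_cases hk : 0 ≤ k
    · simp only [hk, if_true]
      exact (measurable_driven h₁.measurable _).comp (by fun_prop :
        Measurable fun q : ℝ × (ℕ → S₁) × (ℕ → S₂) => (q.1, q.2.1))
    · simp only [hk, if_false]
      exact (measurable_driven h₂.measurable _).comp (by fun_prop :
        Measurable fun q : ℝ × (ℕ → S₁) × (ℕ → S₂) => (q.1, q.2.2))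

theorem lintegral_twoSidedLaw (h₁ : IsTailUpdate Φ₁) (h₂ : IsTailUpdate Φ₂)
    {h : (ℤ → ℝ) → ENNReal} (hm : Measurable h) :
    ∫⁻ m, h m ∂twoSidedLaw E₁ E₂ p Φ₁ Φ₂ = ∫⁻ s, ∫⁻ e₁, ∫⁻ e₂,
      h (twoSidedDriven Φ₁ Φ₂ (s, e₁, e₂)) ∂iidLaw E₂ ∂iidLaw E₁ ∂signLaw p := by
  have hmd := measurable_twoSidedDriven h₁ h₂
  have hmc : Measurable fun q => h (twoSidedDriven Φ₁ Φ₂ q) := hm.comp hmd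
  rw [twoSidedLaw, lintegral_map hm hmd, lintegral_prod _ hmc.aemeasurable]
  refine lintegral_congr fun s => ?_
  have hms : Measurable fun e => h (twoSidedDriven Φ₁ Φ₂ (s, e)) := hmc.comp measurable_prodMk_left
  exact lintegral_prod _ hms.aemeasurable

theorem lintegral_twoSidedLaw_swap (h₁ : IsTailUpdate Φ₁) (h₂ : IsTailUpdate Φ₂)
    {h : (ℤ → ℝ) → ENNReal} (hm : Measurable h) :
    ∫⁻ m, h m ∂twoSidedLaw E₁ E₂ p Φ₁ Φ₂ = ∫⁻ s, ∫⁻ e₂, ∫⁻ e₁,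
      h (twoSidedDriven Φ₁ Φ₂ (s, e₁, e₂)) ∂iidLaw E₁ ∂iidLaw E₂ ∂signLaw p := by
  rw [lintegral_twoSidedLaw h₁ h₂ hm]
  refine lintegral_congr fun s => lintegral_lintegral_swap ?_
  exact ((hm.comp (measurable_twoSidedDriven h₁ h₂)).comp measurable_prodMk_left).aemeasurable

theorem map_reverseSeq_twoSidedLaw (h₁ : IsTailUpdate Φ₁) (h₂ : IsTailUpdate Φ₂) :
    (twoSidedLaw E₁ E₂ p Φ₁ Φ₂).map reverseSeq = twoSidedLaw E₂ E₁ p Φ₂ Φ₁ := by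
  refine Measure.ext_of_lintegral _ fun h hm => ?_
  have hmr : Measurable fun m => h (reverseSeq m) := hm.comp measurable_reverseSeq
  rw [lintegral_map hm measurable_reverseSeq, lintegral_twoSidedLaw h₁ h₂ hmr,
    lintegral_twoSidedLaw_swap h₂ h₁ hm]
  simp only [reverseSeq_twoSidedDriven]

theorem map_forward_twoSidedLaw (h₁ : IsTailUpdate Φ₁) (h₂ : IsTailUpdate Φ₂) :
    (twoSidedLaw E₁ E₂ p Φ₁ Φ₂).map (fun m => (m 0, m 1)) = updatePairLaw E₁ p Φ₁ := by
  refine Measure.ext_of_lintegral _ fun f hf => ?_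
  have hm : Measurable fun m : ℤ → ℝ => f (m 0, m 1) := hf.comp (by fun_prop)
  have hfp : Measurable fun q : ℝ × S₁ => f (q.1, Φ₁ q.1 q.2) := hf.comp h₁.measurable_pair
  rw [lintegral_map hf (by fun_prop), lintegral_twoSidedLaw h₁ h₂ hm, updatePairLaw,
    lintegral_map hf h₁.measurable_pair, lintegral_prod _ hfp.aemeasurable]
  refine lintegral_congr fun s => ?_
  have e0 : ∀ q, twoSidedDriven Φ₁ Φ₂ q 0 = q.1 := fun q => twoSidedDriven_natCast q 0
  have e1 : ∀ q, twoSidedDriven Φ₁ Φ₂ q 1 = Φ₁ q.1 (q.2.1 0) := fun q => twoSidedDriven_natCast q 1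
  have hfs : Measurable fun v => f (s, Φ₁ s v) := hfp.comp measurable_prodMk_left
  have key := lintegral_iidLaw_eval E₁ 0 (f := fun _ v => f (s, Φ₁ s v))
    (hfs.comp measurable_snd) (fun _ _ _ => rfl)
  simpa [e0, e1] using key

/-- The past up to time `t` depends on the initial sign, the backward innovations and the first `t`
forward innovations. With sign and backward innovations frozen, the next forward innovation is
fresh, so the one-sided Markov property applies. -/
theorem twoSidedLaw_forward_step (h₁ : IsTailUpdate Φ₁) (h₂ : IsTailUpdate Φ₂)
    (hμ : IsTailPairLaw p α (updatePairLaw E₁ p Φ₁)) (t : ℕ) (B : Set (ℕ → ℝ)) (A : Set ℝ)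
    (hB : MeasurableSet B) (hA : MeasurableSet A) :
    twoSidedLaw E₁ E₂ p Φ₁ Φ₂ {m | (fun k : ℕ => m ((t : ℤ) - k)) ∈ B ∧ m ((t : ℤ) + 1) ∈ A} =
      ∫⁻ m in {m | (fun k : ℕ => m ((t : ℤ) - k)) ∈ B},
        tailTransition (updatePairLaw E₁ p Φ₁) (m t) A ∂twoSidedLaw E₁ E₂ p Φ₁ Φ₂ := by
  have hpast : Measurable fun (m : ℤ → ℝ) (k : ℕ) => m ((t : ℤ) - k) := by fun_prop
  have hBm : MeasurableSet {m : ℤ → ℝ | (fun k : ℕ => m ((t : ℤ) - k)) ∈ B} := hpast hB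
  have hAm : MeasurableSet {m : ℤ → ℝ | m ((t : ℤ) + 1) ∈ A} :=
    (measurable_pi_apply (_ : ℤ)) hA
  set G : (ℤ → ℝ) → ENNReal := fun m => B.indicator 1 fun k : ℕ => m ((t : ℤ) - k) with hG
  have hGm : Measurable G := (measurable_one.indicator hB).comp hpast
  have hA1 : Measurable fun m : ℤ → ℝ => A.indicator (1 : ℝ → ENNReal) (m ((t : ℤ) + 1)) :=
    (measurable_one.indicator hA).comp (measurable_pi_apply _)
  have hT := measurable_tailTransition_apply (updatePairLaw E₁ p Φ₁)
    (measurable_pi_apply (t : ℤ) : Measurable fun m : ℤ → ℝ => m t) hA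
  have eL : twoSidedLaw E₁ E₂ p Φ₁ Φ₂
      {m | (fun k : ℕ => m ((t : ℤ) - k)) ∈ B ∧ m ((t : ℤ) + 1) ∈ A} =
      ∫⁻ m, G m * A.indicator 1 (m ((t : ℤ) + 1)) ∂twoSidedLaw E₁ E₂ p Φ₁ Φ₂ := by
    refine (lintegral_indicator_one (hBm.inter hAm)).symm.trans (lintegral_congr fun m => ?_)
    rw [Set.inter_indicator_one]
    rfl
  have eR : ∫⁻ m in {m | (fun k : ℕ => m ((t : ℤ) - k)) ∈ B},
        tailTransition (updatePairLaw E₁ p Φ₁) (m t) A ∂twoSidedLaw E₁ E₂ p Φ₁ Φ₂ =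
      ∫⁻ m, G m * tailTransition (updatePairLaw E₁ p Φ₁) (m t) A ∂twoSidedLaw E₁ E₂ p Φ₁ Φ₂ := by
    rw [← lintegral_indicator hBm]
    refine lintegral_congr fun m => ?_
    by_cases h : (fun k : ℕ => m ((t : ℤ) - k)) ∈ B
    · simp [hG, h]
    · simp [hG, h]
  have hGA : Measurable fun m => G m * A.indicator (1 : ℝ → ENNReal) (m ((t : ℤ) + 1)) :=
    hGm.mul hA1
  have hGT : Measurable fun m => G m * tailTransition (updatePairLaw E₁ p Φ₁) (m t) A := hGm.mul hT
  rw [eL, eR, lintegral_twoSidedLaw_swap h₁ h₂ hGA, lintegral_twoSidedLaw_swap h₁ h₂ hGT]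
  refine lintegral_congr_ae (ae_signLaw fun s hs hp => lintegral_congr fun e₂ => ?_)
  have hs' : s ≠ 0 → 0 < signProb p (Real.sign s) := fun _ => by
    rcases hs with rfl | rfl
    · simpa using hp
    · rwa [Real.sign_of_neg (by norm_num)]
  have hmt : Measurable fun e₁ : ℕ → S₁ => twoSidedDriven Φ₁ Φ₂ (s, e₁, e₂) :=
    (measurable_twoSidedDriven h₁ h₂).comp (by fun_prop)
  have key := h₁.lintegral_mul_indicator_driven hμ hs' t
    (F := fun e₁ => G (twoSidedDriven Φ₁ Φ₂ (s, e₁, e₂))) (hGm.comp hmt) (fun e w => by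
      simp only [hG]
      congr 2
      ext k
      simp only [twoSidedDriven]
      split_ifs with h
      · exact driven_update _ _ _ _ (by omega)
      · rfl) hA
  have e1 : ∀ e₁ : ℕ → S₁, twoSidedDriven Φ₁ Φ₂ (s, e₁, e₂) ((t : ℤ) + 1) =
      driven Φ₁ s e₁ (t + 1) := fun e₁ => twoSidedDriven_natCast (s, e₁, e₂) (t + 1)
  simpa only [twoSidedDriven_natCast, e1] using key

theorem isBackForthTailChain_twoSidedLaw (h0 : 0 ≤ p) (h1 : p ≤ 1)
    (h₁ : IsTailUpdate Φ₁) (h₂ : IsTailUpdate Φ₂)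
    (hμ₁ : IsTailPairLaw p α (updatePairLaw E₁ p Φ₁))
    (hμ₂ : IsTailPairLaw p α (updatePairLaw E₂ p Φ₂))
    (ha : AreAdjoint α (updatePairLaw E₁ p Φ₁) (updatePairLaw E₂ p Φ₂)) :
    IsBackForthTailChain α p (updatePairLaw E₁ p Φ₁) (twoSidedLaw E₁ E₂ p Φ₁ Φ₂) := by
  have hsign := isProbabilityMeasure_signLaw h0 h1
  have hf := map_forward_twoSidedLaw (E₁ := E₁) (E₂ := E₂) (p := p) h₁ h₂
  have hrev := map_reverseSeq_twoSidedLaw (E₁ := E₂) (E₂ := E₁) (p := p) h₂ h₁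
  have hb : (twoSidedLaw E₁ E₂ p Φ₁ Φ₂).map (fun m => (m 0, m (-1))) = updatePairLaw E₂ p Φ₂ := by
    rw [← hrev, Measure.map_map (by fun_prop) measurable_reverseSeq,
      ← map_forward_twoSidedLaw (E₁ := E₂) (E₂ := E₁) (p := p) h₂ h₁]
    rfl
  refine ⟨Measure.isProbabilityMeasure_map (measurable_twoSidedDriven h₁ h₂).aemeasurable, hμ₁, hf,
    by rwa [hb], by rwa [hb], fun t B A hB hA => ?_, fun t B A hB hA => ?_⟩
  · rw [hf]
    exact twoSidedLaw_forward_step h₁ h₂ hμ₁ t B A hB hA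
  · have hBm : MeasurableSet {m : ℤ → ℝ | (fun k : ℕ => m (-(t : ℤ) + k)) ∈ B} :=
      (show Measurable fun (m : ℤ → ℝ) (k : ℕ) => m (-(t : ℤ) + k) by fun_prop) hB
    have hAm : MeasurableSet {m : ℤ → ℝ | m (-(t : ℤ) - 1) ∈ A} :=
      (show Measurable fun m : ℤ → ℝ => m (-(t : ℤ) - 1) by fun_prop) hA
    rw [hb]
    rw [← hrev, Measure.map_apply measurable_reverseSeq (s := {m : ℤ → ℝ |
      (fun k : ℕ => m (-(t : ℤ) + k)) ∈ B ∧ m (-(t : ℤ) - 1) ∈ A}) (hBm.inter hAm),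
      setLIntegral_map hBm (measurable_tailTransition_apply _ (measurable_pi_apply (-(t : ℤ))) hA)
        measurable_reverseSeq]
    have e1 : ∀ k : ℕ, -(-(t : ℤ) + k) = t - k := fun k => by ring
    have e2 : -(-(t : ℤ) - 1) = t + 1 := by ring
    simp only [Set.preimage_ofPred_eq, reverseSeq, e1, e2, neg_neg]
    exact twoSidedLaw_forward_step h₂ h₁ hμ₂ t B A hB hA

/-- A back-and-forth tail chain exists for every tail pair law. -/
theorem exists_isBackForthTailChain (h0 : 0 ≤ p) (h1 : p ≤ 1) (hα : 0 < α) {μ : Measure (ℝ × ℝ)}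
    (hμ : IsTailPairLaw p α μ) : ∃ Q, IsBackForthTailChain α p μ Q := by
  have hμ' := isTailPairLaw_adjointLaw hμ h0 h1 hα
  have ha : AreAdjoint α μ (adjointLaw α p μ) := areAdjoint_adjointLaw hα
  obtain ⟨E₁, Φ₁, hE₁, h₁, e₁⟩ := hμ.exists_update h0 h1
  obtain ⟨E₂, Φ₂, hE₂, h₂, e₂⟩ := hμ'.exists_update h0 h1
  rw [e₂] at hμ' ha
  rw [e₁] at hμ ha ⊢
  exact ⟨_, isBackForthTailChain_twoSidedLaw h0 h1 h₁ h₂ hμ hμ' ha⟩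

end TwoSided

theorem IsTailUpdate.ae_signProb_pos {S : Type*} [MeasurableSpace S] {E : Measure S}
    [IsProbabilityMeasure E] {α p : ℝ} {Φ : ℝ → S → ℝ} (hΦ : IsTailUpdate Φ)
    (hν : IsTailPairLaw p α (updatePairLaw E p Φ)) {x : ℝ}
    (hx : x ≠ 0 → 0 < signProb p (Real.sign x)) :
    ∀ᵐ v ∂E, Φ x v ≠ 0 → 0 < signProb p (Real.sign (Φ x v)) := by
  have hN := measurableSet_null_sign p
  have key := hΦ.lintegral_tailTransition_eq (E := E) hx (measurable_one.indicator hN)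
  have hNm : Measurable fun v => Set.indicator {z : ℝ | z ≠ 0 ∧ ¬ 0 < signProb p (Real.sign z)}
      (1 : ℝ → ENNReal) (Φ x v) := (measurable_one.indicator hN).comp (hΦ.measurable_left x)
  rw [lintegral_indicator_one hN, hν.tailTransition_null, eq_comm, lintegral_eq_zero_iff hNm] at key
  filter_upwards [key] with v hv hne
  by_contra hcon
  rw [Set.indicator_of_mem (show Φ x v ∈ {z : ℝ | z ≠ 0 ∧ ¬ 0 < signProb p (Real.sign z)} from
    ⟨hne, hcon⟩)] at hv
  simp at hv

/-! ### Extreme value limits -/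

section Extremes

variable {Ω : Type*} [MeasurableSpace Ω] {P : Measure Ω} [IsProbabilityMeasure P]

/-- The tail at `a n` tends to `0`, while the tail at any fixed level is positive; hence `a n`
eventually exceeds each level. -/
theorem tendsto_atTop_of_tendsto_mul_tail {Z : Ω → ℝ} (hpos : ∀ u, 0 < P.real {ω | u < |Z ω|})
    {a : ℕ → ℝ} (ha : Tendsto (fun n : ℕ => (n : ℝ) * P.real {ω | a n < |Z ω|}) atTop (𝓝 1)) :
    Tendsto a atTop atTop := by
  have h0 : Tendsto (fun n : ℕ => P.real {ω | a n < |Z ω|}) atTop (𝓝 0) := by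
    have := ha.mul tendsto_inv_atTop_nhds_zero_nat
    rw [mul_zero] at this
    refine this.congr' ?_
    filter_upwards [eventually_ne_atTop 0] with n hn
    have : (n : ℝ) ≠ 0 := Nat.cast_ne_zero.2 hn
    field_simp
  refine tendsto_atTop.2 fun K => ?_
  filter_upwards [h0.eventually_lt_const (hpos K)] with n hn
  by_contra! hK
  exact absurd hn (not_lt.2 (measureReal_mono fun ω hω => lt_of_le_of_lt hK.le hω))

/-- Dividing by `x i > 0` makes the event the complement of a joint exceedance of `a n`, whose
probability times `n` tends to `l`; then `(1 - l_n / n)^n → exp(-l)` for `l_n → l`. -/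
theorem tendsto_pow_of_tendsto_exceedance {t : ℕ} {X : ℕ → Ω → ℝ} (hX : ∀ i, Measurable (X i))
    (hpos : ∀ u, 0 < P.real {ω | u < |X 0 ω|}) {a : ℕ → ℝ}
    (ha : Tendsto (fun n : ℕ => (n : ℝ) * P.real {ω | a n < |X 0 ω|}) atTop (𝓝 1))
    {σ x : Fin (t + 1) → ℝ} (hx : ∀ i, 0 < x i) {l : ℝ}
    (hl : Tendsto (fun u : ℝ => P.real {ω | ∃ i : Fin (t + 1), u < σ i / x i * X i ω} /
      P.real {ω | u < |X 0 ω|}) atTop (𝓝 l)) :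
    Tendsto (fun n : ℕ => P.real {ω | ∀ i : Fin (t + 1), σ i * X i ω ≤ a n * x i} ^ n)
      atTop (𝓝 (Real.exp (-l))) := by
  have hat := tendsto_atTop_of_tendsto_mul_tail hpos ha
  have hm : ∀ u : ℝ, MeasurableSet {ω | ∃ i : Fin (t + 1), u < σ i / x i * X i ω} := fun u => by
    have : {ω | ∃ i : Fin (t + 1), u < σ i / x i * X i ω} =
        ⋃ i : Fin (t + 1), {ω | u < σ i / x i * X i ω} := by ext; simp
    rw [this]
    exact MeasurableSet.iUnion fun i => measurableSet_lt measurable_const ((hX _).const_mul _)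
  have hN : Tendsto (fun n : ℕ => (n : ℝ) *
      -P.real {ω | ∃ i : Fin (t + 1), a n < σ i / x i * X i ω}) atTop (𝓝 (-l)) := by
    have := (ha.mul (hl.comp hat)).neg
    rw [one_mul] at this
    refine this.congr fun n => ?_
    have := (hpos (a n)).ne'
    simp only [Function.comp]
    field_simp
  refine (Real.tendsto_one_add_pow_exp_of_tendsto hN).congr fun n => ?_
  rw [← sub_eq_add_neg, ← probReal_compl_eq_one_sub (hm (a n))]
  congr 2
  ext ω
  simp only [Set.mem_compl_iff, Set.mem_ofPred_eq, not_exists, not_lt]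
  refine forall_congr' fun i => ?_
  rw [div_mul_eq_mul_div, div_le_iff₀ (hx i)]

end Extremes

/-! ### The main theorem -/

theorem corollaryC {Ω S : Type*} [MeasurableSpace Ω] [MeasurableSpace S]
    (P : Measure Ω) [IsProbabilityMeasure P]
    (X : ℕ → Ω → ℝ) (ε : ℕ → Ω → S) (Ψ : ℝ → S → ℝ) (φ : S → ℝ → ℝ) (α p : ℝ)
    (hX : IsStationaryMarkovChain P X ε Ψ)
    (hRV : HasRegularlyVaryingTails P (X 0) α p)
    (hφ : HasTailIncrement (P.map (ε 0)) Ψ p φ)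
    (t : ℕ) :
    ∃ l : (Fin (t + 1) → ℝ) → ℝ,
      -- the limit defining `l_t` exists at every point
      (∀ x : Fin (t + 1) → ℝ,
        Tendsto (fun u : ℝ => P.real {ω | ∃ i : Fin (t + 1), u < x i * X i ω} /
          P.real {ω | u < |X 0 ω|}) atTop (𝓝 (l x))) ∧
      -- it is given by the back-and-forth tail chain, which exists
      (∃ Q : Measure (ℤ → ℝ),
        IsBackForthTailChain α p (forwardPairLaw (P.map (ε 0)) p φ) Q) ∧
      (∀ Q : Measure (ℤ → ℝ),
        IsBackForthTailChain α p (forwardPairLaw (P.map (ε 0)) p φ) Q →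
        ∀ x : Fin (t + 1) → ℝ,
          ENNReal.ofReal (l x) = tailDependenceForward α Q x ∧
          ENNReal.ofReal (l x) = tailDependenceBackward α Q x) ∧
      -- extreme value limits of the sign-changed vectors
      (∀ a : ℕ → ℝ,
        Tendsto (fun n : ℕ => (n : ℝ) * P.real {ω | a n < |X 0 ω|}) atTop (𝓝 1) →
        ∀ σ x : Fin (t + 1) → ℝ, (∀ i, σ i = 1 ∨ σ i = -1) → (∀ i, 0 < x i) →
          Tendsto
            (fun n : ℕ => P.real {ω | ∀ i : Fin (t + 1), σ i * X i ω ≤ a n * x i} ^ n)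
            atTop (𝓝 (Real.exp (-(l (fun i => σ i / x i)))))) := by

  have hE := hX.isProbabilityMeasure
  have hρ : IsProbabilityMeasure (P.map (X 0)) :=
    Measure.isProbabilityMeasure_map (hX.measurable_X 0).aemeasurable
  have hRV' := hRV.map (hX.measurable_X 0)
  have h0 := hRV.p_nonneg
  have h1 := hRV.p_le_one
  have hα := hRV.α_pos
  obtain ⟨Φ, hΦ, hlaw, hstep, hgrowth⟩ := hφ.exists_update hX.measurable_Ψ
  have hν : IsTailPairLaw p α (updatePairLaw (P.map (ε 0)) p Φ) :=
    isTailPairLaw_updatePairLaw hRV' hX.measurable_Ψ hΦ hstep hX.map_uncurry_eq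
  have hself : ∀ σ : ℝ, (σ = 1 ∨ σ = -1) → Real.sign σ = σ := fun σ hσ => by
    rcases hσ with rfl | rfl
    · exact Real.sign_one
    · exact Real.sign_of_neg (by norm_num)
  -- Since the one-step law is already known to be a tail pair law, `Φ` never leads to a sign of
  -- weight zero; this is what allows the one-step limits to be iterated.
  have hsign : ∀ᵐ v ∂P.map (ε 0), ∀ σ : ℝ, (σ = 1 ∨ σ = -1) → 0 < signProb p σ →
      ∀ τ : ℝ, (τ = 1 ∨ τ = -1) → 0 < τ * Φ σ v → 0 < signProb p τ := by
    have key : ∀ σ : ℝ, (σ = 1 ∨ σ = -1) → ∀ᵐ v ∂P.map (ε 0), 0 < signProb p σ →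
        Φ σ v ≠ 0 → 0 < signProb p (Real.sign (Φ σ v)) := fun σ hσ => by
      by_cases hp : 0 < signProb p σ
      · filter_upwards [hΦ.ae_signProb_pos hν (x := σ) fun _ => by rwa [hself σ hσ]] with v hv _
        exact hv
      · exact .of_forall fun v h => absurd h hp
    filter_upwards [key 1 (Or.inl rfl), key (-1) (Or.inr rfl)] with v hv1 hv2 σ hσ hp τ hτ hpos
    have h : Φ σ v ≠ 0 → 0 < signProb p (Real.sign (Φ σ v)) := by
      rcases hσ with rfl | rfl
      exacts [hv1 hp, hv2 hp]
    have hτ' : Real.sign (Φ σ v) = τ := by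
      rcases hτ with rfl | rfl
      · exact Real.sign_of_pos (by linarith)
      · exact Real.sign_of_neg (by linarith)
    exact hτ' ▸ h (right_ne_zero_of_mul hpos.ne')
  have hlim := ae_driven_tendsto hΦ hstep hsign hgrowth
  choose l hl0 hl1 hl2 using exists_tail_dependence_limit hX hRV hΦ hlim t
  refine ⟨l, hl1, ?_, fun Q hQ x => ?_, fun a ha σ x _ hx => ?_⟩
  · rw [hlaw]
    exact exists_isBackForthTailChain h0 h1 hα hν
  · rw [hlaw] at hQ
    have : ENNReal.ofReal (l x) = tailDependenceForward α Q x :=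
      (hl2 x).trans (hQ.sum_last_exceedance hΦ h0 h1 hα x)
    exact ⟨this, this.trans (hQ.tailDependenceForward_eq_backward h0 h1 hα x)⟩
  · refine tendsto_pow_of_tendsto_exceedance hX.measurable_X (fun u => ?_) ha hx (hl1 _)
    have := hRV'.tail_pos u
    rwa [map_measureReal_apply (hX.measurable_X 0)
      (measurableSet_lt measurable_const (by fun_prop))] at this
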